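/- Let $\mathbb{D}\subset\mathbb{C}$ be the open unit disk and $m$ Lebesgue measure. For $t>-1$ let $d\lambda_t(z)=\frac{t+1}{\pi}(1-|z|^2)^t\,dm(z)$ on $\mathbb{D}$, let $P^{(t)}$ be the orthogonal projection of $L^2(\mathbb{D},\lambda_t)$ onto its closed subspace of holomorphic functions (the weighted Bergman space), and for a bounded symbol $g$ let $H^{(t)}_g=(I-P^{(t)})M_gP^{(t)}$ be the Hankel operator on $L^2(\mathbb{D},\lambda_t)$, where $M_g$ is multiplication by $g$. Let $\|T\|_{S^2}=\mathrm{Tr}(T^*T)^{1/2}$ denote the Hilbert–Schmidt norm. Put $\varphi_z(w)=\frac{z-w}{1-w\bar z}$, $\bar\partial=\frac12(\partial_x+i\partial_y)$, $\Delta=\partial_x^2+\partial_y^2$, and for $s\in(0,1)$ $$\varrho_t(s)=\frac{t+1}{16\pi^2}\int_s^1(1-x)^t x^{-1}F(s,x)\,dx,\qquad F(s,x)=-\Big[x\ln\frac{s}{x}+(1-x)\ln\frac{1-s}{1-x}\Big].$$ Let $g$ be a complex-valued function that is $C^2$ on the closed disk $\overline{\mathbb{D}}$. Then for every $t>-1$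 the operator $H^{(t)}_g$ is Hilbert–Schmidt, the integrals below (and the one defining $\varrho_t(s)$, $0<s<1$) converge absolutely, and $$\|H^{(t)}_g\|_{S^2}^2=\frac1\pi\int_{\mathbb{D}}|\bar\partial g|^2\,dm-\int_{\mathbb{D}^2}\varrho_t(|\varphi_z(w)|^2)\,\Delta\bar g(z)\,\Delta g(w)\,dm(z,w).$$ Moreover $$\lim_{t\to\infty}\|H^{(t)}_g\|_{S^2}^2=\frac1\pi\int_{\mathbb{D}}|\bar\partial g|^2\,dm.$$ -/

import Mathlib

open MeasureTheory Metric Set Filter Topology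
open scoped ENNReal ComplexConjugate InnerProductSpace Laplacian

noncomputable section

namespace HankelHS

/-! ### Hilbert-Schmidt operators -/


/-- `Tr (T* T) = ∑ ‖T eᵢ‖²` over a Hilbert basis, as an element of `[0, ∞]`. By
`hsNormSq_eq_tsum` below the value is the same for every Hilbert basis. -/
def hsNormSq {E : Type*} [NormedAddCommGroup E] [InnerProductSpace ℂ E] [CompleteSpace E]
    (T : E →L[ℂ] E) : ℝ≥0∞ :=
  ∑' i, ‖T ((exists_hilbertBasis ℂ E).choose_spec.choose i)‖ₑ ^ 2

/-- The Schatten class `S²`. -/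
def IsHilbertSchmidt {E : Type*} [NormedAddCommGroup E] [InnerProductSpace ℂ E] [CompleteSpace E]
    (T : E →L[ℂ] E) : Prop := hsNormSq T ≠ ⊤

/-- The Hilbert-Schmidt norm `‖T‖_{S²} = Tr (T* T) ^ (1/2)`, meaningful for `T` in `S²`. -/
def hsNorm {E : Type*} [NormedAddCommGroup E] [InnerProductSpace ℂ E] [CompleteSpace E]
    (T : E →L[ℂ] E) : ℝ := Real.sqrt (hsNormSq T).toReal

theorem enorm_sq_eq_tsum {E : Type*} [NormedAddCommGroup E] [InnerProductSpace ℂ E] {ι : Type*}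
    (b : HilbertBasis ι ℂ E) (x : E) :
    ‖x‖ₑ ^ 2 = ∑' i, ‖⟪b i, x⟫_ℂ‖ₑ ^ 2 := by
  have h1 : HasSum (fun i => ‖⟪b i, x⟫_ℂ‖ ^ 2) (‖x‖ ^ 2) := by
    have h := (b.hasSum_inner_mul_inner x x).mapL Complex.reCLM
    convert h using 1
    · funext i
      rw [← inner_conj_symm x (b i)]
      simp only [Complex.reCLM_apply]
      rw [← Complex.normSq_eq_conj_mul_self, Complex.ofReal_re, Complex.normSq_eq_norm_sq]
    · simp only [Complex.reCLM_apply]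
      rw [inner_self_eq_norm_sq_to_K]
      norm_cast
  have h2 := ENNReal.ofReal_tsum_of_nonneg (fun i => sq_nonneg ‖⟪b i, x⟫_ℂ‖) h1.summable
  rw [h1.tsum_eq] at h2
  simpa only [ENNReal.ofReal_pow (norm_nonneg _), ofReal_norm] using h2

theorem tsum_enorm_sq_adjoint {E : Type*} [NormedAddCommGroup E] [InnerProductSpace ℂ E] [CompleteSpace E]
    {ι κ : Type*} (b : HilbertBasis ι ℂ E) (c : HilbertBasis κ ℂ E)
    (T : E →L[ℂ] E) :
    ∑' i, ‖T (b i)‖ₑ ^ 2 = ∑' j, ‖(ContinuousLinearMap.adjoint T) (c j)‖ₑ ^ 2 := by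
  simp_rw [enorm_sq_eq_tsum c (T _), enorm_sq_eq_tsum b (ContinuousLinearMap.adjoint T _)]
  rw [ENNReal.tsum_comm]
  refine tsum_congr fun j => tsum_congr fun i => ?_
  rw [ContinuousLinearMap.adjoint_inner_right, ← ofReal_norm, ← ofReal_norm, norm_inner_symm]

theorem hsNormSq_eq_tsum {E : Type*} [NormedAddCommGroup E] [InnerProductSpace ℂ E] [CompleteSpace E]
    {ι : Type*} (b : HilbertBasis ι ℂ E) (T : E →L[ℂ] E) :
    hsNormSq T = ∑' i, ‖T (b i)‖ₑ ^ 2 := by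
  unfold hsNormSq
  rw [tsum_enorm_sq_adjoint b b T, tsum_enorm_sq_adjoint _ b T]

/-! ### Weighted Bergman spaces on the unit disk -/

/-- The open unit disk. -/
def disk : Set ℂ := ball 0 1

/-- The density `((t + 1) / π) (1 - |z|²)^t`. -/
def weight (t : ℝ) (z : ℂ) : ℝ := (t + 1) / Real.pi * (1 - ‖z‖ ^ 2) ^ t

/-- The measure `dλ_t(z) = ((t + 1) / π) (1 - |z|²)^t dm(z)` on the disk. -/
def lam (t : ℝ) : Measure ℂ :=
  (volume.restrict disk).withDensity fun z => ENNReal.ofReal (weight t z)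

/-- The space `L²(λ_t)`. -/
abbrev L2 (t : ℝ) : Type := Lp ℂ 2 (lam t)

/-- The weighted Bergman space: the elements of `L²(λ_t)` represented by a holomorphic function
on the disk. -/
def bergman (t : ℝ) : Submodule ℂ (L2 t) where
  carrier := {f | ∃ h : ℂ → ℂ, DifferentiableOn ℂ h disk ∧ f =ᵐ[lam t] h}
  add_mem' := by
    rintro f f' ⟨h, hd, hh⟩ ⟨h', hd', hh'⟩
    exact ⟨h + h', hd.add hd', (Lp.coeFn_add f f').trans (hh.add hh')⟩
  zero_mem' := ⟨0, differentiableOn_const 0, Lp.coeFn_zero ..⟩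
  smul_mem' := by
    rintro c f ⟨h, hd, hh⟩
    exact ⟨c • h, hd.const_smul c, (Lp.coeFn_smul c f).trans (hh.const_smul c)⟩

theorem lam_ac (t : ℝ) : lam t ≪ volume.restrict disk := withDensity_absolutelyContinuous _ _

/-- Mean value inequality on a disk. -/
theorem enorm_mul_le_lintegral {h : ℂ → ℂ} (hd : DifferentiableOn ℂ h disk) {z : ℂ} {δ : ℝ}
    (hδ : 0 < δ) (hz : closedBall z δ ⊆ disk) :
    ENNReal.ofReal (Real.pi * δ ^ 2) * ‖h z‖ₑ ≤ ∫⁻ w in ball z δ, ‖h w‖ₑ := by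
  have hcont : ContinuousOn h disk := hd.continuousOn
  -- the circle inequality
  have hcirc : ∀ r ∈ Ioo 0 δ, ENNReal.ofReal (2 * Real.pi) * ‖h z‖ₑ ≤
      ∫⁻ θ in Ioo (-Real.pi) Real.pi, ‖h (circleMap z r θ)‖ₑ := by
    intro r hr
    have hsub : closedBall z |r| ⊆ disk := by
      rw [abs_of_pos hr.1]
      exact (closedBall_subset_closedBall hr.2.le).trans hz
    have havg : Real.circleAverage h z r = h z := by
      apply DiffContOnCl.circleAverage
      refine DifferentiableOn.diffContOnCl ?_
      exact hd.mono (closure_ball_subset_closedBall.trans hsub)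
    have hper : Function.Periodic (fun θ => h (circleMap z r θ)) (2 * Real.pi) := fun θ => by
      simp only [periodic_circleMap z r θ]
    have heq : (2 * Real.pi : ℝ) • h z =
        ∫ θ in Ioo (-Real.pi) Real.pi, h (circleMap z r θ) := by
      rw [← havg, Real.circleAverage_def, smul_smul, mul_inv_cancel₀ (by positivity), one_smul]
      rw [← integral_Ioc_eq_integral_Ioo,
        ← intervalIntegral.integral_of_le (by linarith [Real.pi_pos])]
      have := hper.intervalIntegral_add_eq 0 (-Real.pi)
      rw [zero_add] at this
      rw [this]
      congr 1
      ring
    calc ENNReal.ofReal (2 * Real.pi) * ‖h z‖ₑ = ‖(2 * Real.pi : ℝ) • h z‖ₑ := by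
          rw [enorm_smul, Real.enorm_eq_ofReal (by positivity)]
      _ ≤ _ := by rw [heq]; exact enorm_integral_le_lintegral_enorm _
  -- polar coordinates
  have hpol : ∫⁻ w in ball z δ, ‖h w‖ₑ =
      ∫⁻ p in polarCoord.target, ENNReal.ofReal p.1 •
        (ball z δ).indicator (fun w => ‖h w‖ₑ) (z + Complex.polarCoord.symm p) := by
    rw [Complex.lintegral_comp_polarCoord_symm
      (fun w => (ball z δ).indicator (fun w => ‖h w‖ₑ) (z + w)),
      lintegral_add_left_eq_self, lintegral_indicator measurableSet_ball]
  have hmeas : Measurable ((ball z δ).indicator fun w => ‖h w‖ₑ) := by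
    have : ContinuousOn (fun w => ‖h w‖ₑ) (ball z δ) :=
      (continuous_enorm.comp_continuousOn hcont).mono (ball_subset_closedBall.trans hz)
    classical
    have h1 := this.measurable_piecewise (g := fun _ => (0 : ℝ≥0∞)) continuousOn_const
      measurableSet_ball
    have h2 : (ball z δ).piecewise (fun w => ‖h w‖ₑ) (fun _ => (0 : ℝ≥0∞)) =
        (ball z δ).indicator fun w => ‖h w‖ₑ := piecewise_eq_indicator
    rwa [h2] at h1
  have hsymm : ∀ r θ : ℝ, z + Complex.polarCoord.symm (r, θ) = circleMap z r θ := by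
    intro r θ
    simp [circleMap, Complex.polarCoord_symm_apply, Complex.exp_mul_I]
  have hm2 : Measurable fun p : ℝ × ℝ => ENNReal.ofReal p.1 •
      (ball z δ).indicator (fun w => ‖h w‖ₑ) (z + Complex.polarCoord.symm p) := by
    refine (ENNReal.measurable_ofReal.comp measurable_fst).smul (hmeas.comp ?_)
    have : (fun p : ℝ × ℝ => z + Complex.polarCoord.symm p) =
        fun p => circleMap z p.1 p.2 := by
      funext p; exact hsymm p.1 p.2
    rw [this]
    have : Continuous fun p : ℝ × ℝ => circleMap z p.1 p.2 := by
      unfold circleMap; fun_prop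
    exact this.measurable
  rw [hpol, polarCoord_target, Measure.volume_eq_prod, ← Measure.prod_restrict,
    lintegral_prod _ hm2.aemeasurable]
  have hrad : ENNReal.ofReal (Real.pi * δ ^ 2) =
      ∫⁻ r in Ioo 0 δ, ENNReal.ofReal (2 * Real.pi * r) := by
    rw [← ofReal_integral_eq_lintegral_ofReal]
    · rw [← integral_Ioc_eq_integral_Ioo, ← intervalIntegral.integral_of_le hδ.le,
        intervalIntegral.integral_const_mul, integral_id]
      congr 1
      ring
    · exact (Continuous.integrableOn_Icc (by fun_prop)).mono_set Ioo_subset_Icc_self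
    · filter_upwards [ae_restrict_mem measurableSet_Ioo] with r hr
      have := hr.1
      simp only [Pi.zero_apply]
      positivity
  rw [hrad, ← lintegral_mul_const _ (by fun_prop)]
  calc ∫⁻ r in Ioo 0 δ, ENNReal.ofReal (2 * Real.pi * r) * ‖h z‖ₑ
      ≤ ∫⁻ r in Ioo 0 δ, ∫⁻ θ in Ioo (-Real.pi) Real.pi, ENNReal.ofReal r •
          (ball z δ).indicator (fun w => ‖h w‖ₑ) (z + Complex.polarCoord.symm (r, θ)) := by
        refine setLIntegral_mono' measurableSet_Ioo fun r hr => ?_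
        have hin : ∀ θ : ℝ, circleMap z r θ ∈ ball z δ := fun θ => by
          rw [mem_ball, dist_eq_norm]
          simpa [circleMap, abs_of_pos hr.1] using hr.2
        simp_rw [hsymm, indicator_of_mem (hin _), smul_eq_mul]
        rw [lintegral_const_mul' _ _ ENNReal.ofReal_ne_top]
        calc ENNReal.ofReal (2 * Real.pi * r) * ‖h z‖ₑ
            = ENNReal.ofReal r * (ENNReal.ofReal (2 * Real.pi) * ‖h z‖ₑ) := by
              rw [ENNReal.ofReal_mul (by positivity)]; ring
          _ ≤ _ := by gcongr; exact hcirc r hr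
    _ ≤ _ := lintegral_mono_set fun r hr => hr.1

/-- Point evaluations are bounded on the Bergman space, uniformly on smaller disks. -/
theorem exists_enorm_le {t : ℝ} (ht : -1 < t) {r : ℝ} (hr : r < 1) :
    ∃ C : ℝ≥0∞, C ≠ ⊤ ∧ ∀ h : ℂ → ℂ, DifferentiableOn ℂ h disk → ∀ z ∈ closedBall (0 : ℂ) r,
      ‖h z‖ₑ ^ 2 ≤ C * eLpNorm h 2 (lam t) ^ 2 := by
  set δ := (1 - r) / 2 with hδ
  have hδ0 : 0 < δ := by rw [hδ]; linarith
  have hK : IsCompact (closedBall (0 : ℂ) (r + δ)) := isCompact_closedBall 0 _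
  have hlt : ∀ z ∈ closedBall (0 : ℂ) (r + δ), ‖z‖ < 1 := fun z hz => by
    rw [mem_closedBall_zero_iff] at hz
    rw [hδ] at hz; linarith
  have hpos1 : ∀ z ∈ closedBall (0 : ℂ) (r + δ), 0 < 1 - ‖z‖ ^ 2 := fun z hz => by
    have := hlt z hz
    nlinarith [norm_nonneg z]
  have hwpos : ∀ z ∈ closedBall (0 : ℂ) (r + δ), 0 < weight t z := fun z hz => by
    have := hpos1 z hz
    have : 0 < t + 1 := by linarith
    unfold weight
    positivity
  have hwc : ContinuousOn (weight t) (closedBall (0 : ℂ) (r + δ)) := by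
    unfold weight
    refine continuousOn_const.mul (ContinuousOn.rpow_const (by fun_prop) fun z hz => ?_)
    exact Or.inl (hpos1 z hz).ne'
  obtain ⟨c, hc0, hc⟩ : ∃ c : ℝ, 0 < c ∧ ∀ z ∈ closedBall (0 : ℂ) (r + δ), c ≤ weight t z := by
    rcases (closedBall (0 : ℂ) (r + δ)).eq_empty_or_nonempty with he | hne
    · exact ⟨1, one_pos, by simp [he]⟩
    · obtain ⟨x, hx, hmin⟩ := hK.exists_isMinOn hne hwc
      exact ⟨weight t x, hwpos x hx, fun z hz => hmin hz⟩
  have hBdisk : closedBall (0 : ℂ) (r + δ) ⊆ disk := fun z hz => by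
    simpa [disk] using hlt z hz
  have hle : ∀ f : ℂ → ℝ≥0∞, ENNReal.ofReal c * ∫⁻ w in closedBall 0 (r + δ), f w ≤
      ∫⁻ w, f w ∂(lam t) := by
    intro f
    rw [← smul_eq_mul, ← lintegral_smul_measure]
    refine lintegral_mono' (Measure.le_iff.2 fun s hs => ?_) le_rfl
    rw [lam, withDensity_apply _ hs, Measure.smul_apply, smul_eq_mul, Measure.restrict_apply hs,
      Measure.restrict_restrict hs]
    calc ENNReal.ofReal c * volume (s ∩ closedBall 0 (r + δ))
        = ∫⁻ _ in s ∩ closedBall 0 (r + δ), ENNReal.ofReal c := by simp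
      _ ≤ ∫⁻ w in s ∩ closedBall 0 (r + δ), ENNReal.ofReal (weight t w) :=
          setLIntegral_mono' (hs.inter measurableSet_closedBall) fun w hw =>
            ENNReal.ofReal_le_ofReal (hc w hw.2)
      _ ≤ _ := lintegral_mono_set (inter_subset_inter_right s hBdisk)
  have ha0 : ENNReal.ofReal (Real.pi * δ ^ 2) ≠ 0 := by
    simp only [ne_eq, ENNReal.ofReal_eq_zero, not_le]; positivity
  have hc0' : ENNReal.ofReal c ≠ 0 := by simpa using hc0
  refine ⟨(ENNReal.ofReal c * ENNReal.ofReal (Real.pi * δ ^ 2))⁻¹, ?_, fun h hd z hz => ?_⟩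
  · rw [ne_eq, ENNReal.inv_eq_top]
    exact mul_ne_zero hc0' ha0
  have hsub : closedBall z δ ⊆ closedBall 0 (r + δ) := by
    refine closedBall_subset_closedBall' ?_
    rw [mem_closedBall] at hz
    linarith
  have h1 := enorm_mul_le_lintegral (hd.pow 2) hδ0 (hsub.trans hBdisk)
  simp only [Pi.pow_apply, enorm_pow] at h1
  have h2 : ENNReal.ofReal c * (ENNReal.ofReal (Real.pi * δ ^ 2) * ‖h z‖ₑ ^ 2) ≤
      eLpNorm h 2 (lam t) ^ 2 := by
    calc _ ≤ ENNReal.ofReal c * ∫⁻ w in closedBall 0 (r + δ), ‖h w‖ₑ ^ 2 := by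
          gcongr
          exact h1.trans (lintegral_mono_set (ball_subset_closedBall.trans hsub))
      _ ≤ ∫⁻ w, ‖h w‖ₑ ^ 2 ∂(lam t) := hle _
      _ = eLpNorm h 2 (lam t) ^ 2 := by
          have := eLpNorm_nnreal_pow_eq_lintegral (f := h) (μ := lam t) (p := 2) (by norm_num)
          norm_num at this
          exact this.symm
  rw [← mul_assoc] at h2
  rw [mul_comm (_)⁻¹, ← div_eq_mul_inv]
  rw [ENNReal.le_div_iff_mul_le (Or.inl (mul_ne_zero hc0' ha0))
    (Or.inl (ENNReal.mul_ne_top ENNReal.ofReal_ne_top ENNReal.ofReal_ne_top)), mul_comm]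
  exact h2

theorem isClosed_bergman (t : ℝ) : IsClosed (bergman t : Set (L2 t)) := by
  rcases le_or_gt t (-1) with ht | ht
  · have h0 : lam t = 0 := by
      refine withDensity_eq_zero_iff (by unfold weight; fun_prop) |>.2 ?_
      filter_upwards [ae_restrict_mem (measurableSet_ball (x := (0 : ℂ)) (ε := 1))] with z hz
      have hz' : ‖z‖ < 1 := by simpa [disk] using hz
      have hp : 0 < 1 - ‖z‖ ^ 2 := by nlinarith [norm_nonneg z]
      simp only [Pi.zero_apply, ENNReal.ofReal_eq_zero, weight]
      refine mul_nonpos_of_nonpos_of_nonneg ?_ (by positivity)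
      exact div_nonpos_of_nonpos_of_nonneg (by linarith) Real.pi_pos.le
    have : (bergman t : Set (L2 t)) = univ := by
      refine eq_univ_of_forall fun f => ⟨0, differentiableOn_const 0, ?_⟩
      have hb : ae (lam t) = ⊥ := ae_eq_bot.2 h0
      rw [EventuallyEq, hb]
      exact eventually_bot
    rw [this]
    exact isClosed_univ
  refine isClosed_of_closure_subset fun f hf => ?_
  obtain ⟨u, hu, hlim⟩ := mem_closure_iff_seq_limit.1 hf
  choose h hd hh using hu
  have hdiff : ∀ m n, eLpNorm (h m - h n) 2 (lam t) = edist (u m) (u n) := fun m n => by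
    rw [Lp.edist_def]
    exact eLpNorm_congr_ae ((hh m).sub (hh n)).symm
  have hcauchy : CauchySeq u := hlim.cauchySeq
  -- uniform Cauchy on smaller closed disks
  have hunif : ∀ r < 1, UniformCauchySeqOn h atTop (closedBall (0 : ℂ) r) := by
    intro r hr
    obtain ⟨C, hC, hle⟩ := exists_enorm_le ht hr
    rw [Metric.uniformCauchySeqOn_iff]
    intro ε hε
    have hC1 : 0 < C.toReal + 1 := by positivity
    obtain ⟨N, hN⟩ := Metric.cauchySeq_iff.1 hcauchy (ε / (C.toReal + 1)) (by positivity)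
    refine ⟨N, fun m hm n hn z hz => ?_⟩
    have h1 := hle (h m - h n) ((hd m).sub (hd n)) z hz
    rw [hdiff, Pi.sub_apply, ← edist_eq_enorm_sub, edist_dist, edist_dist,
      ← ENNReal.ofReal_toReal hC, ← ENNReal.ofReal_pow dist_nonneg,
      ← ENNReal.ofReal_pow dist_nonneg, ← ENNReal.ofReal_mul ENNReal.toReal_nonneg,
      ENNReal.ofReal_le_ofReal_iff (by positivity)] at h1
    have h2 := hN m hm n hn
    rw [lt_div_iff₀ hC1] at h2
    have h0 : 0 ≤ C.toReal := ENNReal.toReal_nonneg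
    have h3 : 0 ≤ dist (u m) (u n) := dist_nonneg
    have h4 : dist (h m z) (h n z) ^ 2 ≤ (dist (u m) (u n) * (C.toReal + 1)) ^ 2 := by
      refine h1.trans ?_
      rw [mul_pow, mul_comm]
      gcongr
      nlinarith
    exact (abs_le_of_sq_le_sq' h4 (by positivity)).2.trans_lt h2
  have hptc : ∀ z ∈ disk, CauchySeq fun n => h n z := fun z hz => by
    have := (hunif ‖z‖ (by simpa [disk] using hz)).cauchySeq (x := z) (by simp)
    exact this
  choose! l hl using fun z hz => cauchySeq_tendsto_of_complete (hptc z hz)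
  have hloc : TendstoLocallyUniformlyOn h l atTop disk := by
    rw [tendstoLocallyUniformlyOn_iff_forall_isCompact (show IsOpen disk from isOpen_ball)]
    intro K hKs hK
    obtain ⟨r, hr, hKr⟩ : ∃ r < 1, K ⊆ closedBall (0 : ℂ) r := by
      rcases K.eq_empty_or_nonempty with he | hne
      · exact ⟨0, one_pos, by simp [he]⟩
      · obtain ⟨x, hx, hmax⟩ := hK.exists_isMaxOn hne continuous_norm.continuousOn
        exact ⟨‖x‖, by simpa [disk] using hKs hx, fun y hy => by simpa using hmax hy⟩
    exact ((hunif r hr).mono hKr).tendstoUniformlyOn_of_tendsto fun z hz => hl z (hKs hz)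
  refine ⟨l, hloc.differentiableOn (Eventually.of_forall hd) isOpen_ball, ?_⟩
  obtain ⟨φ, hφ, hae⟩ := (tendstoInMeasure_of_tendsto_Lp hlim).exists_seq_tendsto_ae
  have hmem : ∀ᵐ z ∂(lam t), z ∈ disk := (lam_ac t).ae_le (ae_restrict_mem measurableSet_ball)
  filter_upwards [hae, hmem, ae_all_iff.2 hh] with z hz hzd hzh
  refine tendsto_nhds_unique hz ?_
  simp_rw [hzh]
  exact (hl z hzd).comp hφ.tendsto_atTop

instance instCompleteBergman (t : ℝ) : CompleteSpace (bergman t) :=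
  (isClosed_bergman t).completeSpace_coe

/-- The Bergman projection `P^(t)`, as an operator on `L²(λ_t)`. -/
def bergmanProj (t : ℝ) : L2 t →L[ℂ] L2 t := (bergman t).starProjection

/-- The multiplication operator `M_g` on `L²(λ_t)` for a bounded symbol `g`. -/
def mulOp (t : ℝ) (g : ℂ → ℂ) (hg : MemLp g ⊤ (lam t)) : L2 t →L[ℂ] L2 t :=
  (ContinuousLinearMap.mul ℂ ℂ).holderL (lam t) ⊤ 2 2 hg.toLp

/-- The Hankel operator `H_g = (I - P) M_g P` on `L²(λ_t)`. -/
def hankel (t : ℝ) (g : ℂ → ℂ) (hg : MemLp g ⊤ (lam t)) : L2 t →L[ℂ] L2 t :=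
  (ContinuousLinearMap.id ℂ (L2 t) - bergmanProj t) ∘L mulOp t g hg ∘L bergmanProj t

/-- A function that is `C²` up to the boundary is a bounded symbol. -/
theorem memLp_top {g : ℂ → ℂ} (hg : ContDiffOn ℝ 2 g (closedBall 0 1)) (t : ℝ) :
    MemLp g ⊤ (lam t) := by
  obtain ⟨C, hC⟩ := (isCompact_closedBall (0 : ℂ) 1).exists_bound_of_continuousOn hg.continuousOn
  have h1 : AEStronglyMeasurable g (volume.restrict disk) :=
    (hg.continuousOn.mono ball_subset_closedBall).aestronglyMeasurable measurableSet_ball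
  refine memLp_top_of_bound (h1.mono_ac (lam_ac t)) C ?_
  filter_upwards [(lam_ac t).ae_le (ae_restrict_mem measurableSet_ball)] with z hz
  exact hC z (ball_subset_closedBall hz)

/-! ### The ingredients of the trace formula -/

/-- `∂̄ g = (∂ₓ g + i ∂_y g) / 2`. -/
def dbar (g : ℂ → ℂ) (z : ℂ) : ℂ :=
  (1 / 2) * (fderiv ℝ g z 1 + Complex.I * fderiv ℝ g z Complex.I)

/-- The Möbius transform `φ_z(w)`. -/
def mobius (z w : ℂ) : ℂ := (z - w) / (1 - w * conj z)

/-- `F(s, x) = -(x ln (s / x) + (1 - x) ln ((1 - s) / (1 - x)))`. -/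
def kerF (s x : ℝ) : ℝ :=
  -(x * Real.log (s / x) + (1 - x) * Real.log ((1 - s) / (1 - x)))

/-- The integrand `(1 - x)^t x⁻¹ F(s, x)` in the definition of `ϱ_t`. -/
def rhoIntegrand (t s x : ℝ) : ℝ := (1 - x) ^ t * x⁻¹ * kerF s x

/-- `ϱ_t(s) = (t + 1) / (16 π²) ∫_s^1 (1 - x)^t x⁻¹ F(s, x) dx`. -/
def rho (t s : ℝ) : ℝ :=
  (t + 1) / (16 * Real.pi ^ 2) * ∫ x in s..1, rhoIntegrand t s x

/-- The integrand `ϱ_t(|φ_z(w)|²) Δḡ(z) Δg(w)` of the double integral, at `p = (z, w)`. -/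
def pairIntegrand (t : ℝ) (g : ℂ → ℂ) (p : ℂ × ℂ) : ℂ :=
  (rho t (‖mobius p.1 p.2‖ ^ 2) : ℂ) * Δ (fun z => conj (g z)) p.1 * Δ g p.2

end HankelHS

end

noncomputable section

namespace HankelHS

/-! ### One-dimensional kernels -/

/-! Sum and difference of `‖H_g‖²` and `‖H_ḡ‖²` are computed separately, and half their total is the
formula.

Sum. The operator `[M_ḡ, P]` equals `H_ḡ - H_g*`, and the two pieces have orthogonal ranges. Hence
`‖H_g‖² + ‖H_ḡ‖²` is the squared Hilbert-Schmidt norm of a commutator, that is, the double integral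
of `|g(z) - g(w)|² |k_z(w)|²` against `λ_t × λ_t` (`hsNormSq_add_eq_lintegral`). The substitution `w
= φ_z(u)` turns the inner integral into a mean of `|g - g(z)|²` over a radial probability measure
centered at `z`. Green's formula (`radial_formula_mobius`) expresses such a mean through the value
at the center, here zero, and the integral of the Laplacian against a Green kernel `kap`. One has
`Δ|g - g(z)|² = 4(|∂g|² + |∂̄g|²) + 2 Re(conj(g - g(z)) Δg)`. The outer integral over `z` is against
a multiple of the Möbius-invariant measure `(1 - |z|²)⁻² dm`, for which `kap` has constant mass;
this produces the two Dirichlet integrals. In the remaining term `conj(g(w) - g(z))`, as a function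
of `z`, vanishes at `w`, so a second use of Green's formula replaces it by `Δḡ(z)` against the
iterated kernel `sig`, a multiple of `ϱ_t`. The outcome is `lintegral_commutator`. Finiteness of the
sum shows that both operators are Hilbert-Schmidt.

Difference. Let `a m n` be the matrix of the Toeplitz operator of `g` in the normalized monomials.
By Pythagoras `‖H_g e_n‖² - ‖H_ḡ e_n‖²` is the sum over `m` of the antisymmetric quantity `|a n m|²
- |a m n|²`. When `n < M` the square block cancels and only the corner `n < M ≤ m` survives. As `M`
grows, the entries in the corner tend to Fourier coefficients `ĝ(m - n)` of the boundary values,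
with a bound of order `(m - n)⁻²` independent of `M`. Dominated convergence gives `-∑ k |ĝ(k)|²`,
which Green's formula for the Jacobian identifies with `π⁻¹ ∫ (|∂̄g|² - |∂g|²)`, independently of
`t` (`hsNormSq_sub`).

Limit. For `z ≠ w` one has `|ϱ_t(|φ_z(w)|²)| ≤ |z - w|⁻¹ (1 - |φ_z(w)|²)^(t+1)`, which is dominated
by `|z - w|⁻¹` and tends to zero off the diagonal.

Throughout, radial kernels are functions of the squared radius and the one-dimensional integrals are
computed in `ℝ≥0∞`, so that Tonelli needs no integrability. -/

theorem lintegral_triangle {p q : ℝ → ℝ≥0∞} (hp : Measurable p) (hq : Measurable q) (a b : ℝ) :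
    ∫⁻ y in Ioo a b, p y * ∫⁻ u in Ioo y b, q u =
      ∫⁻ u in Ioo a b, q u * ∫⁻ y in Ioo a u, p y := by
  have hT : MeasurableSet {x : ℝ × ℝ | a < x.1 ∧ x.1 < x.2 ∧ x.2 < b} :=
    (measurableSet_lt measurable_const measurable_fst).inter
      ((measurableSet_lt measurable_fst measurable_snd).inter
        (measurableSet_lt measurable_snd measurable_const))
  have hm : Measurable ({x : ℝ × ℝ | a < x.1 ∧ x.1 < x.2 ∧ x.2 < b}.indicator
      fun x => p x.1 * q x.2) :=
    ((hp.comp measurable_fst).mul (hq.comp measurable_snd)).indicator hT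
  have h := lintegral_lintegral_swap (μ := volume) (ν := volume)
    (f := fun y u => {x : ℝ × ℝ | a < x.1 ∧ x.1 < x.2 ∧ x.2 < b}.indicator
      (fun x => p x.1 * q x.2) (y, u)) hm.aemeasurable
  have h1 : ∀ y, ∫⁻ u, {x : ℝ × ℝ | a < x.1 ∧ x.1 < x.2 ∧ x.2 < b}.indicator
      (fun x => p x.1 * q x.2) (y, u) =
      (Ioo a b).indicator (fun y => p y * ∫⁻ u in Ioo y b, q u) y := by
    intro y
    by_cases hy : y ∈ Ioo a b
    · rw [indicator_of_mem hy, ← lintegral_const_mul _ hq, ← lintegral_indicator measurableSet_Ioo]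
      refine lintegral_congr fun u => ?_
      by_cases hu : u ∈ Ioo y b
      · rw [indicator_of_mem hu, indicator_of_mem]
        exact ⟨hy.1, hu⟩
      · rw [indicator_of_notMem hu, indicator_of_notMem]
        exact fun h => hu h.2
    · rw [indicator_of_notMem hy]
      refine (lintegral_congr fun u => ?_).trans lintegral_zero
      exact indicator_of_notMem (fun h => hy ⟨h.1, h.2.1.trans h.2.2⟩) _
  have h2 : ∀ u, ∫⁻ y, {x : ℝ × ℝ | a < x.1 ∧ x.1 < x.2 ∧ x.2 < b}.indicator
      (fun x => p x.1 * q x.2) (y, u) =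
      (Ioo a b).indicator (fun u => q u * ∫⁻ y in Ioo a u, p y) u := by
    intro u
    by_cases hu : u ∈ Ioo a b
    · rw [indicator_of_mem hu, ← lintegral_const_mul _ hp, ← lintegral_indicator measurableSet_Ioo]
      refine lintegral_congr fun y => ?_
      by_cases hy : y ∈ Ioo a u
      · rw [indicator_of_mem hy, indicator_of_mem, mul_comm]
        exact ⟨hy.1, hy.2, hu.2⟩
      · rw [indicator_of_notMem hy, indicator_of_notMem]
        exact fun h => hy ⟨h.1, h.2.1⟩
    · rw [indicator_of_notMem hu]
      refine (lintegral_congr fun y => ?_).trans lintegral_zero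
      exact indicator_of_notMem (fun h => hu ⟨h.1.trans h.2.1, h.2.2⟩) _
  simp_rw [h1, h2] at h
  rwa [lintegral_indicator measurableSet_Ioo, lintegral_indicator measurableSet_Ioo] at h

/-- The fundamental theorem of calculus for nonnegative functions, in `ℝ≥0∞`. -/
theorem lintegral_Ioo_of_hasDerivAt {f f' : ℝ → ℝ} {a b : ℝ} (hab : a ≤ b)
    (hc : ContinuousOn f (Icc a b)) (hd : ∀ x ∈ Ioo a b, HasDerivAt f (f' x) x)
    (hpos : ∀ x ∈ Ioo a b, 0 ≤ f' x) :
    ∫⁻ x in Ioo a b, ENNReal.ofReal (f' x) = ENNReal.ofReal (f b - f a) := by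
  have hint : IntegrableOn f' (Ioc a b) :=
    intervalIntegral.integrableOn_deriv_of_nonneg hc hd hpos
  rw [← intervalIntegral.integral_eq_sub_of_hasDerivAt_of_le hab hc hd
    ((intervalIntegrable_iff_integrableOn_Ioc_of_le hab).2 hint),
    intervalIntegral.integral_of_le hab, integral_Ioc_eq_integral_Ioo,
    ofReal_integral_eq_lintegral_ofReal (hint.mono_set Ioo_subset_Ioc_self)]
  filter_upwards [ae_restrict_mem measurableSet_Ioo] with x hx using hpos x hx

theorem lintegral_inv {s u : ℝ} (hs : 0 < s) (hu : s ≤ u) :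
    ∫⁻ y in Ioo s u, ENNReal.ofReal y⁻¹ = ENNReal.ofReal (Real.log (u / s)) := by
  rw [Real.log_div (by linarith) (by linarith)]
  refine lintegral_Ioo_of_hasDerivAt hu (f := Real.log) ?_ (fun x hx => ?_) fun x hx => ?_
  · exact Real.continuousOn_log.mono fun x hx => by
      have : 0 < x := hs.trans_le hx.1
      simpa using this.ne'
  · exact Real.hasDerivAt_log (hs.trans hx.1).ne'
  · exact inv_nonneg.2 (hs.trans hx.1).le

theorem lintegral_one_sub_rpow {t : ℝ} (ht : -1 < t) {y : ℝ} (hy : y ≤ 1) :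
    ∫⁻ u in Ioo y 1, ENNReal.ofReal ((t + 1) * (1 - u) ^ t) = ENNReal.ofReal ((1 - y) ^ (t + 1)) := by
  have h := lintegral_Ioo_of_hasDerivAt hy (f := fun u => -(1 - u) ^ (t + 1))
    (f' := fun u => (t + 1) * (1 - u) ^ t) ?_ (fun x hx => ?_) fun x hx => ?_
  · rw [h]
    simp [Real.zero_rpow (show t + 1 ≠ 0 by linarith)]
  · refine ContinuousOn.neg (ContinuousOn.rpow_const (by fun_prop) fun x hx => Or.inr (by linarith))
  · have h1 : HasDerivAt (fun u : ℝ => 1 - u) (-1) x := by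
      simpa using (hasDerivAt_id x).const_sub 1
    have h2 := (h1.rpow_const (p := t + 1) (Or.inl (by linarith [hx.2]))).neg
    refine h2.congr_deriv ?_
    rw [add_sub_cancel_right]
    ring
  · have : 0 ≤ 1 - x := by linarith [hx.2]
    have : 0 ≤ t + 1 := by linarith
    positivity

theorem lintegral_inv_one_sub_sq {u : ℝ} (h0 : 0 ≤ u) (hu : u < 1) :
    ∫⁻ y in Ioo 0 u, ENNReal.ofReal (((1 - y) ^ 2)⁻¹) = ENNReal.ofReal (u / (1 - u)) := by
  have h := lintegral_Ioo_of_hasDerivAt h0 (f := fun u => (1 - u)⁻¹)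
    (f' := fun u => ((1 - u) ^ 2)⁻¹) ?_ (fun x hx => ?_) fun x hx => ?_
  · rw [h]
    congr 1
    have : 1 - u ≠ 0 := by linarith
    field_simp
    ring
  · refine ContinuousOn.inv₀ (by fun_prop) fun x hx => ?_
    linarith [hx.2]
  · have h1 : HasDerivAt (fun u : ℝ => 1 - u) (-1) x := by
      simpa using (hasDerivAt_id x).const_sub 1
    have h2 := h1.inv (by linarith [hx.2])
    refine h2.congr_deriv ?_
    simp
  · positivity

theorem log_div_nonneg {s y : ℝ} (hs : 0 < s) (hy : s ≤ y) : 0 ≤ Real.log (y / s) :=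
  Real.log_nonneg ((one_le_div hs).2 hy)

/-- This is the origin of `F`: as a function of `y`, `F(s, y) / (1 - y)` is the antiderivative of
`log(y/s) (1 - y)⁻²` that vanishes at `y = s`. -/
theorem lintegral_log_div {s u : ℝ} (hs : 0 < s) (hsu : s ≤ u) (hu : u < 1) :
    ∫⁻ y in Ioo s u, ENNReal.ofReal (Real.log (y / s) * ((1 - y) ^ 2)⁻¹) =
      ENNReal.ofReal (kerF s u / (1 - u)) := by
  have key : ∀ y ∈ Icc s u, kerF s y / (1 - y) =
      y / (1 - y) * (Real.log y - Real.log s) + (Real.log (1 - y) - Real.log (1 - s)) := by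
    intro y hy
    have h1 : 0 < y := hs.trans_le hy.1
    have h2 : 1 - y ≠ 0 := by linarith [hy.2]
    have h3 : 1 - s ≠ 0 := by linarith
    rw [kerF, Real.log_div hs.ne' h1.ne', Real.log_div h3 h2]
    field_simp
    ring
  have h := lintegral_Ioo_of_hasDerivAt hsu
    (f := fun y => y / (1 - y) * (Real.log y - Real.log s) + (Real.log (1 - y) - Real.log (1 - s)))
    (f' := fun y => Real.log (y / s) * ((1 - y) ^ 2)⁻¹) ?_ (fun x hx => ?_) fun x hx => ?_
  · rw [h, key u ⟨hsu, le_rfl⟩]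
    simp
  · refine ContinuousOn.add (ContinuousOn.mul (ContinuousOn.div (by fun_prop) (by fun_prop)
      fun x hx => ?_) (ContinuousOn.sub (ContinuousOn.log (by fun_prop) fun x hx => ?_)
      (by fun_prop))) (ContinuousOn.sub (ContinuousOn.log (by fun_prop) fun x hx => ?_) (by fun_prop))
    · linarith [hx.2]
    · linarith [hx.1]
    · linarith [hx.2]
  · have hx0 : x ≠ 0 := by linarith [hx.1]
    have hx1 : 1 - x ≠ 0 := by linarith [hx.2]
    have h1 : HasDerivAt (fun u : ℝ => 1 - u) (-1) x := by
      simpa using (hasDerivAt_id x).const_sub 1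
    have h2 := (((hasDerivAt_id x).div h1 hx1).mul
      ((Real.hasDerivAt_log hx0).sub_const (Real.log s))).add ((h1.log hx1).sub_const (Real.log (1 - s)))
    refine h2.congr_deriv ?_
    rw [Real.log_div hx0 hs.ne']
    simp only [id, Pi.div_apply]
    field_simp
    ring
  · have := log_div_nonneg hs hx.1.le
    positivity

/-- The Green kernel `(4π)⁻¹ ∫_s^1 (1 - u)^(t+1) u⁻¹ du` of the Berezin transform. -/
def kap (t s : ℝ) : ℝ≥0∞ :=
  ∫⁻ u in Ioo s 1, ENNReal.ofReal ((1 - u) ^ (t + 1) / (4 * Real.pi * u))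

/-- The Green potential of `kap t y / (1 - y)²`. -/
def sig (t s : ℝ) : ℝ≥0∞ :=
  ∫⁻ y in Ioo s 1, ENNReal.ofReal (Real.log (y / s) * ((1 - y) ^ 2)⁻¹ / 4) * kap t y

theorem measurable_lintegral_Ioo {f : ℝ → ℝ → ℝ≥0∞} (hf : Measurable (Function.uncurry f)) :
    Measurable fun s => ∫⁻ y in Ioo s 1, f s y := by
  have hT : MeasurableSet {x : ℝ × ℝ | x.1 < x.2 ∧ x.2 < 1} :=
    (measurableSet_lt measurable_fst measurable_snd).inter
      (measurableSet_lt measurable_snd measurable_const)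
  have h := (hf.indicator hT).lintegral_prod_right' (ν := volume)
  convert h using 2 with s
  rw [← lintegral_indicator measurableSet_Ioo]
  exact lintegral_congr fun y => rfl

theorem measurable_kap (t : ℝ) : Measurable (kap t) := by
  refine measurable_lintegral_Ioo (f := fun _ u =>
    ENNReal.ofReal ((1 - u) ^ (t + 1) / (4 * Real.pi * u))) ?_
  unfold Function.uncurry
  fun_prop

theorem measurable_sig (t : ℝ) : Measurable (sig t) := by
  refine measurable_lintegral_Ioo (f := fun s y =>
    ENNReal.ofReal (Real.log (y / s) * ((1 - y) ^ 2)⁻¹ / 4) * kap t y) ?_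
  have := measurable_kap t
  unfold Function.uncurry
  fun_prop

/-- `log(y/s)` is the integral of `1/x` over `(s, y)`; exchanging the order leaves the tail `(1 -
x)^(t+1)` of the density. Thus `kap t` is the kernel `τ` of `radial_formula` belonging to the
density of `λ_t`. -/
theorem kap_eq {t : ℝ} (ht : -1 < t) {s : ℝ} (hs : 0 < s) :
    ∫⁻ y in Ioo s 1, ENNReal.ofReal ((t + 1) / Real.pi * (1 - y) ^ t * Real.log (y / s) / 4) =
      kap t s := by
  have h := lintegral_triangle (p := fun y => ENNReal.ofReal y⁻¹)
    (q := fun u => ENNReal.ofReal ((t + 1) * (1 - u) ^ t)) (by fun_prop) (by fun_prop) s 1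
  have hpi := Real.pi_pos
  have ht' : 0 < t + 1 := by linarith
  calc _ = ∫⁻ u in Ioo s 1, ENNReal.ofReal (1 / (4 * Real.pi)) *
        (ENNReal.ofReal ((t + 1) * (1 - u) ^ t) * ∫⁻ y in Ioo s u, ENNReal.ofReal y⁻¹) := by
        refine setLIntegral_congr_fun measurableSet_Ioo fun u hu => ?_
        have h1 : 0 ≤ 1 - u := by linarith [hu.2]
        rw [lintegral_inv hs hu.1.le, ← ENNReal.ofReal_mul (by positivity),
          ← ENNReal.ofReal_mul (by positivity)]
        congr 1
        field_simp
    _ = ∫⁻ y in Ioo s 1, ENNReal.ofReal (1 / (4 * Real.pi)) *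
        (ENNReal.ofReal y⁻¹ * ∫⁻ u in Ioo y 1, ENNReal.ofReal ((t + 1) * (1 - u) ^ t)) := by
        rw [lintegral_const_mul' _ _ ENNReal.ofReal_ne_top,
          lintegral_const_mul' _ _ ENNReal.ofReal_ne_top, h]
    _ = _ := by
        refine setLIntegral_congr_fun measurableSet_Ioo fun u hu => ?_
        have h1 : 0 < u := hs.trans hu.1
        rw [lintegral_one_sub_rpow ht hu.2.le, ← ENNReal.ofReal_mul (by positivity),
          ← ENNReal.ofReal_mul (by positivity)]
        congr 1
        field_simp

/-- After the exchange of integrals the inner one is `u / (1 - u)`: its numerator cancels the `u⁻¹`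
in `kap` and its denominator lowers the exponent to `t`. -/
theorem lintegral_kap {t : ℝ} (ht : -1 < t) :
    ∫⁻ y in Ioo 0 1, ENNReal.ofReal (((1 - y) ^ 2)⁻¹) * kap t y =
      ENNReal.ofReal (1 / (4 * Real.pi * (t + 1))) := by
  unfold kap
  rw [lintegral_triangle (by fun_prop) (by fun_prop)]
  have hpi := Real.pi_pos
  have ht' : 0 < t + 1 := by linarith
  calc _ = ∫⁻ u in Ioo (0 : ℝ) 1, ENNReal.ofReal (1 / (4 * Real.pi * (t + 1))) *
        ENNReal.ofReal ((t + 1) * (1 - u) ^ t) := by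
        refine setLIntegral_congr_fun measurableSet_Ioo fun u hu => ?_
        have h1 : 0 < 1 - u := by linarith [hu.2]
        have h2 := hu.1
        rw [lintegral_inv_one_sub_sq hu.1.le hu.2, ← ENNReal.ofReal_mul (by positivity),
          ← ENNReal.ofReal_mul (by positivity)]
        congr 1
        rw [Real.rpow_add_one h1.ne']
        field_simp
    _ = _ := by
        rw [lintegral_const_mul' _ _ ENNReal.ofReal_ne_top, lintegral_one_sub_rpow ht zero_le_one]
        simp

/-- `F(s, x)` is the relative entropy of the Bernoulli law `x` with respect to the Bernoulli law
`s`, so this is Gibbs' inequality, from `log u ≤ u - 1`. At `x = 1` the quotient by `1 - x` takes a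
default value, but its logarithm carries the factor zero. -/
theorem kerF_nonneg {s x : ℝ} (hs : 0 < s) (hsx : s ≤ x) (hx : x ≤ 1) : 0 ≤ kerF s x := by
  rcases hx.eq_or_lt with rfl | hx
  · have := log_div_nonneg hs hsx
    rw [Real.log_div (by norm_num) hs.ne'] at this
    rw [kerF, Real.log_div hs.ne' (by norm_num)]
    linarith
  have h0 : 0 < x := by linarith
  have h1 : 0 < 1 - x := by linarith
  have h2 : 0 < 1 - s := by linarith
  have e1 := Real.log_le_sub_one_of_pos (div_pos hs h0)
  have e2 := Real.log_le_sub_one_of_pos (div_pos h2 h1)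
  have e3 := mul_le_mul_of_nonneg_left e1 h0.le
  have e4 := mul_le_mul_of_nonneg_left e2 h1.le
  have e5 : x * (s / x - 1) = s - x := by field_simp
  have e6 : (1 - x) * ((1 - s) / (1 - x) - 1) = x - s := by field_simp; ring
  rw [kerF]
  linarith

/-- The second summand of the entropy is nonpositive for `s ≤ x`, and so is `x log x`. The surviving
factor `x` cancels the `x⁻¹` of the integrand of `ϱ_t`. -/
theorem kerF_le {s x : ℝ} (hs : 0 < s) (hsx : s ≤ x) (hx : x ≤ 1) :
    kerF s x ≤ x * Real.log (1 / s) := by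
  have h0 : 0 < x := by linarith
  have hl : Real.log (s / x) = -Real.log (1 / s) - Real.log x := by
    rw [Real.log_div hs.ne' h0.ne', one_div, Real.log_inv]
    ring
  have h3 : Real.log x ≤ 0 := Real.log_nonpos h0.le hx
  have h4 : 0 ≤ (1 - x) * Real.log ((1 - s) / (1 - x)) := by
    rcases hx.eq_or_lt with rfl | hx
    · simp
    · have h1 : 0 < 1 - x := by linarith
      exact mul_nonneg h1.le (Real.log_nonneg ((one_le_div h1).2 (by linarith)))
  rw [kerF, hl]
  nlinarith

/-! ### Bounds for `ϱ_t` and its identification as an iterated Green kernel. -/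

theorem rhoIntegrand_nonneg {t s x : ℝ} (hs : 0 < s) (hx : x ∈ Ioo s 1) :
    0 ≤ rhoIntegrand t s x := by
  have h1 : 0 < 1 - x := by linarith [hx.2]
  have h2 : 0 < x := hs.trans hx.1
  have h3 := kerF_nonneg hs hx.1.le hx.2.le
  unfold rhoIntegrand
  positivity

theorem rhoIntegrand_le {t s x : ℝ} (hs : 0 < s) (hx : x ∈ Ioo s 1) :
    rhoIntegrand t s x ≤ (1 - x) ^ t * Real.log (1 / s) := by
  have h1 : 0 < 1 - x := by linarith [hx.2]
  have h2 : 0 < x := hs.trans hx.1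
  have h3 := kerF_le hs hx.1.le hx.2.le
  unfold rhoIntegrand
  rw [mul_assoc]
  gcongr
  rw [inv_mul_le_iff₀ h2]
  exact h3

theorem measurable_rhoIntegrand (t s : ℝ) : Measurable (rhoIntegrand t s) := by
  unfold rhoIntegrand kerF
  fun_prop

theorem lintegral_rhoIntegrand_le {t : ℝ} (ht : -1 < t) {s : ℝ} (hs : s ∈ Ioo (0 : ℝ) 1) :
    ∫⁻ x in Ioo s 1, ENNReal.ofReal (rhoIntegrand t s x) ≤
      ENNReal.ofReal (Real.log (1 / s) * (1 - s) ^ (t + 1) / (t + 1)) := by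
  have ht' : 0 < t + 1 := by linarith
  have hl : 0 ≤ Real.log (1 / s) := log_div_nonneg hs.1 hs.2.le
  calc _ ≤ ∫⁻ x in Ioo s 1, ENNReal.ofReal (Real.log (1 / s) / (t + 1)) *
        ENNReal.ofReal ((t + 1) * (1 - x) ^ t) := by
        refine setLIntegral_mono' measurableSet_Ioo fun x hx => ?_
        rw [← ENNReal.ofReal_mul (by positivity)]
        refine ENNReal.ofReal_le_ofReal ((rhoIntegrand_le hs.1 hx).trans (le_of_eq ?_))
        field_simp
    _ = _ := by
        rw [lintegral_const_mul' _ _ ENNReal.ofReal_ne_top, lintegral_one_sub_rpow ht hs.2.le,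
          ← ENNReal.ofReal_mul (by positivity)]
        congr 1
        ring

theorem integrableOn_rhoIntegrand {t : ℝ} (ht : -1 < t) {s : ℝ} (hs : s ∈ Ioo (0 : ℝ) 1) :
    IntegrableOn (rhoIntegrand t s) (Ioo s 1) := by
  refine ⟨(measurable_rhoIntegrand t s).aestronglyMeasurable, ?_⟩
  rw [hasFiniteIntegral_iff_ofReal]
  · exact (lintegral_rhoIntegrand_le ht hs).trans_lt ENNReal.ofReal_lt_top
  · filter_upwards [ae_restrict_mem measurableSet_Ioo] with x hx using rhoIntegrand_nonneg hs.1 hx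

theorem rho_eq_lintegral {t : ℝ} {s : ℝ} (hs : s ∈ Ioo (0 : ℝ) 1) :
    rho t s = (t + 1) / (16 * Real.pi ^ 2) *
      (∫⁻ x in Ioo s 1, ENNReal.ofReal (rhoIntegrand t s x)).toReal := by
  rw [rho, intervalIntegral.integral_of_le hs.2.le, integral_Ioc_eq_integral_Ioo,
    integral_eq_lintegral_of_nonneg_ae _ (measurable_rhoIntegrand t s).aestronglyMeasurable]
  filter_upwards [ae_restrict_mem measurableSet_Ioo] with x hx using rhoIntegrand_nonneg hs.1 hx

theorem rho_nonneg {t : ℝ} (ht : -1 < t) {s : ℝ} (hs : s ∈ Ioo (0 : ℝ) 1) : 0 ≤ rho t s := by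
  have ht' : 0 < t + 1 := by linarith
  rw [rho_eq_lintegral hs]
  positivity

/-- The logarithm is the only singularity, on the diagonal, and it is integrable; the power of `1 -
s` drives the limit `t → ∞`. -/
theorem rho_le {t : ℝ} (ht : -1 < t) {s : ℝ} (hs : s ∈ Ioo (0 : ℝ) 1) :
    rho t s ≤ Real.log (1 / s) * (1 - s) ^ (t + 1) / (16 * Real.pi ^ 2) := by
  have ht' : 0 < t + 1 := by linarith
  have hl : 0 ≤ Real.log (1 / s) := log_div_nonneg hs.1 hs.2.le
  have h1 : 0 < 1 - s := by linarith [hs.2]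
  rw [rho_eq_lintegral hs]
  have h := ENNReal.toReal_mono ENNReal.ofReal_ne_top (lintegral_rhoIntegrand_le ht hs)
  rw [ENNReal.toReal_ofReal (by positivity)] at h
  calc _ ≤ (t + 1) / (16 * Real.pi ^ 2) * (Real.log (1 / s) * (1 - s) ^ (t + 1) / (t + 1)) := by
        gcongr
    _ = _ := by field_simp

/-- Exchange the two integrations: the inner one is `lintegral_log_div`, and its denominator `1 - u`
lowers the power `(1 - u)^(t+1)` of `kap` to the `(1 - u)^t` of `ϱ_t`. -/
theorem sig_eq {t s : ℝ} (hs : s ∈ Ioo (0 : ℝ) 1) :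
    sig t s = ∫⁻ x in Ioo s 1, ENNReal.ofReal (1 / (16 * Real.pi)) *
      ENNReal.ofReal (rhoIntegrand t s x) := by
  unfold sig kap
  rw [lintegral_triangle (by fun_prop) (by fun_prop)]
  refine setLIntegral_congr_fun measurableSet_Ioo fun u hu => ?_
  have h1 : 0 < 1 - u := by linarith [hu.2]
  have h2 : 0 < u := hs.1.trans hu.1
  have h3 := kerF_nonneg hs.1 hu.1.le hu.2.le
  have hpi := Real.pi_pos
  have e : ∫⁻ y in Ioo s u, ENNReal.ofReal (Real.log (y / s) * ((1 - y) ^ 2)⁻¹ / 4) =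
      ENNReal.ofReal (1 / 4) * ENNReal.ofReal (kerF s u / (1 - u)) := by
    rw [← lintegral_log_div hs.1 hu.1.le hu.2, ← lintegral_const_mul' _ _ ENNReal.ofReal_ne_top]
    refine setLIntegral_congr_fun measurableSet_Ioo fun y hy => ?_
    rw [← ENNReal.ofReal_mul (by positivity)]
    congr 1
    ring
  rw [e, ← ENNReal.ofReal_mul (by positivity), ← ENNReal.ofReal_mul (by positivity),
    ← ENNReal.ofReal_mul (by positivity)]
  congr 1
  rw [Real.rpow_add_one h1.ne', rhoIntegrand]
  field_simp
  ring

theorem sig_toReal {t s : ℝ} (hs : s ∈ Ioo (0 : ℝ) 1) :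
    (t + 1) / Real.pi * (sig t s).toReal = rho t s := by
  rw [sig_eq hs, lintegral_const_mul' _ _ ENNReal.ofReal_ne_top, ENNReal.toReal_mul,
    ENNReal.toReal_ofReal (by positivity), rho_eq_lintegral hs]
  field_simp

/-! ### Möbius transforms of the disk -/

theorem mem_disk {z : ℂ} : z ∈ disk ↔ ‖z‖ < 1 := by simp [disk]

theorem isOpen_disk : IsOpen disk := isOpen_ball

theorem measurableSet_disk : MeasurableSet disk := measurableSet_ball

theorem zero_mem_disk : (0 : ℂ) ∈ disk := by simp [mem_disk]

theorem one_sub_norm_sq_pos {z : ℂ} (hz : z ∈ disk) : 0 < 1 - ‖z‖ ^ 2 := by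
  have := mem_disk.1 hz
  nlinarith [norm_nonneg z]

theorem one_sub_mul_conj_ne_zero {z u : ℂ} (hz : z ∈ disk) (hu : u ∈ disk) :
    1 - u * conj z ≠ 0 := by
  intro h
  have h1 : ‖u * conj z‖ = 1 := by rw [← sub_eq_zero.1 h]; simp
  rw [norm_mul, RCLike.norm_conj] at h1
  have := mem_disk.1 hz
  have := mem_disk.1 hu
  nlinarith [norm_nonneg z, norm_nonneg u]

theorem norm_one_sub_pos {z u : ℂ} (hz : z ∈ disk) (hu : u ∈ disk) :
    0 < ‖1 - u * conj z‖ := norm_pos_iff.2 (one_sub_mul_conj_ne_zero hz hu)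

theorem norm_one_sub_sq (z u : ℂ) :
    ‖1 - u * conj z‖ ^ 2 = ‖z - u‖ ^ 2 + (1 - ‖z‖ ^ 2) * (1 - ‖u‖ ^ 2) := by
  simp only [← Complex.normSq_eq_norm_sq, Complex.normSq_apply]
  simp
  ring

theorem one_sub_norm_mobius_sq {z u : ℂ} (hz : z ∈ disk) (hu : u ∈ disk) :
    1 - ‖mobius z u‖ ^ 2 = (1 - ‖z‖ ^ 2) * (1 - ‖u‖ ^ 2) / ‖1 - u * conj z‖ ^ 2 := by
  have h := norm_one_sub_pos hz hu
  rw [mobius, norm_div, div_pow, eq_div_iff (by positivity), sub_mul,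
    div_mul_cancel₀ _ (by positivity), norm_one_sub_sq]
  ring

theorem mobius_mem {z u : ℂ} (hz : z ∈ disk) (hu : u ∈ disk) : mobius z u ∈ disk := by
  have h := one_sub_norm_mobius_sq hz hu
  have h1 := norm_one_sub_pos hz hu
  have h2 := one_sub_norm_sq_pos hz
  have h3 := one_sub_norm_sq_pos hu
  have h4 : 0 < 1 - ‖mobius z u‖ ^ 2 := by rw [h]; positivity
  rw [mem_disk]
  nlinarith [norm_nonneg (mobius z u)]

theorem one_sub_mobius_mul {z u : ℂ} (hz : z ∈ disk) (hu : u ∈ disk) :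
    1 - mobius z u * conj z = ((1 - ‖z‖ ^ 2 : ℝ) : ℂ) / (1 - u * conj z) := by
  have h := one_sub_mul_conj_ne_zero hz hu
  have hz2 : ((1 - ‖z‖ ^ 2 : ℝ) : ℂ) = 1 - z * conj z := by
    rw [Complex.mul_conj, Complex.normSq_eq_norm_sq]
    push_cast
    ring
  rw [hz2, mobius, eq_div_iff h, sub_mul, div_mul_eq_mul_div, div_mul_cancel₀ _ h]
  ring

theorem mobius_mobius {z u : ℂ} (hz : z ∈ disk) (hu : u ∈ disk) : mobius z (mobius z u) = u := by
  have h := one_sub_mul_conj_ne_zero hz hu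
  have h2 : (1 - z * conj z : ℂ) ≠ 0 := one_sub_mul_conj_ne_zero hz hz
  have hz2 : ((1 - ‖z‖ ^ 2 : ℝ) : ℂ) = 1 - z * conj z := by
    rw [Complex.mul_conj, Complex.normSq_eq_norm_sq]
    push_cast
    ring
  rw [mobius, one_sub_mobius_mul hz hu, hz2, mobius]
  field_simp
  ring

theorem mobius_zero (z : ℂ) : mobius z 0 = z := by simp [mobius]

theorem norm_mobius_comm (z u : ℂ) : ‖mobius z u‖ = ‖mobius u z‖ := by
  rw [mobius, mobius, norm_div, norm_div, norm_sub_rev]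
  congr 1
  rw [← RCLike.norm_conj]
  simp [mul_comm]

theorem norm_mobius_sq_mem {z u : ℂ} (hz : z ∈ disk) (hu : u ∈ disk) (hne : z ≠ u) :
    ‖mobius z u‖ ^ 2 ∈ Ioo (0 : ℝ) 1 := by
  have h1 := one_sub_norm_sq_pos (mobius_mem hz hu)
  refine ⟨?_, by linarith⟩
  have : mobius z u ≠ 0 := div_ne_zero (sub_ne_zero.2 hne) (one_sub_mul_conj_ne_zero hz hu)
  positivity

theorem hasDerivAt_mobius {z u : ℂ} (hz : z ∈ disk) (hu : u ∈ disk) :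
    HasDerivAt (mobius z) (((‖z‖ ^ 2 - 1 : ℝ) : ℂ) / (1 - u * conj z) ^ 2) u := by
  have h := one_sub_mul_conj_ne_zero hz hu
  have h1 : HasDerivAt (fun w : ℂ => z - w) (-1) u := by
    simpa using (hasDerivAt_id u).const_sub z
  have h2 : HasDerivAt (fun w : ℂ => 1 - w * conj z) (-conj z) u := by
    simpa using ((hasDerivAt_id u).mul_const (conj z)).const_sub 1
  refine (h1.div h2 h).congr_deriv ?_
  have hz2 : ((‖z‖ ^ 2 - 1 : ℝ) : ℂ) = z * conj z - 1 := by
    rw [Complex.mul_conj, Complex.normSq_eq_norm_sq]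
    push_cast
    ring
  rw [hz2]
  congr 1
  ring

/-- The Jacobian `|φ_z'(u)|²`. -/
def mobiusJac (z u : ℂ) : ℝ := ((1 - ‖z‖ ^ 2) / ‖1 - u * conj z‖ ^ 2) ^ 2

theorem norm_deriv_mobius_sq {z u : ℂ} (hz : z ∈ disk) :
    ‖((‖z‖ ^ 2 - 1 : ℝ) : ℂ) / (1 - u * conj z) ^ 2‖ ^ 2 = mobiusJac z u := by
  have := one_sub_norm_sq_pos hz
  rw [norm_div, norm_pow, Complex.norm_real, Real.norm_eq_abs, abs_sub_comm, abs_of_pos this,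
    mobiusJac]

theorem mobiusJac_nonneg (z u : ℂ) : 0 ≤ mobiusJac z u := sq_nonneg _

/-- Invariance of the hyperbolic measure `(1 - |u|²)⁻² dm(u)` under `φ_z`. -/
theorem mobiusJac_mul {z u : ℂ} (hz : z ∈ disk) (hu : u ∈ disk) :
    mobiusJac z u * ((1 - ‖mobius z u‖ ^ 2) ^ 2)⁻¹ = ((1 - ‖u‖ ^ 2) ^ 2)⁻¹ := by
  have h1 := norm_one_sub_pos hz hu
  have h2 := one_sub_norm_sq_pos hz
  have h3 := one_sub_norm_sq_pos hu
  rw [one_sub_norm_mobius_sq hz hu, mobiusJac]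
  field_simp

theorem image_mobius {z : ℂ} (hz : z ∈ disk) : mobius z '' disk = disk := by
  ext w
  constructor
  · rintro ⟨u, hu, rfl⟩
    exact mobius_mem hz hu
  · exact fun hw => ⟨mobius z w, mobius_mem hz hw, mobius_mobius hz hw⟩

theorem injOn_mobius {z : ℂ} (hz : z ∈ disk) : InjOn (mobius z) disk := fun u hu v hv h => by
  rw [← mobius_mobius hz hu, h, mobius_mobius hz hv]

/-- The real determinant of multiplication by `a` is the field norm of `a` from `ℂ` to `ℝ`. -/
theorem det_restrictScalars_smulRight (a : ℂ) :
    (((ContinuousLinearMap.toSpanSingleton ℂ a).restrictScalars ℝ).det : ℝ) = ‖a‖ ^ 2 := by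
  have h : ((((ContinuousLinearMap.toSpanSingleton ℂ a).restrictScalars ℝ : ℂ →L[ℝ] ℂ)) :
      ℂ →ₗ[ℝ] ℂ) = Algebra.lmul ℝ ℂ a := by
    ext
    simp [mul_comm]
  rw [ContinuousLinearMap.det, h, ← Algebra.norm_apply, Algebra.norm_complex_apply,
    Complex.normSq_eq_norm_sq]

/-! ### Change of variables along the involution `φ_z` of the disk. -/

theorem hasFDerivWithinAt_mobius {z : ℂ} (hz : z ∈ disk) (u : ℂ) (hu : u ∈ disk) :
    HasFDerivWithinAt (mobius z) ((ContinuousLinearMap.toSpanSingleton ℂ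
      (((‖z‖ ^ 2 - 1 : ℝ) : ℂ) / (1 - u * conj z) ^ 2)).restrictScalars ℝ) disk u :=
  ((hasDerivAt_mobius hz hu).hasFDerivAt.restrictScalars ℝ).hasFDerivWithinAt

theorem lintegral_comp_mobius {z : ℂ} (hz : z ∈ disk) (f : ℂ → ℝ≥0∞) :
    ∫⁻ w in disk, f w = ∫⁻ u in disk, ENNReal.ofReal (mobiusJac z u) * f (mobius z u) := by
  have h := lintegral_image_eq_lintegral_abs_det_fderiv_mul volume measurableSet_disk
    (hasFDerivWithinAt_mobius hz) (injOn_mobius hz) f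
  rw [image_mobius hz] at h
  simp_rw [det_restrictScalars_smulRight, abs_pow, abs_norm,
    norm_deriv_mobius_sq hz] at h
  exact h

theorem integral_comp_mobius {F : Type*} [NormedAddCommGroup F] [NormedSpace ℝ F] {z : ℂ}
    (hz : z ∈ disk) (f : ℂ → F) :
    ∫ w in disk, f w = ∫ u in disk, mobiusJac z u • f (mobius z u) := by
  have h := integral_image_eq_integral_abs_det_fderiv_smul volume measurableSet_disk
    (hasFDerivWithinAt_mobius hz) (injOn_mobius hz) f
  rw [image_mobius hz] at h
  simp_rw [det_restrictScalars_smulRight, abs_pow, abs_norm,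
    norm_deriv_mobius_sq hz] at h
  exact h

theorem integrableOn_comp_mobius {F : Type*} [NormedAddCommGroup F] [NormedSpace ℝ F] {z : ℂ}
    (hz : z ∈ disk) (f : ℂ → F) :
    IntegrableOn f disk ↔ IntegrableOn (fun u => mobiusJac z u • f (mobius z u)) disk := by
  have h := integrableOn_image_iff_integrableOn_abs_det_fderiv_smul volume measurableSet_disk
    (hasFDerivWithinAt_mobius hz) (injOn_mobius hz) f
  rw [image_mobius hz] at h
  simp_rw [det_restrictScalars_smulRight, abs_pow, abs_norm,
    norm_deriv_mobius_sq hz] at h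
  exact h

/-! ### The Laplacian -/

theorem laplacian_eq_fderiv {f : ℂ → ℂ} {x : ℂ} (hf : ContDiffAt ℝ 2 f x) :
    Δ f x = fderiv ℝ (fun y => fderiv ℝ f y 1) x 1 +
      fderiv ℝ (fun y => fderiv ℝ f y Complex.I) x Complex.I := by
  have hd : DifferentiableAt ℝ (fderiv ℝ f) x :=
    (hf.fderiv_right (m := 1) (by norm_num)).differentiableAt (by norm_num)
  have key : ∀ v : ℂ, fderiv ℝ (fun y => fderiv ℝ f y v) x v = fderiv ℝ (fderiv ℝ f) x v v := by
    intro v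
    rw [fderiv_clm_apply hd (differentiableAt_const v)]
    simp
  rw [InnerProductSpace.laplacian_eq_iteratedFDeriv_complexPlane, key, key]
  simp [iteratedFDeriv_two_apply]

theorem laplacian_eq_fderiv_fderiv {f : ℂ → ℂ} {x : ℂ} :
    Δ f x = fderiv ℝ (fderiv ℝ f) x 1 1 + fderiv ℝ (fderiv ℝ f) x Complex.I Complex.I := by
  rw [InnerProductSpace.laplacian_eq_iteratedFDeriv_complexPlane]
  simp [iteratedFDeriv_two_apply]

/-- The Laplacian in a rotated and scaled orthogonal frame. -/
theorem bilin_rotate (B : ℂ →L[ℝ] ℂ →L[ℝ] ℂ) (a : ℂ) :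
    B a a + B (a * Complex.I) (a * Complex.I) =
      ((‖a‖ ^ 2 : ℝ) : ℂ) * (B 1 1 + B Complex.I Complex.I) := by
  have h1 : a = a.re • (1 : ℂ) + a.im • Complex.I := by
    simp [Complex.re_add_im]
  have h2 : a * Complex.I = (-a.im) • (1 : ℂ) + a.re • Complex.I := by
    apply Complex.ext <;> simp
  rw [h2]
  nth_rewrite 1 2 [h1]
  simp only [map_add, map_smul, add_apply, smul_apply]
  simp only [Complex.real_smul]
  rw [← Complex.normSq_eq_norm_sq, Complex.normSq_apply]
  push_cast
  ring

/-- In the second derivative along `v` the term with `φ''` is `Df(φ'' v²)`. For `v = 1` and `v = i`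
these cancel because `1 + i² = 0`, and what remains is the Laplacian of `f` in the frame `φ', i φ'`.
-/
theorem laplacian_comp_holomorphic {f φ : ℂ → ℂ} {U : Set ℂ} {u : ℂ} (hU : IsOpen U) (hu : u ∈ U)
    (hφ : DifferentiableOn ℂ φ U) (hf : ContDiffAt ℝ 2 f (φ u)) :
    Δ (fun x => f (φ x)) u = ((‖deriv φ u‖ ^ 2 : ℝ) : ℂ) * Δ f (φ u) := by
  have hφc : ∀ x ∈ U, DifferentiableAt ℂ φ x := fun x hx => hφ.differentiableAt (hU.mem_nhds hx)
  have hφ2 : ContDiffAt ℝ 2 φ u :=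
    ((hφ.analyticOnNhd hU u hu).contDiffAt (n := 2)).restrict_scalars ℝ
  have hφ' : DifferentiableAt ℂ (deriv φ) u :=
    (hφ.deriv hU).differentiableAt (hU.mem_nhds hu)
  have hev : ∀ᶠ y in 𝓝 (φ u), DifferentiableAt ℝ f y := by
    filter_upwards [hf.eventually (by simp)] with y hy using hy.differentiableAt (by norm_num)
  have hfd : ∀ v, (fun y => fderiv ℝ (fun x => f (φ x)) y v) =ᶠ[𝓝 u]
      fun y => fderiv ℝ f (φ y) (deriv φ y * v) := by
    intro v
    filter_upwards [hU.mem_nhds hu, (hφc u hu).continuousAt.eventually hev] with y hy hy2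
    have h1 : HasFDerivAt φ ((ContinuousLinearMap.toSpanSingleton ℂ (deriv φ y)).restrictScalars ℝ) y :=
      (hφc y hy).hasDerivAt.hasFDerivAt.restrictScalars ℝ
    have h2 := (hy2.hasFDerivAt.comp y h1).fderiv
    rw [show (fun x => f (φ x)) = f ∘ φ from rfl, h2]
    simp [mul_comm]
  have hd : DifferentiableAt ℝ (fderiv ℝ f) (φ u) :=
    (hf.fderiv_right (m := 1) (by norm_num)).differentiableAt (by norm_num)
  have h1 : HasFDerivAt φ ((ContinuousLinearMap.toSpanSingleton ℂ (deriv φ u)).restrictScalars ℝ) u :=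
    (hφc u hu).hasDerivAt.hasFDerivAt.restrictScalars ℝ
  have h2 : HasFDerivAt (deriv φ)
      ((ContinuousLinearMap.toSpanSingleton ℂ (deriv (deriv φ) u)).restrictScalars ℝ) u :=
    hφ'.hasDerivAt.hasFDerivAt.restrictScalars ℝ
  have key : ∀ v : ℂ, fderiv ℝ (fun y => fderiv ℝ (fun x => f (φ x)) y v) u v =
      fderiv ℝ (fderiv ℝ f) (φ u) (deriv φ u * v) (deriv φ u * v) +
        fderiv ℝ f (φ u) (deriv (deriv φ) u * (v * v)) := by
    intro v
    rw [(hfd v).fderiv_eq]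
    have h3 : HasFDerivAt (fun y => fderiv ℝ f (φ y) (deriv φ y * v)) _ u :=
      (hd.hasFDerivAt.comp u h1).clm_apply (h2.mul_const' v)
    rw [h3.fderiv]
    simp only [add_apply, Function.comp_apply]
    simp [mul_comm, mul_left_comm]
    ring
  have hc : ContDiffAt ℝ 2 (fun x => f (φ x)) u := hf.comp u hφ2
  rw [laplacian_eq_fderiv hc, key, key, laplacian_eq_fderiv_fderiv, ← bilin_rotate]
  simp only [mul_one, Complex.I_mul_I, mul_neg, map_neg]
  ring

theorem laplacian_conj {f : ℂ → ℂ} (x : ℂ) : Δ (fun y => conj (f y)) x = conj (Δ f x) := by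
  have h := InnerProductSpace.laplacian_CLE_comp_left (f := f) (l := Complex.conjCLE)
  simpa [Function.comp_def] using congrFun h x

/-- `∂ g = (∂ₓ g - i ∂_y g) / 2`. -/
def del (g : ℂ → ℂ) (z : ℂ) : ℂ :=
  (1 / 2) * (fderiv ℝ g z 1 - Complex.I * fderiv ℝ g z Complex.I)

theorem norm_del_sq_add (g : ℂ → ℂ) (z : ℂ) :
    2 * (‖del g z‖ ^ 2 + ‖dbar g z‖ ^ 2) = ‖fderiv ℝ g z 1‖ ^ 2 + ‖fderiv ℝ g z Complex.I‖ ^ 2 := by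
  simp only [del, dbar, ← Complex.normSq_eq_norm_sq, Complex.normSq_apply]
  simp
  ring

/-- Leibniz rule: each direction contributes the cross term `2|∂_v f|²`, and the parallelogram law
`norm_del_sq_add` converts their sum to `∂` and `∂̄`. -/
theorem laplacian_normSq_sub {f : ℂ → ℂ} {x : ℂ} (hf : ContDiffAt ℝ 2 f x) (c : ℂ) :
    Δ (fun y => conj (f y - c) * (f y - c)) x =
      ((4 * (‖del f x‖ ^ 2 + ‖dbar f x‖ ^ 2) + 2 * (conj (f x - c) * Δ f x).re : ℝ) : ℂ) := by
  have hev : ∀ᶠ y in 𝓝 x, DifferentiableAt ℝ f y := by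
    filter_upwards [hf.eventually (by simp)] with y hy using hy.differentiableAt (by norm_num)
  have hd : DifferentiableAt ℝ (fderiv ℝ f) x :=
    (hf.fderiv_right (m := 1) (by norm_num)).differentiableAt (by norm_num)
  have hcj : ∀ {p : ℂ → ℂ} {y : ℂ} {L : ℂ →L[ℝ] ℂ}, HasFDerivAt p L y →
      HasFDerivAt (fun y => conj (p y)) ((Complex.conjCLE : ℂ →L[ℝ] ℂ).comp L) y := fun h =>
    (Complex.conjCLE : ℂ →L[ℝ] ℂ).hasFDerivAt.comp _ h
  have hfd : ∀ v, (fun y => fderiv ℝ (fun y => conj (f y - c) * (f y - c)) y v) =ᶠ[𝓝 x]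
      fun y => conj (f y - c) * fderiv ℝ f y v + (f y - c) * conj (fderiv ℝ f y v) := by
    intro v
    filter_upwards [hev] with y hy
    have h1 := hy.hasFDerivAt.sub_const c
    have h2 : HasFDerivAt (fun y => conj (f y - c) * (f y - c)) _ y := (hcj h1).mul h1
    rw [h2.fderiv]
    simp
  have key : ∀ v : ℂ, fderiv ℝ (fun y => fderiv ℝ (fun y => conj (f y - c) * (f y - c)) y v) x v =
      (conj (f x - c) * fderiv ℝ (fun y => fderiv ℝ f y v) x v +
        (f x - c) * conj (fderiv ℝ (fun y => fderiv ℝ f y v) x v)) +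
      2 * ((‖fderiv ℝ f x v‖ ^ 2 : ℝ) : ℂ) := by
    intro v
    rw [(hfd v).fderiv_eq]
    have h1 := hev.self_of_nhds.hasFDerivAt.sub_const c
    have h2 := (hd.clm_apply (differentiableAt_const v)).hasFDerivAt
    have h3 : HasFDerivAt (fun y => conj (f y - c) * fderiv ℝ f y v +
        (f y - c) * conj (fderiv ℝ f y v)) _ x := ((hcj h1).mul h2).add (h1.mul (hcj h2))
    rw [h3.fderiv, ← Complex.normSq_eq_norm_sq,
      ← Complex.mul_conj]
    simp
    ring
  have hc : ContDiffAt ℝ 2 (fun y => conj (f y - c) * (f y - c)) x := by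
    have h1 : ContDiffAt ℝ 2 (fun y => f y - c) x := hf.sub contDiffAt_const
    exact (Complex.conjCLE.contDiff.contDiffAt.comp x h1).mul h1
  have h4 : (4 * (‖del f x‖ ^ 2 + ‖dbar f x‖ ^ 2) : ℝ) =
      2 * (‖fderiv ℝ f x 1‖ ^ 2 + ‖fderiv ℝ f x Complex.I‖ ^ 2) := by
    rw [← norm_del_sq_add]
    ring
  rw [laplacian_eq_fderiv hc, key, key, h4, laplacian_eq_fderiv hf]
  set a := fderiv ℝ (fun y => fderiv ℝ f y 1) x 1
  set b := fderiv ℝ (fun y => fderiv ℝ f y Complex.I) x Complex.I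
  have h5 : ((2 * (conj (f x - c) * (a + b)).re : ℝ) : ℂ) =
      conj (f x - c) * (a + b) + (f x - c) * conj (a + b) := by
    have := Complex.add_conj (conj (f x - c) * (a + b))
    rw [← this]
    simp
  rw [Complex.ofReal_add, h5, map_add]
  push_cast
  ring

/-! ### Functions that are `C²` up to the boundary -/

theorem contDiffAt_of_mem_disk {g : ℂ → ℂ} (hg : ContDiffOn ℝ 2 g (closedBall 0 1)) {z : ℂ}
    (hz : z ∈ disk) : ContDiffAt ℝ 2 g z :=
  hg.contDiffAt (mem_of_superset (isOpen_disk.mem_nhds hz) ball_subset_closedBall)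

theorem contDiffOn_conj {g : ℂ → ℂ} {s : Set ℂ} (hg : ContDiffOn ℝ 2 g s) :
    ContDiffOn ℝ 2 (fun z => conj (g z)) s :=
  Complex.conjCLE.contDiff.comp_contDiffOn hg

theorem continuousOn_laplacian {g : ℂ → ℂ} {U : Set ℂ} (hU : IsOpen U) (hg : ContDiffOn ℝ 2 g U) :
    ContinuousOn (Δ g) U := by
  have h1 : ContDiffOn ℝ 1 (fderiv ℝ g) U := hg.fderiv_of_isOpen hU (by norm_num)
  have h2 : ContinuousOn (fderiv ℝ (fderiv ℝ g)) U := h1.continuousOn_fderiv_of_isOpen hU (by norm_num)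
  have : Δ g = fun x => fderiv ℝ (fderiv ℝ g) x 1 1 +
      fderiv ℝ (fderiv ℝ g) x Complex.I Complex.I := funext fun x => laplacian_eq_fderiv_fderiv
  rw [this]
  fun_prop

theorem uniqueDiffOn_closedBall : UniqueDiffOn ℝ (closedBall (0 : ℂ) 1) :=
  uniqueDiffOn_convex (convex_closedBall 0 1) (by
    rw [interior_closedBall _ one_ne_zero]
    exact ⟨0, by simp⟩)

/-- On the open disk the derivatives agree with the derivatives within the closed disk, which are
continuous on a compact set. On the unit circle itself `fderiv` is not controlled, so the bounds
stop at the open disk. -/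
theorem exists_bound {g : ℂ → ℂ} (hg : ContDiffOn ℝ 2 g (closedBall 0 1)) :
    ∃ C : ℝ, 0 ≤ C ∧ ∀ z ∈ disk, ‖g z‖ ≤ C ∧ ‖fderiv ℝ g z‖ ≤ C ∧
      ‖fderiv ℝ (fderiv ℝ g) z‖ ≤ C ∧ ‖Δ g z‖ ≤ C := by
  have hK := isCompact_closedBall (0 : ℂ) 1
  have h1 : ContDiffOn ℝ 1 (fderivWithin ℝ g (closedBall 0 1)) (closedBall 0 1) :=
    hg.fderivWithin uniqueDiffOn_closedBall (by norm_num)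
  have h2 := h1.continuousOn_fderivWithin uniqueDiffOn_closedBall (by norm_num)
  obtain ⟨C0, hC0⟩ := hK.exists_bound_of_continuousOn hg.continuousOn
  obtain ⟨C1, hC1⟩ := hK.exists_bound_of_continuousOn h1.continuousOn
  obtain ⟨C2, hC2⟩ := hK.exists_bound_of_continuousOn h2
  have e1 : ∀ z ∈ disk, fderivWithin ℝ g (closedBall 0 1) z = fderiv ℝ g z := fun z hz =>
    fderivWithin_of_mem_nhds (mem_of_superset (isOpen_disk.mem_nhds hz) ball_subset_closedBall)
  have e2 : ∀ z ∈ disk, fderivWithin ℝ (fderivWithin ℝ g (closedBall 0 1)) (closedBall 0 1) z =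
      fderiv ℝ (fderiv ℝ g) z := fun z hz => by
    rw [fderivWithin_of_mem_nhds (mem_of_superset (isOpen_disk.mem_nhds hz) ball_subset_closedBall)]
    refine Filter.EventuallyEq.fderiv_eq ?_
    filter_upwards [isOpen_disk.mem_nhds hz] with y hy using e1 y hy
  have hd : ∀ z ∈ disk, ‖fderiv ℝ (fderiv ℝ g) z‖ ≤ C2 := fun z hz => by
    rw [← e2 z hz]
    exact hC2 z (ball_subset_closedBall hz)
  have p0 : 0 ≤ C0 := (norm_nonneg _).trans (hC0 0 (by simp))
  have p1 : 0 ≤ C1 := (norm_nonneg _).trans (hC1 0 (by simp))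
  have p2 : 0 ≤ C2 := (norm_nonneg _).trans (hC2 0 (by simp))
  refine ⟨C0 + C1 + 2 * C2, by positivity, fun z hz => ⟨?_, ?_, ?_, ?_⟩⟩
  · linarith [hC0 z (ball_subset_closedBall hz)]
  · rw [← e1 z hz]
    linarith [hC1 z (ball_subset_closedBall hz)]
  · linarith [hd z hz]
  · rw [laplacian_eq_fderiv_fderiv]
    have h : ∀ v : ℂ, ‖v‖ = 1 → ‖fderiv ℝ (fderiv ℝ g) z v v‖ ≤ C2 := fun v hv => by
      have := (fderiv ℝ (fderiv ℝ g) z).le_opNorm₂ v v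
      rw [hv, mul_one, mul_one] at this
      exact this.trans (hd z hz)
    have := norm_add_le (fderiv ℝ (fderiv ℝ g) z 1 1)
      (fderiv ℝ (fderiv ℝ g) z Complex.I Complex.I)
    linarith [h 1 (by simp), h Complex.I (by simp)]

/-! ### The circle mean of a `C²` function -/

theorem norm_exp_I (θ : ℝ) : ‖Complex.exp (θ * Complex.I)‖ = 1 := Complex.norm_exp_ofReal_mul_I θ

theorem continuousOn_polar {E : Type*} [TopologicalSpace E] {f : ℂ → E} (hf : ContinuousOn f disk)
    {R : ℝ} (hR : R < 1) :
    ContinuousOn (fun p : ℝ × ℝ => f (p.1 * Complex.exp (p.2 * Complex.I))) (Icc 0 R ×ˢ univ) := by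
  refine hf.comp (Continuous.continuousOn (by fun_prop)) fun p hp => ?_
  rw [mem_disk, norm_mul, norm_exp_I, mul_one, Complex.norm_real, Real.norm_eq_abs,
    abs_of_nonneg hp.1.1]
  exact hp.1.2.trans_lt hR

theorem hasDerivAt_ray {E : Type*} [NormedAddCommGroup E] [NormedSpace ℝ E] {f : ℂ → E} {s θ : ℝ}
    (hf : DifferentiableAt ℝ f (s * Complex.exp (θ * Complex.I))) :
    HasDerivAt (fun s : ℝ => f (s * Complex.exp (θ * Complex.I)))
      (fderiv ℝ f (s * Complex.exp (θ * Complex.I)) (Complex.exp (θ * Complex.I))) s := by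
  have h1 : HasDerivAt (fun s : ℝ => (s : ℂ) * Complex.exp (θ * Complex.I))
      (Complex.exp (θ * Complex.I)) s := by
    simpa using Complex.ofRealCLM.hasDerivAt (x := s) |>.mul_const (Complex.exp (θ * Complex.I))
  exact hf.hasFDerivAt.comp_hasDerivAt s h1

theorem hasDerivAt_exp_I (θ : ℝ) : HasDerivAt (fun θ : ℝ => Complex.exp (θ * Complex.I))
    (Complex.exp (θ * Complex.I) * Complex.I) θ := by
  have h1 : HasDerivAt (fun θ : ℝ => (θ : ℂ) * Complex.I) Complex.I θ := by
    simpa using Complex.ofRealCLM.hasDerivAt (x := θ) |>.mul_const Complex.I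
  exact h1.cexp

theorem hasDerivAt_angle {E : Type*} [NormedAddCommGroup E] [NormedSpace ℝ E] {f : ℂ → E} {s θ : ℝ}
    (hf : DifferentiableAt ℝ f (s * Complex.exp (θ * Complex.I))) :
    HasDerivAt (fun θ : ℝ => f (s * Complex.exp (θ * Complex.I)))
      (s • fderiv ℝ f (s * Complex.exp (θ * Complex.I))
        (Complex.exp (θ * Complex.I) * Complex.I)) θ := by
  have h1 := (hasDerivAt_exp_I θ).const_mul (s : ℂ)
  have h2 := hf.hasFDerivAt.comp_hasDerivAt θ h1
  refine h2.congr_deriv ?_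
  have h3 := (fderiv ℝ f (s * Complex.exp (θ * Complex.I))).map_smul s
    (Complex.exp (θ * Complex.I) * Complex.I)
  rwa [Complex.real_smul] at h3

/-- At `s = 0` this is the limit `s log s → 0`; it makes the boundary term at the origin vanish in
`circle_mean`. -/
theorem continuous_mul_log_div (R : ℝ) :
    Continuous fun s : ℝ => s * (Real.log R - Real.log s) := by
  simp_rw [mul_sub]
  exact (continuous_id.mul continuous_const).sub Real.continuous_mul_log

theorem intervalIntegrable_log_sub (R a b : ℝ) :
    IntervalIntegrable (fun s : ℝ => Real.log R - Real.log s) volume a b :=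
  intervalIntegrable_const.sub intervalIntegral.intervalIntegrable_log'

theorem mul_exp_mem_disk {s : ℝ} (h0 : 0 ≤ s) (h1 : s < 1) (θ : ℝ) :
    (s * Complex.exp (θ * Complex.I) : ℂ) ∈ disk := by
  rwa [mem_disk, norm_mul, norm_exp_I, mul_one, Complex.norm_real, Real.norm_eq_abs,
    abs_of_nonneg h0]

/-- Green's formula for the circle mean of radius `R`. -/
theorem circle_mean {h : ℂ → ℂ} (hh : ContDiffOn ℝ 2 h disk) {R : ℝ} (hR0 : 0 < R) (hR1 : R < 1) :
    ∫ θ in (-Real.pi)..Real.pi, h (R * Complex.exp (θ * Complex.I)) =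
      2 * Real.pi * h 0 + ∫ s in 0..R, ((Real.log R - Real.log s : ℝ) : ℂ) *
        (s * ∫ θ in (-Real.pi)..Real.pi, Δ h (s * Complex.exp (θ * Complex.I))) := by
  have hpi := Real.pi_pos
  have hd1 : ContDiffOn ℝ 1 (fderiv ℝ h) disk := hh.fderiv_of_isOpen isOpen_disk (by norm_num)
  have hc2 : ContinuousOn (fderiv ℝ (fderiv ℝ h)) disk :=
    hd1.continuousOn_fderiv_of_isOpen isOpen_disk (by norm_num)
  have hdh : ∀ z ∈ disk, DifferentiableAt ℝ h z := fun z hz =>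
    (hh.differentiableOn (by norm_num)).differentiableAt (isOpen_disk.mem_nhds hz)
  have hdd : ∀ z ∈ disk, DifferentiableAt ℝ (fderiv ℝ h) z := fun z hz =>
    (hd1.differentiableOn (by norm_num)).differentiableAt (isOpen_disk.mem_nhds hz)
  set e : ℝ → ℂ := fun θ => Complex.exp (θ * Complex.I) with he
  have hec : Continuous e := by fun_prop
  have hmem : ∀ s ∈ Icc 0 R, ∀ θ, (s * e θ : ℂ) ∈ disk := fun s hs θ =>
    mul_exp_mem_disk hs.1 (hs.2.trans_lt hR1) θ
  -- continuity in polar coordinates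
  have c0 := continuousOn_polar hh.continuousOn hR1
  have c1 := continuousOn_polar hd1.continuousOn hR1
  have c2 := continuousOn_polar hc2 hR1
  have cfst : ∀ {E : Type} [TopologicalSpace E] {f : ℝ × ℝ → E}, ContinuousOn f (Icc 0 R ×ˢ univ) →
      ∀ θ, ContinuousOn (fun s => f (s, θ)) (Icc 0 R) := fun hf θ =>
    hf.comp (by fun_prop) fun s hs => ⟨hs, mem_univ _⟩
  have csnd : ∀ {E : Type} [TopologicalSpace E] {f : ℝ × ℝ → E}, ContinuousOn f (Icc 0 R ×ˢ univ) →
      ∀ s ∈ Icc 0 R, Continuous (fun θ => f (s, θ)) := fun hf s hs =>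
    continuousOn_univ.1 (hf.comp (by fun_prop) fun θ _ => ⟨hs, mem_univ _⟩)
  -- `B = ∂_s (s ∂_s h)`. Its angular integral will be that of `s Δh`, since the two differ by a
  -- `θ`-derivative.
  set B : ℝ × ℝ → ℂ := fun p => p.1 * fderiv ℝ (fderiv ℝ h) (p.1 * e p.2) (e p.2) (e p.2) +
    fderiv ℝ h (p.1 * e p.2) (e p.2) with hB
  have cB : ContinuousOn B (Icc 0 R ×ˢ univ) := by
    have : ContinuousOn (fun p : ℝ × ℝ => e p.2) (Icc 0 R ×ˢ univ) := by fun_prop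
    exact (ContinuousOn.mul (by fun_prop) ((c2.clm_apply this).clm_apply this)).add
      (c1.clm_apply this)
  -- integration along rays
  have hray : ∀ θ : ℝ, ∫ s in 0..R, ((Real.log R - Real.log s : ℝ) : ℂ) * B (s, θ) =
      h (R * e θ) - h 0 := by
    intro θ
    -- The antiderivative is `s log(R/s) ∂_s h + h`: the `-∂_s h` produced by differentiating the
    -- logarithm cancels the derivative of `h`. The first summand vanishes at both ends.
    have h1 := intervalIntegral.integral_eq_sub_of_hasDerivAt_of_le hR0.le
      (f := fun s : ℝ => ((s * (Real.log R - Real.log s) : ℝ) : ℂ) * fderiv ℝ h (s * e θ) (e θ) +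
        h (s * e θ))
      (f' := fun s => ((Real.log R - Real.log s : ℝ) : ℂ) * B (s, θ)) ?_ ?_ ?_
    · rw [h1]
      simp
    · exact (((Complex.continuous_ofReal.comp (continuous_mul_log_div R)).continuousOn).mul
        ((cfst c1 θ).clm_apply continuousOn_const)).add (cfst c0 θ)
    · intro s hs
      have hsd := hmem s ⟨hs.1.le, hs.2.le⟩ θ
      have hs0 : s ≠ 0 := hs.1.ne'
      have d1 : HasDerivAt (fun s : ℝ => s * (Real.log R - Real.log s))
          (Real.log R - Real.log s - 1) s := by
        refine ((hasDerivAt_id s).mul ((Real.hasDerivAt_log hs0).const_sub (Real.log R))).congr_deriv ?_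
        simp only [id]
        field_simp
        ring
      have d2 := (hasDerivAt_ray (hdd _ hsd)).clm_apply (hasDerivAt_const s (e θ))
      have d3 := (d1.ofReal_comp.mul d2).add (hasDerivAt_ray (hdh _ hsd))
      refine d3.congr_deriv ?_
      simp only [hB, he]
      push_cast
      simp
      ring
    · refine IntervalIntegrable.mul_continuousOn ?_ ?_
      · exact ⟨(intervalIntegrable_log_sub R 0 R).1.ofReal, (intervalIntegrable_log_sub R 0 R).2.ofReal⟩
      · rw [uIcc_of_le hR0.le]
        exact cfst cB θ
  -- integration along circles
  have hcirc : ∀ s ∈ Icc 0 R, ∫ θ in (-Real.pi)..Real.pi, B (s, θ) =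
      s * ∫ θ in (-Real.pi)..Real.pi, Δ h (s * e θ) := by
    intro s hs
    have cont1 : Continuous fun θ => fderiv ℝ h (s * e θ) := csnd c1 s hs
    have cont2 : Continuous fun θ => fderiv ℝ (fderiv ℝ h) (s * e θ) := csnd c2 s hs
    -- The `θ`-derivative of `Dh(i e)` is `s D²h(i e, i e) - Dh(e)`; it integrates to zero by
    -- periodicity, and added to `B` it gives `s Δh`.
    have h1 := intervalIntegral.integral_eq_sub_of_hasDerivAt (a := -Real.pi) (b := Real.pi)
      (f := fun θ : ℝ => fderiv ℝ h (s * e θ) (e θ * Complex.I))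
      (f' := fun θ => s * fderiv ℝ (fderiv ℝ h) (s * e θ) (e θ * Complex.I) (e θ * Complex.I) -
        fderiv ℝ h (s * e θ) (e θ)) ?_ ?_
    · have hper : e Real.pi = e (-Real.pi) := by simp [he, Complex.exp_neg]
      rw [hper, sub_self] at h1
      rw [← intervalIntegral.integral_const_mul, ← add_zero (∫ θ in (-Real.pi)..Real.pi, B (s, θ)),
        ← h1, ← intervalIntegral.integral_add]
      · refine intervalIntegral.integral_congr fun θ _ => ?_
        have hb := bilin_rotate (fderiv ℝ (fderiv ℝ h) (s * e θ)) (e θ)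
        rw [norm_exp_I, ← laplacian_eq_fderiv_fderiv] at hb
        simp only [hB]
        rw [show Δ h (s * e θ) = ((1 ^ 2 : ℝ) : ℂ) * Δ h (s * e θ) by simp, ← hb]
        ring
      · exact (csnd cB s hs).intervalIntegrable _ _
      · exact Continuous.intervalIntegrable (by fun_prop) _ _
    · intro θ _
      have hsd := hmem s hs θ
      have d2 := (hasDerivAt_angle (hdd _ hsd)).clm_apply ((hasDerivAt_exp_I θ).mul_const Complex.I)
      refine d2.congr_deriv ?_
      rw [mul_assoc, Complex.I_mul_I]
      simp [he]
      ring
    · exact Continuous.intervalIntegrable (by fun_prop) _ _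
  -- Fubini
  have hswap : ∫ θ in (-Real.pi)..Real.pi, ∫ s in 0..R, ((Real.log R - Real.log s : ℝ) : ℂ) * B (s, θ) =
      ∫ s in 0..R, ∫ θ in (-Real.pi)..Real.pi, ((Real.log R - Real.log s : ℝ) : ℂ) * B (s, θ) := by
    have hle : -Real.pi ≤ Real.pi := by linarith
    simp only [intervalIntegral.integral_of_le hR0.le, intervalIntegral.integral_of_le hle]
    rw [integral_integral_swap]
    have hlog : Integrable (fun s : ℝ => ((Real.log R - Real.log s : ℝ) : ℂ))
        (volume.restrict (Ioc 0 R)) :=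
      ((intervalIntegrable_iff_integrableOn_Ioc_of_le hR0.le).1
        (intervalIntegrable_log_sub R 0 R)).ofReal
    have hlog2 := hlog.comp_snd (volume.restrict (Ioc (-Real.pi) Real.pi))
    obtain ⟨M, hM⟩ := (isCompact_Icc.prod isCompact_Icc).exists_bound_of_continuousOn
      (cB.mono (prod_mono_right (subset_univ (Icc (-Real.pi) Real.pi))))
    have cB' : ContinuousOn (fun p : ℝ × ℝ => B (p.2, p.1)) (Ioc (-Real.pi) Real.pi ×ˢ Ioc 0 R) :=
      cB.comp (by fun_prop) fun p hp => ⟨Ioc_subset_Icc_self hp.2, mem_univ _⟩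
    refine hlog2.mul_bdd (c := M) ?_ ?_
    · rw [Measure.prod_restrict]
      exact cB'.aestronglyMeasurable (measurableSet_Ioc.prod measurableSet_Ioc)
    · rw [Measure.prod_restrict]
      filter_upwards [ae_restrict_mem (measurableSet_Ioc.prod measurableSet_Ioc)] with p hp
      exact hM _ ⟨Ioc_subset_Icc_self hp.2, Ioc_subset_Icc_self hp.1⟩
  simp_rw [hray, intervalIntegral.integral_const_mul] at hswap
  rw [intervalIntegral.integral_sub, intervalIntegral.integral_const, sub_eq_iff_eq_add] at hswap
  · rw [hswap, add_comm]
    congr 1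
    · rw [Complex.real_smul]
      push_cast
      ring
    · refine intervalIntegral.integral_congr fun s hs => ?_
      rw [uIcc_of_le hR0.le] at hs
      rw [hcirc s hs]
  · exact (csnd c0 R ⟨hR0.le, le_rfl⟩).intervalIntegrable _ _
  · exact intervalIntegrable_const

/-! ### Polar coordinates on the disk -/

theorem polar_preimage_disk :
    polarCoord.target ∩ Complex.polarCoord.symm ⁻¹' disk = Ioo (0 : ℝ) 1 ×ˢ Ioo (-Real.pi) Real.pi := by
  ext p
  rw [polarCoord_target]
  simp only [mem_inter_iff, mem_prod, mem_Ioi, mem_Ioo, mem_preimage, mem_disk,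
    Complex.norm_polarCoord_symm]
  constructor
  · rintro ⟨⟨h1, h2⟩, h3⟩
    exact ⟨⟨h1, (le_abs_self _).trans_lt h3⟩, h2⟩
  · rintro ⟨⟨h1, h2⟩, h3⟩
    exact ⟨⟨h1, h3⟩, by rwa [abs_of_pos h1]⟩

theorem polarCoord_symm_eq (p : ℝ × ℝ) :
    Complex.polarCoord.symm p = p.1 * Complex.exp (p.2 * Complex.I) := by
  rw [Complex.polarCoord_symm_apply, Complex.exp_mul_I, Complex.ofReal_cos, Complex.ofReal_sin]

theorem measurableSet_polar_preimage : MeasurableSet (Complex.polarCoord.symm ⁻¹' disk) := by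
  have : Continuous fun p : ℝ × ℝ => Complex.polarCoord.symm p := by
    simp_rw [polarCoord_symm_eq]
    fun_prop
  exact this.measurable measurableSet_disk

theorem lintegral_disk_polar (f : ℂ → ℝ≥0∞) :
    ∫⁻ w in disk, f w = ∫⁻ p in Ioo (0 : ℝ) 1 ×ˢ Ioo (-Real.pi) Real.pi,
      ENNReal.ofReal p.1 * f (p.1 * Complex.exp (p.2 * Complex.I)) := by
  rw [← lintegral_indicator measurableSet_disk, ← Complex.lintegral_comp_polarCoord_symm,
    ← polar_preimage_disk, inter_comm, ← setLIntegral_indicator measurableSet_polar_preimage]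
  refine lintegral_congr fun p => ?_
  by_cases hp : Complex.polarCoord.symm p ∈ disk
  · rw [indicator_of_mem hp, indicator_of_mem (mem_preimage.2 hp), polarCoord_symm_eq, smul_eq_mul]
  · rw [indicator_of_notMem hp, indicator_of_notMem (by exact hp), smul_zero]

theorem integral_disk_polar (f : ℂ → ℂ) :
    ∫ w in disk, f w = ∫ p in Ioo (0 : ℝ) 1 ×ˢ Ioo (-Real.pi) Real.pi,
      p.1 * f (p.1 * Complex.exp (p.2 * Complex.I)) := by
  rw [← integral_indicator measurableSet_disk, ← Complex.integral_comp_polarCoord_symm,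
    ← polar_preimage_disk, ← setIntegral_indicator measurableSet_polar_preimage]
  congr 1 with p
  by_cases hp : Complex.polarCoord.symm p ∈ disk
  · rw [indicator_of_mem hp, indicator_of_mem (mem_preimage.2 hp), polarCoord_symm_eq,
      Complex.real_smul]
  · rw [indicator_of_notMem hp, indicator_of_notMem (by exact hp), smul_zero]

theorem integral_disk_radial {F : ℂ → ℂ} (hF : ContinuousOn F disk) {k : ℝ → ℝ} (hk : Measurable k)
    (hint : IntegrableOn (fun w => F w * k ‖w‖) disk) :
    ∫ w in disk, F w * k ‖w‖ = ∫ r in Ioo (0 : ℝ) 1,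
      (r * k r : ℝ) * ∫ θ in (-Real.pi)..Real.pi, F (r * Complex.exp (θ * Complex.I)) := by
  have hle : -Real.pi ≤ Real.pi := by linarith [Real.pi_pos]
  have hS : MeasurableSet (Ioo (0 : ℝ) 1 ×ˢ Ioo (-Real.pi) Real.pi) :=
    measurableSet_Ioo.prod measurableSet_Ioo
  rw [integral_disk_polar, Measure.volume_eq_prod, setIntegral_prod]
  · refine setIntegral_congr_fun measurableSet_Ioo fun r hr => ?_
    simp only
    rw [intervalIntegral.integral_of_le hle, integral_Ioc_eq_integral_Ioo, ← integral_const_mul]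
    refine integral_congr_ae (Eventually.of_forall fun θ => ?_)
    simp only
    rw [norm_mul, norm_exp_I, mul_one, Complex.norm_real, Real.norm_eq_abs, abs_of_pos hr.1]
    push_cast
    ring
  · have hc : ContinuousOn (fun p : ℝ × ℝ => F (p.1 * Complex.exp (p.2 * Complex.I)))
        (Ioo (0 : ℝ) 1 ×ˢ Ioo (-Real.pi) Real.pi) :=
      hF.comp (by fun_prop) fun p hp => mul_exp_mem_disk hp.1.1.le hp.1.2 p.2
    rw [← Measure.volume_eq_prod]
    refine ⟨?_, ?_⟩
    · have h1 : Measurable fun p : ℝ × ℝ => (p.1 : ℂ) := by fun_prop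
      have h2 : Measurable fun p : ℝ × ℝ => ((k ‖(p.1 * Complex.exp (p.2 * Complex.I) : ℂ)‖ : ℝ) : ℂ) := by
        fun_prop
      exact h1.aestronglyMeasurable.mul ((hc.aestronglyMeasurable hS).mul h2.aestronglyMeasurable)
    · have h := hint.2
      rw [hasFiniteIntegral_iff_enorm, lintegral_disk_polar] at h
      rw [hasFiniteIntegral_iff_enorm]
      refine lt_of_le_of_lt (le_of_eq (setLIntegral_congr_fun hS fun p hp => ?_)) h
      rw [enorm_mul, ← ofReal_norm (p.1 : ℂ), Complex.norm_real, Real.norm_eq_abs,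
        abs_of_pos hp.1.1]

/-! ### Radial integrals in the variable `y = |w|²` and Green's formula for radial means. -/

theorem lintegral_Ioo_sq {a b : ℝ} (ha : 0 ≤ a) (hab : a ≤ b) (f : ℝ → ℝ≥0∞) :
    ∫⁻ y in Ioo (a ^ 2) (b ^ 2), f y = ∫⁻ r in Ioo a b, ENNReal.ofReal (2 * r) * f (r ^ 2) := by
  have himg : (fun r : ℝ => r ^ 2) '' Ioo a b = Ioo (a ^ 2) (b ^ 2) := by
    ext y
    constructor
    · rintro ⟨r, hr, rfl⟩
      exact ⟨pow_lt_pow_left₀ hr.1 ha (by norm_num),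
        pow_lt_pow_left₀ hr.2 (ha.trans hr.1.le) (by norm_num)⟩
    · intro hy
      have hy0 : 0 ≤ y := (sq_nonneg a).trans hy.1.le
      exact ⟨√y, ⟨Real.lt_sqrt_of_sq_lt hy.1, (Real.sqrt_lt' (by nlinarith [hy.1, hy.2])).2 hy.2⟩,
        Real.sq_sqrt hy0⟩
  have h := lintegral_image_eq_lintegral_abs_deriv_mul (s := Ioo a b) (f := fun r : ℝ => r ^ 2)
    (f' := fun r => 2 * r) measurableSet_Ioo
    (fun r _ => by simpa using ((hasDerivAt_pow 2 r).hasDerivWithinAt))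
    (fun r hr q hq hrq => by
      have h0 := ha.trans_lt hr.1
      have h1 := ha.trans_lt hq.1
      exact (pow_left_inj₀ h0.le h1.le (by norm_num)).1 hrq) f
  rw [himg] at h
  rw [h]
  refine setLIntegral_congr_fun measurableSet_Ioo fun r hr => ?_
  rw [abs_of_pos (by linarith [ha.trans_lt hr.1])]

theorem lintegral_disk_radial {ω : ℝ → ℝ≥0∞} (hω : Measurable ω) :
    ∫⁻ w in disk, ω (‖w‖ ^ 2) = ENNReal.ofReal Real.pi * ∫⁻ y in Ioo 0 1, ω y := by
  have h := lintegral_Ioo_sq le_rfl zero_le_one ω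
  rw [zero_pow two_ne_zero, one_pow] at h
  rw [lintegral_disk_polar, h, Measure.volume_eq_prod, ← Measure.prod_restrict, lintegral_prod]
  · rw [← lintegral_const_mul' _ _ ENNReal.ofReal_ne_top]
    refine setLIntegral_congr_fun measurableSet_Ioo fun r hr => ?_
    simp only [norm_mul, norm_exp_I, mul_one, Complex.norm_real, Real.norm_eq_abs, sq_abs,
      lintegral_const, Measure.restrict_apply_univ, Real.volume_Ioo]
    rw [mul_comm, ← mul_assoc, ← mul_assoc, ← ENNReal.ofReal_mul Real.pi_pos.le,
      ← ENNReal.ofReal_mul (by linarith [Real.pi_pos])]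
    congr 2
    ring
  · exact Measurable.aemeasurable (by fun_prop)

/-- `log x = 2 log √x ≤ 2 √x`. This majorant is free of `y` and integrable in `s` on `(0, 1)`, which
makes the kernel `τ` of `radial_formula` integrable on the disk. -/
theorem log_div_le_inv_sqrt {s y : ℝ} (hs : 0 < s) (hsy : s ≤ y) (hy : y ≤ 1) :
    Real.log (y / s) ≤ 2 * (√s)⁻¹ := by
  have h1 : 0 < y / s := div_pos (hs.trans_le hsy) hs
  have h2 := Real.log_le_sub_one_of_pos (Real.sqrt_pos.2 h1)
  rw [Real.log_sqrt h1.le, Real.sqrt_div (hs.le.trans hsy)] at h2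
  have h3 : √y / √s ≤ (√s)⁻¹ := by
    rw [div_eq_mul_inv]
    have : √y ≤ 1 := Real.sqrt_le_one.2 hy
    have : 0 ≤ (√s)⁻¹ := by positivity
    nlinarith
  linarith

theorem lintegral_inv_sqrt : ∫⁻ s in Ioo (0 : ℝ) 1, ENNReal.ofReal ((√s)⁻¹) = ENNReal.ofReal 2 := by
  have h := lintegral_Ioo_of_hasDerivAt zero_le_one (f := fun s : ℝ => 2 * √s)
    (f' := fun s => (√s)⁻¹) (by fun_prop) (fun s hs => ?_) fun s hs => by positivity
  · rw [h]
    simp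
  · have h1 := (Real.hasDerivAt_sqrt hs.1.ne').const_mul 2
    refine h1.congr_deriv ?_
    have : √s ≠ 0 := (Real.sqrt_pos.2 hs.1).ne'
    field_simp

/-- The radial mean of a `C²` function through its Laplacian. -/
theorem radial_formula {h : ℂ → ℂ} (hh : ContDiffOn ℝ 2 h disk) {C : ℝ}
    (hb : ∀ z ∈ disk, ‖h z‖ ≤ C) (hΔ : ∀ z ∈ disk, ‖Δ h z‖ ≤ C) {ω : ℝ → ℝ} (hω : Measurable ω)
    (hω0 : ∀ y < 1, 0 ≤ ω y) {m : ℝ} (hm : 0 ≤ m)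
    (hfin : ∫⁻ y in Ioo 0 1, ENNReal.ofReal (ω y) = ENNReal.ofReal m) {τ : ℝ → ℝ≥0∞}
    (hτm : Measurable τ) (hτ : ∀ s ∈ Ioo (0 : ℝ) 1,
      ∫⁻ y in Ioo s 1, ENNReal.ofReal (Real.log (y / s) / 4) * ENNReal.ofReal (ω y) = τ s) :
    IntegrableOn (fun w => Δ h w * (τ (‖w‖ ^ 2)).toReal) disk ∧
      ∫ w in disk, h w * ω (‖w‖ ^ 2) =
        Real.pi * m * h 0 + ∫ w in disk, Δ h w * (τ (‖w‖ ^ 2)).toReal := by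
  have hpi := Real.pi_pos
  have hle : -Real.pi ≤ Real.pi := by linarith
  have hC : 0 ≤ C := (norm_nonneg _).trans (hb 0 zero_mem_disk)
  have hLc := continuousOn_laplacian isOpen_disk hh
  have hlt : ∀ w ∈ disk, ‖w‖ ^ 2 < 1 := fun w hw => by linarith [one_sub_norm_sq_pos hw]
  -- bounds for the kernel
  have hτle : ∀ s ∈ Ioo (0 : ℝ) 1, τ s ≤ ENNReal.ofReal ((√s)⁻¹) * ENNReal.ofReal m := by
    intro s hs
    rw [← hτ s hs, ← hfin, ← lintegral_const_mul' _ _ ENNReal.ofReal_ne_top]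
    refine le_trans (setLIntegral_mono' measurableSet_Ioo fun y hy => ?_)
      (lintegral_mono_set (Ioo_subset_Ioo_left hs.1.le))
    gcongr
    have := log_div_le_inv_sqrt hs.1 hy.1.le hy.2.le
    have : 0 ≤ (√s)⁻¹ := by positivity
    linarith
  have hτint : ∫⁻ w in disk, τ (‖w‖ ^ 2) < ⊤ := by
    rw [lintegral_disk_radial hτm]
    refine ENNReal.mul_lt_top ENNReal.ofReal_lt_top ?_
    calc _ ≤ ∫⁻ s in Ioo (0 : ℝ) 1, ENNReal.ofReal ((√s)⁻¹) * ENNReal.ofReal m :=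
          setLIntegral_mono' measurableSet_Ioo hτle
      _ = ENNReal.ofReal 2 * ENNReal.ofReal m := by
          rw [lintegral_mul_const' _ _ ENNReal.ofReal_ne_top, lintegral_inv_sqrt]
      _ < ⊤ := ENNReal.mul_lt_top ENNReal.ofReal_lt_top ENNReal.ofReal_lt_top
  have hbase : ∀ {F : ℂ → ℂ} {k : ℝ → ℝ} {K : ℝ → ℝ≥0∞}, ContinuousOn F disk → (∀ z ∈ disk, ‖F z‖ ≤ C) →
      Measurable k → (∀ y < 1, ‖k y‖ₑ ≤ K y) → ∫⁻ w in disk, K (‖w‖ ^ 2) < ⊤ →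
      IntegrableOn (fun w => F w * (k (‖w‖ ^ 2) : ℂ)) disk := by
    intro F k K hF hFb hk hkK hK
    refine ⟨(hF.aestronglyMeasurable measurableSet_disk).mul
      (Measurable.aestronglyMeasurable (by fun_prop)), ?_⟩
    rw [hasFiniteIntegral_iff_enorm]
    calc _ ≤ ∫⁻ w in disk, ENNReal.ofReal C * K (‖w‖ ^ 2) := by
          refine setLIntegral_mono' measurableSet_disk fun w hw => ?_
          rw [enorm_mul]
          gcongr
          · rw [← ofReal_norm]
            exact ENNReal.ofReal_le_ofReal (hFb w hw)
          · rw [← ofReal_norm, Complex.norm_real, ofReal_norm]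
            exact hkK _ (hlt w hw)
      _ < ⊤ := by
          rw [lintegral_const_mul' _ _ ENNReal.ofReal_ne_top]
          exact ENNReal.mul_lt_top ENNReal.ofReal_lt_top hK
  have hI1 : IntegrableOn (fun w => Δ h w * ((τ (‖w‖ ^ 2)).toReal : ℂ)) disk := by
    refine hbase (k := fun y => (τ y).toReal) hLc hΔ hτm.ennreal_toReal (fun y _ => ?_) hτint
    rw [Real.enorm_eq_ofReal ENNReal.toReal_nonneg]
    exact ENNReal.ofReal_toReal_le
  have hI0 : IntegrableOn (fun w => h w * (ω (‖w‖ ^ 2) : ℂ)) disk := by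
    refine hbase (K := fun y => ENNReal.ofReal (ω y)) hh.continuousOn hb hω (fun y hy => ?_) ?_
    · rw [Real.enorm_eq_ofReal (hω0 y hy)]
    · rw [lintegral_disk_radial (ω := fun y => ENNReal.ofReal (ω y)) (by fun_prop), hfin]
      exact ENNReal.mul_lt_top ENNReal.ofReal_lt_top ENNReal.ofReal_lt_top
  refine ⟨hI1, ?_⟩
  -- reduction to radial integrals
  have hr1 : ∀ r ∈ Ioo (0 : ℝ) 1, r ^ 2 < 1 := fun r hr => by nlinarith [hr.1, hr.2]
  have e0 := integral_disk_radial (k := fun r => ω (r ^ 2)) hh.continuousOn (by fun_prop) hI0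
  have e1 := integral_disk_radial (k := fun r => (τ (r ^ 2)).toReal) hLc (by fun_prop) hI1
  rw [e0, e1]
  set D : ℝ → ℂ := fun s => ∫ θ in (-Real.pi)..Real.pi, Δ h (s * Complex.exp (θ * Complex.I)) with hD
  have hDb : ∀ s ∈ Ioo (0 : ℝ) 1, ‖D s‖ ≤ 2 * Real.pi * C := by
    intro s hs
    have := intervalIntegral.norm_integral_le_of_norm_le_const (a := -Real.pi) (b := Real.pi)
      (C := C) (f := fun θ : ℝ => Δ h (s * Complex.exp (θ * Complex.I)))
      fun θ _ => hΔ _ (mul_exp_mem_disk hs.1.le hs.2 θ)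
    rw [abs_of_pos (by linarith)] at this
    linarith
  have hDm : AEStronglyMeasurable D (volume.restrict (Ioo 0 1)) := by
    have hc : ContinuousOn (fun p : ℝ × ℝ => Δ h (p.1 * Complex.exp (p.2 * Complex.I)))
        (Ioo (0 : ℝ) 1 ×ˢ Ioc (-Real.pi) Real.pi) :=
      hLc.comp (by fun_prop) fun p hp => mul_exp_mem_disk hp.1.1.le hp.1.2 p.2
    have h1 := hc.aestronglyMeasurable (μ := volume) (measurableSet_Ioo.prod measurableSet_Ioc)
    rw [Measure.volume_eq_prod, ← Measure.prod_restrict] at h1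
    have h2 := h1.integral_prod_right'
    simp only [hD, intervalIntegral.integral_of_le hle]
    exact h2
  have hrω : IntegrableOn (fun r : ℝ => r * ω (r ^ 2)) (Ioo 0 1) ∧
      ∫ r in Ioo (0 : ℝ) 1, r * ω (r ^ 2) = m / 2 := by
    have h1 : ∫⁻ r in Ioo (0 : ℝ) 1, ENNReal.ofReal (r * ω (r ^ 2)) = ENNReal.ofReal (m / 2) := by
      have h2 := lintegral_Ioo_sq le_rfl zero_le_one fun y => ENNReal.ofReal (ω y)
      rw [zero_pow two_ne_zero, one_pow, hfin] at h2
      rw [div_eq_inv_mul, ENNReal.ofReal_mul (by norm_num), h2,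
        ← lintegral_const_mul' _ _ ENNReal.ofReal_ne_top]
      refine setLIntegral_congr_fun measurableSet_Ioo fun r hr => ?_
      have := hω0 _ (hr1 r hr)
      have := hr.1
      rw [← ENNReal.ofReal_mul (by positivity), ← ENNReal.ofReal_mul (by positivity)]
      congr 1
      ring
    have h3 : 0 ≤ᵐ[volume.restrict (Ioo (0 : ℝ) 1)] fun r => r * ω (r ^ 2) := by
      filter_upwards [ae_restrict_mem measurableSet_Ioo] with r hr
      exact mul_nonneg hr.1.le (hω0 _ (hr1 r hr))
    have h4 : AEStronglyMeasurable (fun r : ℝ => r * ω (r ^ 2)) (volume.restrict (Ioo 0 1)) :=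
      Measurable.aestronglyMeasurable (by fun_prop)
    refine ⟨⟨h4, ?_⟩, ?_⟩
    · rw [hasFiniteIntegral_iff_ofReal h3, h1]
      exact ENNReal.ofReal_lt_top
    · rw [integral_eq_lintegral_of_nonneg_ae h3 h4, h1, ENNReal.toReal_ofReal (by positivity)]
  -- Both sides of the formula are iterated integrals of `Ψ` over the triangle `s < r`: integrating
  -- in `s` first gives the circle mean of radius `r` minus its central value, integrating in `r`
  -- first gives the kernel `τ`.
  set Ψ : ℝ → ℝ → ℂ := fun r s => {p : ℝ × ℝ | p.2 < p.1}.indicator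
    (fun p => ((p.1 * ω (p.1 ^ 2) * (Real.log p.1 - Real.log p.2) : ℝ) : ℂ) * (p.2 * D p.2)) (r, s)
    with hΨ
  have hT : MeasurableSet {p : ℝ × ℝ | p.2 < p.1} := measurableSet_lt measurable_snd measurable_fst
  -- `s log(r/s) ≤ r - s ≤ 1` absorbs the logarithm, so that `Ψ` is dominated by `2πC r ω(r²)`, a
  -- function of `r` alone.
  have hlog : ∀ r ∈ Ioo (0 : ℝ) 1, ∀ s ∈ Ioo (0 : ℝ) 1, s < r →
      0 ≤ Real.log r - Real.log s ∧ (Real.log r - Real.log s) * s ≤ 1 := by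
    intro r hr s hs hsr
    have h1 := Real.log_le_sub_one_of_pos (div_pos hr.1 hs.1)
    have h2 := log_div_nonneg hs.1 hsr.le
    rw [Real.log_div hr.1.ne' hs.1.ne'] at h1 h2
    refine ⟨h2, ?_⟩
    have h3 := mul_le_mul_of_nonneg_right h1 hs.1.le
    have h4 : (r / s - 1) * s = r - s := by
      have := hs.1.ne'
      field_simp
    linarith [hr.2, hs.1]
  have hΨint : Integrable (Function.uncurry Ψ)
      ((volume.restrict (Ioo (0 : ℝ) 1)).prod (volume.restrict (Ioo (0 : ℝ) 1))) := by
    have h1 := (hrω.1.mul_const (2 * Real.pi * C)).comp_fst (volume.restrict (Ioo (0 : ℝ) 1))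
    refine h1.mono' ?_ ?_
    · refine AEStronglyMeasurable.indicator ?_ hT
      refine (Measurable.aestronglyMeasurable (by fun_prop)).mul
        ((Measurable.aestronglyMeasurable (by fun_prop)).mul hDm.comp_snd)
    · rw [Measure.prod_restrict]
      filter_upwards [ae_restrict_mem (measurableSet_Ioo.prod measurableSet_Ioo)] with p hp
      have p1 := mul_nonneg hp.1.1.le (hω0 _ (hr1 _ hp.1))
      by_cases hlt : p.2 < p.1
      · obtain ⟨l1, l2⟩ := hlog _ hp.1 _ hp.2 hlt
        have e : Function.uncurry Ψ p = ((p.1 * ω (p.1 ^ 2) * (Real.log p.1 - Real.log p.2) : ℝ) : ℂ) *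
          (p.2 * D p.2) := by
          simp only [Function.uncurry, hΨ]
          exact indicator_of_mem (by exact hlt) _
        rw [e, norm_mul, norm_mul, Complex.norm_real, Complex.norm_real, Real.norm_eq_abs,
          Real.norm_eq_abs, abs_of_pos hp.2.1, abs_of_nonneg (mul_nonneg p1 l1)]
        have h5 := hDb _ hp.2
        calc _ = p.1 * ω (p.1 ^ 2) * (((Real.log p.1 - Real.log p.2) * p.2) * ‖D p.2‖) := by ring
          _ ≤ p.1 * ω (p.1 ^ 2) * (1 * (2 * Real.pi * C)) := by gcongr
          _ = _ := by ring
      · have e : Function.uncurry Ψ p = 0 := by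
          simp only [Function.uncurry, hΨ]
          exact indicator_of_notMem (by exact hlt) _
        rw [e, norm_zero]
        positivity
  have hswap := integral_integral_swap hΨint
  have hleft : ∀ r ∈ Ioo (0 : ℝ) 1, ∫ s in Ioo (0 : ℝ) 1, Ψ r s =
      ((r * ω (r ^ 2) : ℝ) : ℂ) * (∫ θ in (-Real.pi)..Real.pi, h (r * Complex.exp (θ * Complex.I))) -
        ((r * ω (r ^ 2) : ℝ) : ℂ) * (2 * Real.pi * h 0) := by
    intro r hr
    rw [circle_mean hh hr.1 hr.2, mul_add, add_sub_cancel_left, intervalIntegral.integral_of_le hr.1.le,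
      integral_Ioc_eq_integral_Ioo, ← integral_const_mul]
    have e : Ioo (0 : ℝ) r = Ioo 0 1 ∩ Iio r := by
      ext s
      simp only [mem_Ioo, mem_inter_iff, mem_Iio]
      exact ⟨fun hs => ⟨⟨hs.1, hs.2.trans hr.2⟩, hs.2⟩, fun hs => ⟨hs.1.1, hs.2⟩⟩
    rw [e, ← setIntegral_indicator measurableSet_Iio]
    refine integral_congr_ae (Eventually.of_forall fun s => ?_)
    by_cases hs : s < r
    · simp only [hΨ]
      rw [indicator_of_mem (by exact hs), indicator_of_mem (by exact hs)]
      push_cast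
      ring
    · simp only [hΨ]
      rw [indicator_of_notMem (by exact hs), indicator_of_notMem (by exact hs)]
  have hright : ∀ s ∈ Ioo (0 : ℝ) 1, ∫ r in Ioo (0 : ℝ) 1, Ψ r s =
      ((s * (τ (s ^ 2)).toReal : ℝ) : ℂ) * D s := by
    intro s hs
    have e : Ioo s 1 = Ioo 0 1 ∩ Ioi s := by
      ext r
      simp only [mem_Ioo, mem_inter_iff, mem_Ioi]
      exact ⟨fun hr => ⟨⟨hs.1.trans hr.1, hr.2⟩, hr.1⟩, fun hr => ⟨hr.2, hr.1.2⟩⟩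
    have h1 : ∫ r in Ioo (0 : ℝ) 1, Ψ r s = ∫ r in Ioo s 1,
        ((r * ω (r ^ 2) * (Real.log r - Real.log s) : ℝ) : ℂ) * (s * D s) := by
      rw [e, ← setIntegral_indicator measurableSet_Ioi]
      refine integral_congr_ae (Eventually.of_forall fun r => ?_)
      by_cases hr : s < r
      · simp only [hΨ]
        rw [indicator_of_mem (by exact hr), indicator_of_mem (by exact hr)]
      · simp only [hΨ]
        rw [indicator_of_notMem (by exact hr), indicator_of_notMem (by exact hr)]
    -- Source of the factor `1/4`: with `y = r²` one half comes from `dy = 2r dr` and another from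
    -- `log(r²/s²) = 2 log(r/s)`.
    have h2 : ∫ r in Ioo s 1, r * ω (r ^ 2) * (Real.log r - Real.log s) = (τ (s ^ 2)).toReal := by
      rw [integral_eq_lintegral_of_nonneg_ae]
      · congr 1
        have h3 := lintegral_Ioo_sq hs.1.le hs.2.le
          fun y => ENNReal.ofReal (Real.log (y / s ^ 2) / 4) * ENNReal.ofReal (ω y)
        rw [one_pow, hτ (s ^ 2) ⟨by have := hs.1; positivity, hr1 s hs⟩] at h3
        rw [h3]
        refine setLIntegral_congr_fun measurableSet_Ioo fun r hr => ?_
        have hr' : r ∈ Ioo (0 : ℝ) 1 := ⟨hs.1.trans hr.1, hr.2⟩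
        have l1 := (hlog r hr' s hs hr.1).1
        have l2 : Real.log (r ^ 2 / s ^ 2) = 2 * (Real.log r - Real.log s) := by
          rw [← div_pow, Real.log_pow, Real.log_div hr'.1.ne' hs.1.ne']
          norm_num
        have l3 := hω0 _ (hr1 r hr')
        have l4 := hr'.1
        rw [l2, ← ENNReal.ofReal_mul (by positivity), ← ENNReal.ofReal_mul (by positivity)]
        congr 1
        ring
      · filter_upwards [ae_restrict_mem measurableSet_Ioo] with r hr
        have hr' : r ∈ Ioo (0 : ℝ) 1 := ⟨hs.1.trans hr.1, hr.2⟩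
        exact mul_nonneg (mul_nonneg hr'.1.le (hω0 _ (hr1 r hr'))) (hlog r hr' s hs hr.1).1
      · exact Measurable.aestronglyMeasurable (by fun_prop)
    rw [h1, integral_mul_const, integral_complex_ofReal, h2]
    push_cast
    ring
  rw [setIntegral_congr_fun measurableSet_Ioo hleft,
    setIntegral_congr_fun measurableSet_Ioo hright] at hswap
  have hcint : IntegrableOn (fun r : ℝ => ((r * ω (r ^ 2) : ℝ) : ℂ) * (2 * Real.pi * h 0)) (Ioo 0 1) :=
    hrω.1.ofReal.mul_const _
  have hfirst : IntegrableOn (fun r : ℝ => ((r * ω (r ^ 2) : ℝ) : ℂ) *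
      ∫ θ in (-Real.pi)..Real.pi, h (r * Complex.exp (θ * Complex.I))) (Ioo 0 1) := by
    have h1 := hΨint.integral_prod_left
    refine (h1.add hcint).congr ?_
    filter_upwards [ae_restrict_mem measurableSet_Ioo] with r hr
    have := hleft r hr
    simp only [Pi.add_apply, Function.uncurry]
    rw [this]
    ring
  rw [integral_sub hfirst hcint, sub_eq_iff_eq_add'] at hswap
  rw [hswap, integral_mul_const, integral_complex_ofReal, hrω.2]
  congr 1
  push_cast
  ring

/-! ### The measures `λ_t` and the Bergman kernel -/

theorem measurable_weight (t : ℝ) : Measurable (weight t) := by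
  unfold weight
  fun_prop

theorem weight_nonneg {t : ℝ} (ht : -1 < t) {z : ℂ} (hz : z ∈ disk) : 0 ≤ weight t z := by
  have h1 := one_sub_norm_sq_pos hz
  have h2 : 0 < t + 1 := by linarith
  unfold weight
  positivity

theorem lintegral_lam (t : ℝ) (f : ℂ → ℝ≥0∞) :
    ∫⁻ z, f z ∂(lam t) = ∫⁻ z in disk, ENNReal.ofReal (weight t z) * f z := by
  rw [lam, lintegral_withDensity_eq_lintegral_mul_non_measurable]
  · rfl
  · exact (measurable_weight t).ennreal_ofReal
  · exact Eventually.of_forall fun _ => ENNReal.ofReal_lt_top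

theorem integral_lam {t : ℝ} (ht : -1 < t) (f : ℂ → ℂ) :
    ∫ z, f z ∂(lam t) = ∫ z in disk, weight t z * f z := by
  rw [lam, integral_withDensity_eq_integral_toReal_smul]
  · refine setIntegral_congr_fun measurableSet_disk fun z hz => ?_
    rw [ENNReal.toReal_ofReal (weight_nonneg ht hz), Complex.real_smul]
  · exact (measurable_weight t).ennreal_ofReal
  · exact Eventually.of_forall fun _ => ENNReal.ofReal_lt_top

theorem integrable_lam {t : ℝ} (ht : -1 < t) (f : ℂ → ℂ) :
    Integrable f (lam t) ↔ IntegrableOn (fun z => weight t z * f z) disk := by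
  rw [lam, integrable_withDensity_iff_integrable_smul']
  · refine integrable_congr ?_
    filter_upwards [ae_restrict_mem measurableSet_disk] with z hz
    rw [ENNReal.toReal_ofReal (weight_nonneg ht hz), Complex.real_smul]
  · exact (measurable_weight t).ennreal_ofReal
  · exact Eventually.of_forall fun _ => ENNReal.ofReal_lt_top

theorem ae_lam_mem (t : ℝ) : ∀ᵐ z ∂(lam t), z ∈ disk :=
  (lam_ac t).ae_le (ae_restrict_mem measurableSet_disk)

theorem lintegral_radial_density {t : ℝ} (ht : -1 < t) :
    ∫⁻ y in Ioo 0 1, ENNReal.ofReal ((t + 1) / Real.pi * (1 - y) ^ t) =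
      ENNReal.ofReal (1 / Real.pi) := by
  have hpi := Real.pi_pos
  calc _ = ∫⁻ y in Ioo (0 : ℝ) 1, ENNReal.ofReal (1 / Real.pi) *
        ENNReal.ofReal ((t + 1) * (1 - y) ^ t) := by
        refine setLIntegral_congr_fun measurableSet_Ioo fun y _ => ?_
        rw [← ENNReal.ofReal_mul (by positivity)]
        congr 1
        ring
    _ = _ := by
        rw [lintegral_const_mul' _ _ ENNReal.ofReal_ne_top, lintegral_one_sub_rpow ht zero_le_one]
        simp

theorem lam_univ {t : ℝ} (ht : -1 < t) : lam t univ = 1 := by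
  have h := lintegral_lam t 1
  simp only [Pi.one_apply, lintegral_one, mul_one] at h
  rw [h]
  have h2 := lintegral_disk_radial (ω := fun y => ENNReal.ofReal ((t + 1) / Real.pi * (1 - y) ^ t))
    (by fun_prop)
  unfold weight
  rw [h2, lintegral_radial_density ht, ← ENNReal.ofReal_mul Real.pi_pos.le]
  have := Real.pi_pos.ne'
  field_simp
  simp

theorem isProbabilityMeasure_lam {t : ℝ} (ht : -1 < t) : IsProbabilityMeasure (lam t) :=
  ⟨lam_univ ht⟩

/-- The Bergman kernel `k_z(w) = (1 - w z̄)^(-(t+2))`. -/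
def bk (t : ℝ) (z w : ℂ) : ℂ := (1 - w * conj z) ^ ((-(t + 2) : ℝ) : ℂ)

theorem norm_bk (t : ℝ) (z w : ℂ) : ‖bk t z w‖ = ‖1 - w * conj z‖ ^ (-(t + 2)) :=
  Complex.norm_cpow_real _ _

theorem one_sub_mul_conj_mem_slitPlane {z w : ℂ} (hz : z ∈ disk) (hw : ‖w‖ ≤ 1) :
    1 - w * conj z ∈ Complex.slitPlane := by
  left
  have h1 : ‖w * conj z‖ < 1 := by
    rw [norm_mul, RCLike.norm_conj]
    have := mem_disk.1 hz
    nlinarith [norm_nonneg z, norm_nonneg w]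
  have h2 := (Complex.re_le_norm (w * conj z))
  rw [Complex.sub_re, Complex.one_re]
  linarith

theorem differentiableAt_bk (t : ℝ) {z w : ℂ} (hz : z ∈ disk) (hw : ‖w‖ ≤ 1) :
    DifferentiableAt ℂ (bk t z) w :=
  DifferentiableAt.cpow_const (by fun_prop) (one_sub_mul_conj_mem_slitPlane hz hw)

/-- With `a = (1 - |z|²)/|1 - u z̄|²` the Jacobian is `a²` and `1 - |φ_z(u)|² = a (1 - |u|²)`, so
`φ_z` pulls `λ_t` back to `a^(t+2) λ_t`. -/
theorem mobiusJac_mul_weight (t : ℝ) {z u : ℂ} (hz : z ∈ disk) (hu : u ∈ disk) :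
    mobiusJac z u * weight t (mobius z u) =
      weight t u * ((1 - ‖z‖ ^ 2) / ‖1 - u * conj z‖ ^ 2) ^ (t + 2) := by
  have h1 := norm_one_sub_pos hz hu
  have h2 := one_sub_norm_sq_pos hz
  have h3 := one_sub_norm_sq_pos hu
  have h4 : 0 < (1 - ‖z‖ ^ 2) / ‖1 - u * conj z‖ ^ 2 := by positivity
  rw [weight, weight, one_sub_norm_mobius_sq hz hu, mobiusJac, mul_comm (1 - ‖z‖ ^ 2), mul_div_assoc,
    Real.mul_rpow h3.le h4.le, Real.rpow_add h4, Real.rpow_two]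
  ring

theorem norm_one_sub_mobius {z u : ℂ} (hz : z ∈ disk) (hu : u ∈ disk) :
    ‖1 - mobius z u * conj z‖ = (1 - ‖z‖ ^ 2) / ‖1 - u * conj z‖ := by
  rw [one_sub_mobius_mul hz hu, norm_div, Complex.norm_real, Real.norm_eq_abs,
    abs_of_pos (one_sub_norm_sq_pos hz)]

/-- The probability measure `(1 - |z|²)^(t+2) |k_z|² dλ_t` is the image of `λ_t` under `φ_z`. -/
theorem mobiusJac_mul_weight_mul_norm_bk_sq (t : ℝ) {z u : ℂ} (hz : z ∈ disk) (hu : u ∈ disk) :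
    mobiusJac z u * (weight t (mobius z u) * ‖bk t z (mobius z u)‖ ^ 2) =
      (1 - ‖z‖ ^ 2) ^ (-(t + 2)) * weight t u := by
  have h1 := norm_one_sub_pos hz hu
  have h2 := one_sub_norm_sq_pos hz
  have h4 : 0 < (1 - ‖z‖ ^ 2) / ‖1 - u * conj z‖ ^ 2 := by positivity
  have h5 : 0 < (1 - ‖z‖ ^ 2) / ‖1 - u * conj z‖ := by positivity
  rw [← mul_assoc, mobiusJac_mul_weight t hz hu, norm_bk, norm_one_sub_mobius hz hu, sq (_ ^ _),
    ← Real.mul_rpow h5.le h5.le, Real.rpow_neg (by positivity), ← Real.inv_rpow (by positivity),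
    mul_assoc, ← Real.mul_rpow h4.le (by positivity), Real.rpow_neg h2.le, ← Real.inv_rpow h2.le,
    mul_comm]
  congr 2
  field_simp

/-! ### The pair integrand -/

/-- For `z` in the disk, `z - w` ranges in the ball of radius `2`. In polar coordinates the Jacobian
cancels `|v|⁻¹`, and the bound `4π` is the area of `(0, 2) × (-π, π)`. -/
theorem integrableOn_inv_norm_sub :
    IntegrableOn (fun p : ℂ × ℂ => ‖p.1 - p.2‖⁻¹) (disk ×ˢ disk) := by
  have hm : Measurable fun p : ℂ × ℂ => ‖p.1 - p.2‖⁻¹ := by fun_prop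
  refine ⟨hm.aestronglyMeasurable, ?_⟩
  rw [hasFiniteIntegral_iff_ofReal (Eventually.of_forall fun p => by positivity),
    Measure.volume_eq_prod, ← Measure.prod_restrict, lintegral_prod _ hm.ennreal_ofReal.aemeasurable]
  have hball : ∫⁻ v in ball (0 : ℂ) 2, ENNReal.ofReal ‖v‖⁻¹ ≤ ENNReal.ofReal (4 * Real.pi) := by
    have hpi := Real.pi_pos
    rw [← lintegral_indicator measurableSet_ball, ← Complex.lintegral_comp_polarCoord_symm]
    calc _ ≤ ∫⁻ p in polarCoord.target, (Ioo (0 : ℝ) 2 ×ˢ Ioo (-Real.pi) Real.pi).indicator 1 p := by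
          refine setLIntegral_mono' polarCoord.open_target.measurableSet fun p hp => ?_
          rw [polarCoord_target] at hp
          by_cases h : Complex.polarCoord.symm p ∈ ball (0 : ℂ) 2
          · rw [indicator_of_mem h, Complex.norm_polarCoord_symm, abs_of_pos hp.1, indicator_of_mem,
              smul_eq_mul, ← ENNReal.ofReal_mul (le_of_lt hp.1), mul_inv_cancel₀ (ne_of_gt hp.1)]
            · simp
            · rw [mem_ball_zero_iff, Complex.norm_polarCoord_symm, abs_of_pos hp.1] at h
              exact ⟨⟨hp.1, h⟩, hp.2⟩
          · rw [indicator_of_notMem h, smul_zero]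
            exact zero_le
      _ ≤ ∫⁻ p, (Ioo (0 : ℝ) 2 ×ˢ Ioo (-Real.pi) Real.pi).indicator 1 p :=
          setLIntegral_le_lintegral _ _
      _ = ENNReal.ofReal (4 * Real.pi) := by
          rw [lintegral_indicator_one (measurableSet_Ioo.prod measurableSet_Ioo),
            Measure.volume_eq_prod, Measure.prod_prod, Real.volume_Ioo, Real.volume_Ioo,
            ← ENNReal.ofReal_mul (by norm_num)]
          congr 1
          ring
  calc _ ≤ ∫⁻ _ in disk, ENNReal.ofReal (4 * Real.pi) := by
        refine setLIntegral_mono' measurableSet_disk fun z hz => ?_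
        refine le_trans ?_ hball
        rw [← lintegral_indicator measurableSet_disk, ← lintegral_indicator measurableSet_ball,
          ← lintegral_sub_left_eq_self _ z]
        refine lintegral_mono fun w => ?_
        by_cases hw : z - w ∈ disk
        · rw [indicator_of_mem hw, indicator_of_mem, sub_sub_cancel]
          rw [mem_ball_zero_iff]
          have h1 := norm_sub_le z (z - w)
          rw [sub_sub_cancel] at h1
          linarith [mem_disk.1 hz, mem_disk.1 hw]
        · rw [indicator_of_notMem hw]
          exact zero_le
    _ < ⊤ := by
        rw [setLIntegral_const]
        exact ENNReal.mul_lt_top ENNReal.ofReal_lt_top measure_ball_lt_top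

/-- On the diagonal `|φ_z(w)|² = 0`, outside the interval `(0, 1)` where `ϱ_t` is estimated and
equal to a multiple of `sig`; the diagonal is null because its slices are points. -/
theorem ae_ne_prod : ∀ᵐ p ∂(volume.restrict (disk ×ˢ disk)), p.1 ∈ disk ∧ p.2 ∈ disk ∧ p.1 ≠ p.2 := by
  have h : volume {p : ℂ × ℂ | p.1 = p.2} = 0 := by
    rw [Measure.volume_eq_prod, Measure.measure_prod_null (measurableSet_eq_fun (by fun_prop) (by fun_prop))]
    refine Eventually.of_forall fun z => ?_
    have : Prod.mk z ⁻¹' {p : ℂ × ℂ | p.1 = p.2} = {z} := by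
      ext w
      simp [eq_comm]
    change volume (Prod.mk z ⁻¹' {p : ℂ × ℂ | p.1 = p.2}) = 0
    rw [this]
    simp
  have h2 : ∀ᵐ p ∂(volume.restrict (disk ×ˢ disk)), ¬ p.1 = p.2 := by
    refine ae_restrict_of_ae ?_
    rw [ae_iff]
    simpa using h
  filter_upwards [ae_restrict_mem (measurableSet_disk.prod measurableSet_disk), h2] with p hp hp2
  exact ⟨hp.1, hp.2, hp2⟩

theorem measurable_mobius : Measurable fun p : ℂ × ℂ => mobius p.1 p.2 := by
  unfold mobius
  fun_prop

/-- `log |φ|⁻² = 2 log |φ|⁻¹ ≤ 2 |φ|⁻¹ ≤ 4 |z - w|⁻¹`, the last step because `|1 - w z̄| ≤ 2`; the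
constant `4` is absorbed by `16π²`. -/
theorem rho_mobius_le {t : ℝ} (ht : -1 < t) {z w : ℂ} (hz : z ∈ disk) (hw : w ∈ disk) (hne : z ≠ w) :
    |rho t (‖mobius z w‖ ^ 2)| ≤ ‖z - w‖⁻¹ * (1 - ‖mobius z w‖ ^ 2) ^ (t + 1) := by
  have hs := norm_mobius_sq_mem hz hw hne
  have hm : 0 < ‖mobius z w‖ := by
    by_contra h
    have h0 : ‖mobius z w‖ = 0 := le_antisymm (not_lt.1 h) (norm_nonneg _)
    rw [h0] at hs
    norm_num at hs
  have h0 := norm_one_sub_pos hz hw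
  have hzw : 0 < ‖z - w‖ := norm_pos_iff.2 (sub_ne_zero.2 hne)
  rw [abs_of_nonneg (rho_nonneg ht hs)]
  refine (rho_le ht hs).trans ?_
  have h1 : Real.log (1 / ‖mobius z w‖ ^ 2) ≤ 4 * ‖z - w‖⁻¹ := by
    have e : (1 / ‖mobius z w‖ ^ 2) = (‖mobius z w‖⁻¹) ^ 2 := by rw [inv_pow, one_div]
    rw [e, Real.log_pow]
    have h2 := Real.log_le_sub_one_of_pos (inv_pos.2 hm)
    have h3 : ‖mobius z w‖⁻¹ ≤ 2 * ‖z - w‖⁻¹ := by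
      rw [mobius, norm_div, inv_div, div_eq_mul_inv]
      gcongr
      refine (norm_sub_le _ _).trans ?_
      rw [norm_mul, RCLike.norm_conj, norm_one]
      nlinarith [mem_disk.1 hz, mem_disk.1 hw, norm_nonneg z, norm_nonneg w]
    push_cast
    linarith
  have h4 : 0 ≤ (1 - ‖mobius z w‖ ^ 2) ^ (t + 1) := Real.rpow_nonneg (by linarith [hs.2]) _
  have h5 : 4 ≤ 16 * Real.pi ^ 2 := by nlinarith [Real.pi_gt_three]
  rw [div_le_iff₀ (by positivity)]
  calc _ ≤ 4 * ‖z - w‖⁻¹ * (1 - ‖mobius z w‖ ^ 2) ^ (t + 1) := by gcongr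
    _ ≤ _ := by
      have : 0 ≤ ‖z - w‖⁻¹ * (1 - ‖mobius z w‖ ^ 2) ^ (t + 1) := by positivity
      nlinarith

/-- In `ϱ_t(s)` the parameter occurs both in the integrand and in a limit of integration.
Measurability is taken from `sig`, a Lebesgue integral with measurable dependence on `s`, which
agrees with `ϱ_t` up to a factor off the diagonal. -/
theorem aestronglyMeasurable_pairIntegrand {g : ℂ → ℂ} (hg : ContDiffOn ℝ 2 g disk) (t : ℝ) :
    AEStronglyMeasurable (pairIntegrand t g) (volume.restrict (disk ×ˢ disk)) := by
  have hL := continuousOn_laplacian isOpen_disk hg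
  have hm : MeasurableSet (disk ×ˢ disk) := measurableSet_disk.prod measurableSet_disk
  have h1 : AEStronglyMeasurable (fun p : ℂ × ℂ => ((rho t (‖mobius p.1 p.2‖ ^ 2) : ℝ) : ℂ))
      (volume.restrict (disk ×ˢ disk)) := by
    have h2 : Measurable fun p : ℂ × ℂ =>
        (((t + 1) / Real.pi * (sig t (‖mobius p.1 p.2‖ ^ 2)).toReal : ℝ) : ℂ) := by
      have h3 := measurable_mobius
      have h4 := ((measurable_sig t).comp (h3.norm.pow_const 2)).ennreal_toReal
      exact Complex.measurable_ofReal.comp (h4.const_mul _)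
    refine h2.aestronglyMeasurable.congr ?_
    filter_upwards [ae_ne_prod] with p hp
    rw [sig_toReal (norm_mobius_sq_mem hp.1 hp.2.1 hp.2.2)]
  have h5 : ContinuousOn (fun p : ℂ × ℂ => Δ g p.1) (disk ×ˢ disk) :=
    hL.comp (by fun_prop) fun p hp => hp.1
  have h6 : ContinuousOn (fun p : ℂ × ℂ => Δ g p.2) (disk ×ˢ disk) :=
    hL.comp (by fun_prop) fun p hp => hp.2
  have h7 : ContinuousOn (fun p : ℂ × ℂ => conj (Δ g p.1)) (disk ×ˢ disk) :=
    Complex.continuous_conj.comp_continuousOn h5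
  refine ((h1.mul (h7.aestronglyMeasurable hm)).mul (h6.aestronglyMeasurable hm)).congr ?_
  refine Eventually.of_forall fun p => ?_
  simp only [pairIntegrand, Pi.mul_apply]
  rw [laplacian_conj]

theorem norm_pairIntegrand_le {g : ℂ → ℂ} {C : ℝ} (hC0 : 0 ≤ C) (hC : ∀ z ∈ disk, ‖Δ g z‖ ≤ C) {t : ℝ}
    (ht : -1 < t) {p : ℂ × ℂ} (hp : p.1 ∈ disk ∧ p.2 ∈ disk ∧ p.1 ≠ p.2) :
    ‖pairIntegrand t g p‖ ≤ ‖p.1 - p.2‖⁻¹ * (1 - ‖mobius p.1 p.2‖ ^ 2) ^ (t + 1) * C ^ 2 := by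
  have h1 := rho_mobius_le ht hp.1 hp.2.1 hp.2.2
  have h2 := hC _ hp.1
  have h3 := hC _ hp.2.1
  rw [pairIntegrand, laplacian_conj, norm_mul, norm_mul, Complex.norm_real, RCLike.norm_conj,
    Real.norm_eq_abs, mul_assoc, sq C]
  have h4 : ‖Δ g p.1‖ * ‖Δ g p.2‖ ≤ C * C := mul_le_mul h2 h3 (norm_nonneg _) hC0
  exact mul_le_mul h1 h4 (by positivity) ((abs_nonneg _).trans h1)

theorem norm_pairIntegrand_le' {g : ℂ → ℂ} {C : ℝ} (hC0 : 0 ≤ C) (hC : ∀ z ∈ disk, ‖Δ g z‖ ≤ C) {t : ℝ}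
    (ht : -1 < t) : ∀ᵐ p ∂(volume.restrict (disk ×ˢ disk)),
      ‖pairIntegrand t g p‖ ≤ ‖p.1 - p.2‖⁻¹ * C ^ 2 := by
  filter_upwards [ae_ne_prod] with p hp
  refine (norm_pairIntegrand_le hC0 hC ht hp).trans ?_
  have h1 := norm_mobius_sq_mem hp.1 hp.2.1 hp.2.2
  have h2 : (1 - ‖mobius p.1 p.2‖ ^ 2) ^ (t + 1) ≤ 1 :=
    Real.rpow_le_one (by linarith [h1.2]) (by linarith [h1.1]) (by linarith)
  have h3 : 0 ≤ ‖p.1 - p.2‖⁻¹ := by positivity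
  gcongr
  nlinarith

theorem integrableOn_pairIntegrand {g : ℂ → ℂ} (hg : ContDiffOn ℝ 2 g (closedBall 0 1)) {t : ℝ}
    (ht : -1 < t) : IntegrableOn (pairIntegrand t g) (disk ×ˢ disk) := by
  obtain ⟨C, hC0, hC⟩ := exists_bound hg
  exact (integrableOn_inv_norm_sub.mul_const (C ^ 2)).mono'
    (aestronglyMeasurable_pairIntegrand (hg.mono ball_subset_closedBall) t)
    (norm_pairIntegrand_le' hC0 (fun z hz => (hC z hz).2.2.2) ht)

/-- Dominated convergence: off the diagonal `(1 - |φ_z(w)|²)^(t+1)` is a power with base in `(0,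
1)`. -/
theorem tendsto_integral_pairIntegrand {g : ℂ → ℂ} (hg : ContDiffOn ℝ 2 g (closedBall 0 1)) :
    Tendsto (fun t => ∫ p in disk ×ˢ disk, pairIntegrand t g p) atTop (𝓝 0) := by
  obtain ⟨C, hC0, hC⟩ := exists_bound hg
  have hC' : ∀ z ∈ disk, ‖Δ g z‖ ≤ C := fun z hz => (hC z hz).2.2.2
  rw [← integral_zero (ℂ × ℂ) ℂ (μ := volume.restrict (disk ×ˢ disk))]
  refine tendsto_integral_filter_of_dominated_convergence (fun p => ‖p.1 - p.2‖⁻¹ * C ^ 2) ?_ ?_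
    (integrableOn_inv_norm_sub.mul_const _) ?_
  · exact Eventually.of_forall fun t =>
      aestronglyMeasurable_pairIntegrand (hg.mono ball_subset_closedBall) t
  · filter_upwards [eventually_gt_atTop (-1)] with t ht using norm_pairIntegrand_le' hC0 hC' ht
  · filter_upwards [ae_ne_prod] with p hp
    have h1 := norm_mobius_sq_mem hp.1 hp.2.1 hp.2.2
    rw [tendsto_zero_iff_norm_tendsto_zero]
    have h2 : Tendsto (fun t : ℝ => (1 - ‖mobius p.1 p.2‖ ^ 2) ^ (t + 1)) atTop (𝓝 0) :=
      (tendsto_rpow_atTop_of_base_lt_one _ (by linarith [h1.2]) (by linarith [h1.1])).comp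
        (tendsto_atTop_add_const_right _ _ tendsto_id)
    have h3 := (h2.const_mul (‖p.1 - p.2‖⁻¹)).mul_const (C ^ 2)
    rw [mul_zero, zero_mul] at h3
    refine squeeze_zero' (Eventually.of_forall fun t => norm_nonneg _) ?_ h3
    filter_upwards [eventually_gt_atTop (-1)] with t ht using norm_pairIntegrand_le hC0 hC' ht hp

/-- The kernel is real and symmetric, so conjugation amounts to exchanging `z` and `w`. The double
integral is therefore real. -/
theorem conj_integral_pairIntegrand (g : ℂ → ℂ) (t : ℝ) :
    conj (∫ p in disk ×ˢ disk, pairIntegrand t g p) = ∫ p in disk ×ˢ disk, pairIntegrand t g p := by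
  rw [← integral_conj]
  have h := integral_prod_swap (μ := volume.restrict disk) (ν := volume.restrict disk)
    (fun p : ℂ × ℂ => pairIntegrand t g p)
  rw [Measure.volume_eq_prod, ← Measure.prod_restrict, ← h]
  congr 1 with p
  simp only [pairIntegrand, Prod.swap, laplacian_conj, map_mul, Complex.conj_ofReal,
    Complex.conj_conj]
  rw [norm_mobius_comm]
  ring

/-! ### The commutator integral -/

theorem differentiableOn_mobius {z : ℂ} (hz : z ∈ disk) : DifferentiableOn ℂ (mobius z) disk :=
  fun _ hu => (hasDerivAt_mobius hz hu).differentiableAt.differentiableWithinAt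

theorem contDiffOn_mobius {z : ℂ} (hz : z ∈ disk) : ContDiffOn ℝ 2 (mobius z) disk := fun u hu =>
  (((differentiableOn_mobius hz).analyticOnNhd isOpen_disk u hu).contDiffAt
    (n := 2)).restrict_scalars ℝ |>.contDiffWithinAt

/-- The requirement `1 ≤ M` lets the single constant `M * C` bound both `f ∘ φ_z` and its Laplacian
in `radial_formula_mobius`. -/
theorem exists_mobiusJac_le {z : ℂ} (hz : z ∈ disk) : ∃ M : ℝ, 1 ≤ M ∧ ∀ u ∈ disk, mobiusJac z u ≤ M := by
  have h1 := mem_disk.1 hz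
  have h0 : 0 < 1 - ‖z‖ := by linarith
  refine ⟨((1 / (1 - ‖z‖) ^ 2) ^ 2), ?_, fun u hu => ?_⟩
  · refine one_le_pow₀ ?_
    rw [one_le_div (by positivity)]
    nlinarith [norm_nonneg z]
  · have h2 : 1 - ‖z‖ ≤ ‖1 - u * conj z‖ := by
      have h3 := norm_sub_norm_le (1 : ℂ) (u * conj z)
      rw [norm_one, norm_mul, RCLike.norm_conj] at h3
      nlinarith [mem_disk.1 hu, norm_nonneg z]
    have h4 := one_sub_norm_sq_pos hz
    rw [mobiusJac]
    gcongr
    nlinarith [norm_nonneg z]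

/-- The radial formula centered at `z`. -/
theorem radial_formula_mobius {f : ℂ → ℂ} (hf : ContDiffOn ℝ 2 f disk) {C : ℝ}
    (hb : ∀ z ∈ disk, ‖f z‖ ≤ C) (hΔ : ∀ z ∈ disk, ‖Δ f z‖ ≤ C) {ω : ℝ → ℝ} (hω : Measurable ω)
    (hω0 : ∀ y < 1, 0 ≤ ω y) {m : ℝ} (hm : 0 ≤ m)
    (hfin : ∫⁻ y in Ioo 0 1, ENNReal.ofReal (ω y) = ENNReal.ofReal m) {τ : ℝ → ℝ≥0∞}
    (hτm : Measurable τ) (hτ : ∀ s ∈ Ioo (0 : ℝ) 1,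
      ∫⁻ y in Ioo s 1, ENNReal.ofReal (Real.log (y / s) / 4) * ENNReal.ofReal (ω y) = τ s)
    {z : ℂ} (hz : z ∈ disk) :
    ∫ u in disk, f (mobius z u) * ω (‖u‖ ^ 2) =
        Real.pi * m * f z + ∫ w in disk, Δ f w * (τ (‖mobius z w‖ ^ 2)).toReal := by
  obtain ⟨M, hM1, hM⟩ := exists_mobiusJac_le hz
  have hC : 0 ≤ C := (norm_nonneg _).trans (hb 0 zero_mem_disk)
  have hlap : ∀ u ∈ disk, Δ (fun x => f (mobius z x)) u = mobiusJac z u * Δ f (mobius z u) := by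
    intro u hu
    rw [laplacian_comp_holomorphic isOpen_disk hu (differentiableOn_mobius hz)
      (hf.contDiffAt (isOpen_disk.mem_nhds (mobius_mem hz hu))), (hasDerivAt_mobius hz hu).deriv,
      norm_deriv_mobius_sq hz]
  have h := radial_formula (h := fun x => f (mobius z x)) (C := M * C)
    (hf.comp (contDiffOn_mobius hz) fun u hu => mobius_mem hz hu)
    (fun u hu => (hb _ (mobius_mem hz hu)).trans (by nlinarith)) (fun u hu => ?_) hω hω0 hm hfin hτm hτ
  · rw [h.2, mobius_zero,
      integral_comp_mobius hz fun w => Δ f w * ((τ (‖mobius z w‖ ^ 2)).toReal : ℂ)]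
    congr 1
    refine setIntegral_congr_fun measurableSet_disk fun u hu => ?_
    rw [hlap u hu, mobius_mobius hz hu, Complex.real_smul, mul_assoc]
  · rw [hlap u hu, norm_mul, Complex.norm_real, Real.norm_eq_abs, abs_of_nonneg (mobiusJac_nonneg _ _)]
    exact mul_le_mul (hM u hu) (hΔ _ (mobius_mem hz hu)) (norm_nonneg _) (by linarith)

theorem kap_ne_top (t : ℝ) (ht : -1 < t) {s : ℝ} (hs : 0 < s) : kap t s ≠ ⊤ := by
  have hpi := Real.pi_pos
  refine ne_of_lt (lt_of_le_of_lt (b := ∫⁻ _ in Ioo s 1, ENNReal.ofReal (1 / (4 * Real.pi * s))) ?_ ?_)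
  · refine setLIntegral_mono' measurableSet_Ioo fun u hu => ENNReal.ofReal_le_ofReal ?_
    have h1 : (1 - u) ^ (t + 1) ≤ 1 :=
      Real.rpow_le_one (by linarith [hu.2]) (by linarith [hs.trans hu.1]) (by linarith)
    have := hu.1
    gcongr
  · rw [setLIntegral_const, Real.volume_Ioo]
    exact ENNReal.mul_lt_top ENNReal.ofReal_lt_top ENNReal.ofReal_lt_top

/-- The Laplacian of `‖g - g z‖²` at `w`. -/
def lapSq (g : ℂ → ℂ) (z w : ℂ) : ℝ :=
  4 * (‖del g w‖ ^ 2 + ‖dbar g w‖ ^ 2) + 2 * (conj (g w - g z) * Δ g w).re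

theorem enorm_sq_eq_ofReal (z : ℂ) : ‖z‖ₑ ^ 2 = ENNReal.ofReal (‖z‖ ^ 2) := by
  rw [← ofReal_norm, ENNReal.ofReal_pow (norm_nonneg _)]

theorem norm_del_le (g : ℂ → ℂ) (z : ℂ) : ‖del g z‖ ≤ ‖fderiv ℝ g z‖ := by
  have h1 := (fderiv ℝ g z).le_opNorm 1
  have h2 := (fderiv ℝ g z).le_opNorm Complex.I
  have h3 := norm_sub_le (fderiv ℝ g z 1) (Complex.I * fderiv ℝ g z Complex.I)
  simp only [norm_one, Complex.norm_I, mul_one, norm_mul, one_mul] at h1 h2 h3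
  rw [del, norm_mul]
  norm_num
  linarith

theorem norm_dbar_le (g : ℂ → ℂ) (z : ℂ) : ‖dbar g z‖ ≤ ‖fderiv ℝ g z‖ := by
  have h1 := (fderiv ℝ g z).le_opNorm 1
  have h2 := (fderiv ℝ g z).le_opNorm Complex.I
  have h3 := norm_add_le (fderiv ℝ g z 1) (Complex.I * fderiv ℝ g z Complex.I)
  simp only [norm_one, Complex.norm_I, mul_one, norm_mul, one_mul] at h1 h2 h3
  rw [dbar, norm_mul]
  norm_num
  linarith

/-! ### Continuity, bounds and integrability of the terms made from derivatives of `g`. -/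

theorem continuousOn_del {g : ℂ → ℂ} (hg : ContDiffOn ℝ 2 g disk) : ContinuousOn (del g) disk := by
  have h1 : ContinuousOn (fderiv ℝ g) disk := hg.continuousOn_fderiv_of_isOpen isOpen_disk (by norm_num)
  unfold del
  fun_prop

theorem continuousOn_dbar {g : ℂ → ℂ} (hg : ContDiffOn ℝ 2 g disk) : ContinuousOn (dbar g) disk := by
  have h1 : ContinuousOn (fderiv ℝ g) disk := hg.continuousOn_fderiv_of_isOpen isOpen_disk (by norm_num)
  unfold dbar
  fun_prop

theorem integrableOn_disk_of_bounded {E : Type*} [NormedAddCommGroup E] {f : ℂ → E}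
    (hf : ContinuousOn f disk) {C : ℝ} (hC : ∀ z ∈ disk, ‖f z‖ ≤ C) : IntegrableOn f disk :=
  IntegrableOn.of_bound measure_ball_lt_top (hf.aestronglyMeasurable measurableSet_disk) C
    ((ae_restrict_mem measurableSet_disk).mono hC)

theorem integrableOn_norm_del_sq {g : ℂ → ℂ} (hg : ContDiffOn ℝ 2 g (closedBall 0 1)) :
    IntegrableOn (fun z => ‖del g z‖ ^ 2) disk := by
  obtain ⟨C, hC0, hC⟩ := exists_bound hg
  refine integrableOn_disk_of_bounded (C := C ^ 2)
    ((continuousOn_del (hg.mono ball_subset_closedBall)).norm.pow 2) fun z hz => ?_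
  rw [norm_pow, norm_norm]
  gcongr
  exact (norm_del_le g z).trans (hC z hz).2.1

theorem integrableOn_norm_dbar_sq {g : ℂ → ℂ} (hg : ContDiffOn ℝ 2 g (closedBall 0 1)) :
    IntegrableOn (fun z => ‖dbar g z‖ ^ 2) disk := by
  obtain ⟨C, hC0, hC⟩ := exists_bound hg
  refine integrableOn_disk_of_bounded (C := C ^ 2)
    ((continuousOn_dbar (hg.mono ball_subset_closedBall)).norm.pow 2) fun z hz => ?_
  rw [norm_pow, norm_norm]
  gcongr
  exact (norm_dbar_le g z).trans (hC z hz).2.1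

theorem exists_lapSq_bound {g : ℂ → ℂ} (hg : ContDiffOn ℝ 2 g (closedBall 0 1)) :
    ∃ M : ℝ, 0 ≤ M ∧ ∀ z ∈ disk, ∀ w ∈ disk, |lapSq g z w| ≤ M ∧ ‖g w - g z‖ ^ 2 ≤ M := by
  obtain ⟨C, hC0, hC⟩ := exists_bound hg
  refine ⟨12 * C ^ 2, by positivity, fun z hz w hw => ?_⟩
  have h1 := (norm_del_le g w).trans (hC w hw).2.1
  have h2 := (norm_dbar_le g w).trans (hC w hw).2.1
  have h1' : ‖del g w‖ ^ 2 ≤ C ^ 2 := by gcongr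
  have h2' : ‖dbar g w‖ ^ 2 ≤ C ^ 2 := by gcongr
  have h3 : ‖g w - g z‖ ≤ 2 * C := (norm_sub_le _ _).trans (by linarith [(hC w hw).1, (hC z hz).1])
  have h4 : |(conj (g w - g z) * Δ g w).re| ≤ 2 * C * C := by
    refine (Complex.abs_re_le_norm _).trans ?_
    rw [norm_mul, RCLike.norm_conj]
    exact mul_le_mul h3 (hC w hw).2.2.2 (norm_nonneg _) (by positivity)
  constructor
  · rw [lapSq, abs_le]
    have := abs_le.1 h4
    have p1 := sq_nonneg ‖del g w‖
    have p2 := sq_nonneg ‖dbar g w‖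
    constructor <;> nlinarith
  · have : ‖g w - g z‖ ^ 2 ≤ (2 * C) ^ 2 := by gcongr
    nlinarith

/-- The mean square oscillation of `g` at `z`. -/
theorem lintegral_oscillation {g : ℂ → ℂ} (hg : ContDiffOn ℝ 2 g (closedBall 0 1)) {t : ℝ}
    (ht : -1 < t) {z : ℂ} (hz : z ∈ disk) :
    0 ≤ ∫ w in disk, lapSq g z w * (kap t (‖mobius z w‖ ^ 2)).toReal ∧
    ∫⁻ u, ‖g z - g (mobius z u)‖ₑ ^ 2 ∂(lam t) =
      ENNReal.ofReal (∫ w in disk, lapSq g z w * (kap t (‖mobius z w‖ ^ 2)).toReal) := by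
  have hgd := hg.mono (ball_subset_closedBall (x := (0 : ℂ)) (ε := 1))
  obtain ⟨M, hM0, hM⟩ := exists_lapSq_bound hg
  have ht' : 0 < t + 1 := by linarith
  have hpi := Real.pi_pos
  have hsub : ContDiffOn ℝ 2 (fun y => g y - g z) disk := hgd.sub contDiffOn_const
  have hf : ContDiffOn ℝ 2 (fun y => conj (g y - g z) * (g y - g z)) disk :=
    (contDiffOn_conj hsub).mul hsub
  have hsq : ∀ y, conj (g y - g z) * (g y - g z) = ((‖g y - g z‖ ^ 2 : ℝ) : ℂ) := fun y => by
    rw [← Complex.normSq_eq_conj_mul_self, Complex.normSq_eq_norm_sq]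
  have hlap : ∀ w ∈ disk, Δ (fun y => conj (g y - g z) * (g y - g z)) w = (lapSq g z w : ℂ) :=
    fun w hw => laplacian_normSq_sub (contDiffAt_of_mem_disk hg hw) (g z)
  -- The function `|g - g(z)|²` vanishes at `z`, so the term with the central value drops out. The
  -- mass `1/π` is that of the radial density of the probability measure `λ_t`.
  have h := radial_formula_mobius hf (C := M) (fun w hw => ?_) (fun w hw => ?_)
    (ω := fun y => (t + 1) / Real.pi * (1 - y) ^ t) (by fun_prop) (fun y hy => ?_) (m := 1 / Real.pi)
    (by positivity) (lintegral_radial_density ht) (measurable_kap t) (fun s hs => ?_) hz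
  · have hreal : ∫ u in disk, ‖g (mobius z u) - g z‖ ^ 2 * weight t u =
        ∫ w in disk, lapSq g z w * (kap t (‖mobius z w‖ ^ 2)).toReal := by
      simp only [hsq] at h
      rw [sub_self, norm_zero] at h
      apply Complex.ofReal_injective
      rw [← integral_complex_ofReal, ← integral_complex_ofReal]
      have e1 : ∫ u in disk, ((‖g (mobius z u) - g z‖ ^ 2 * weight t u : ℝ) : ℂ) =
          ∫ u in disk, ((‖g (mobius z u) - g z‖ ^ 2 : ℝ) : ℂ) *
            (((t + 1) / Real.pi * (1 - ‖u‖ ^ 2) ^ t : ℝ) : ℂ) := by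
        refine setIntegral_congr_fun measurableSet_disk fun u _ => ?_
        simp only [weight]
        push_cast
        ring
      rw [e1, h]
      simp only [ne_eq, OfNat.ofNat_ne_zero, not_false_eq_true, zero_pow, Complex.ofReal_zero,
        mul_zero, zero_add]
      refine setIntegral_congr_fun measurableSet_disk fun w hw => ?_
      have := hlap w hw
      simp only [hsq] at this
      rw [this]
      push_cast
      ring
    have hnn : ∀ u ∈ disk, 0 ≤ ‖g (mobius z u) - g z‖ ^ 2 * weight t u := fun u hu =>
      mul_nonneg (sq_nonneg _) (weight_nonneg ht hu)
    rw [← hreal]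
    refine ⟨setIntegral_nonneg measurableSet_disk hnn, ?_⟩
    rw [lintegral_lam, ofReal_integral_eq_lintegral_ofReal]
    · refine setLIntegral_congr_fun measurableSet_disk fun u hu => ?_
      rw [enorm_sq_eq_ofReal, ← ENNReal.ofReal_mul (weight_nonneg ht hu), norm_sub_rev, mul_comm]
    · have hw : IntegrableOn (weight t) disk := by
        refine ⟨(measurable_weight t).aestronglyMeasurable, ?_⟩
        rw [hasFiniteIntegral_iff_ofReal]
        · have h1 := lam_univ ht
          rw [lam, withDensity_apply _ MeasurableSet.univ, Measure.restrict_univ] at h1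
          rw [h1]
          exact ENNReal.one_lt_top
        · filter_upwards [ae_restrict_mem measurableSet_disk] with u hu using weight_nonneg ht hu
      refine hw.bdd_mul (c := M) ?_ ?_
      · have : ContinuousOn (fun u => ‖g (mobius z u) - g z‖ ^ 2) disk :=
          ((hgd.continuousOn.comp (differentiableOn_mobius hz).continuousOn
            fun u hu => mobius_mem hz hu).sub continuousOn_const).norm.pow 2
        exact this.aestronglyMeasurable measurableSet_disk
      · filter_upwards [ae_restrict_mem measurableSet_disk] with u hu
        rw [norm_pow, norm_norm]
        exact (hM z hz _ (mobius_mem hz hu)).2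
    · filter_upwards [ae_restrict_mem measurableSet_disk] with u hu using hnn u hu
  · rw [hsq, Complex.norm_real, Real.norm_eq_abs, abs_of_nonneg (sq_nonneg _)]
    exact (hM z hz w hw).2
  · rw [hlap w hw, Complex.norm_real, Real.norm_eq_abs]
    exact (hM z hz w hw).1
  · have : 0 < 1 - y := by linarith
    positivity
  · rw [← kap_eq ht hs.1]
    refine setLIntegral_congr_fun measurableSet_Ioo fun y hy => ?_
    have := log_div_nonneg hs.1 hy.1.le
    rw [← ENNReal.ofReal_mul (by positivity)]
    congr 1
    ring

/-- Substitution `w = φ_z(u)`, under which `|k_z|² dλ_t` becomes a multiple of `λ_t`. -/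
theorem lintegral_kernel_sq (t : ℝ) (g : ℂ → ℂ) {z : ℂ} (hz : z ∈ disk) :
    ∫⁻ w, ‖g z - g w‖ₑ ^ 2 * ‖bk t z w‖ₑ ^ 2 ∂(lam t) =
      ENNReal.ofReal ((1 - ‖z‖ ^ 2) ^ (-(t + 2))) * ∫⁻ u, ‖g z - g (mobius z u)‖ₑ ^ 2 ∂(lam t) := by
  rw [lintegral_lam, lintegral_lam, ← lintegral_const_mul' _ _ ENNReal.ofReal_ne_top,
    lintegral_comp_mobius hz]
  refine setLIntegral_congr_fun measurableSet_disk fun u hu => ?_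
  have h := mobiusJac_mul_weight_mul_norm_bk_sq t hz hu
  have h0 := one_sub_norm_sq_pos hz
  rw [← mul_assoc (ENNReal.ofReal _) (ENNReal.ofReal (weight t u)), ← ENNReal.ofReal_mul (by positivity),
    ← h, ENNReal.ofReal_mul (mobiusJac_nonneg _ _), ENNReal.ofReal_mul' (by positivity),
    enorm_sq_eq_ofReal (bk t z (mobius z u))]
  ring

/-- The hyperbolically weighted Green kernel has constant mass. -/
theorem lintegral_kap_mobius {t : ℝ} (ht : -1 < t) {w : ℂ} (hw : w ∈ disk) :
    ∫⁻ z in disk, ENNReal.ofReal (((1 - ‖z‖ ^ 2) ^ 2)⁻¹) * kap t (‖mobius z w‖ ^ 2) =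
      ENNReal.ofReal (1 / (4 * (t + 1))) := by
  have hpi := Real.pi_pos
  have ht' : 0 < t + 1 := by linarith
  -- Substitute `z = φ_w(u)`: the hyperbolic measure is invariant, and `|φ_z(w)| = |φ_w(z)| = |u|`
  -- makes the integrand radial.
  rw [lintegral_comp_mobius hw]
  have h1 : ∫⁻ u in disk, ENNReal.ofReal (mobiusJac w u) *
      (ENNReal.ofReal (((1 - ‖mobius w u‖ ^ 2) ^ 2)⁻¹) * kap t (‖mobius (mobius w u) w‖ ^ 2)) =
      ∫⁻ u in disk, ENNReal.ofReal (((1 - ‖u‖ ^ 2) ^ 2)⁻¹) * kap t (‖u‖ ^ 2) := by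
    refine setLIntegral_congr_fun measurableSet_disk fun u hu => ?_
    rw [norm_mobius_comm (mobius w u) w, mobius_mobius hw hu, ← mul_assoc, ← ENNReal.ofReal_mul (mobiusJac_nonneg _ _),
      mobiusJac_mul hw hu]
  have hk := measurable_kap t
  rw [h1, lintegral_disk_radial (ω := fun y => ENNReal.ofReal (((1 - y) ^ 2)⁻¹) * kap t y) (by fun_prop),
    lintegral_kap ht, ← ENNReal.ofReal_mul hpi.le]
  congr 1
  field_simp

theorem integral_kap_mobius {t : ℝ} (ht : -1 < t) {w : ℂ} (hw : w ∈ disk) :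
    ∫ z in disk, ((1 - ‖z‖ ^ 2) ^ 2)⁻¹ * (kap t (‖mobius z w‖ ^ 2)).toReal = 1 / (4 * (t + 1)) := by
  have hk := measurable_kap t
  have hmob : Measurable fun z => mobius z w := by
    unfold mobius
    fun_prop
  have h := lintegral_kap_mobius ht hw
  have hm : Measurable fun z : ℂ => ENNReal.ofReal (((1 - ‖z‖ ^ 2) ^ 2)⁻¹) * kap t (‖mobius z w‖ ^ 2) := by
    fun_prop
  have h2 := integral_toReal hm.aemeasurable (ae_lt_top hm (by rw [h]; exact ENNReal.ofReal_ne_top))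
  rw [h, ENNReal.toReal_ofReal (by have : 0 < t + 1 := by linarith
                                   positivity)] at h2
  rw [← h2]
  refine setIntegral_congr_fun measurableSet_disk fun z hz => ?_
  rw [ENNReal.toReal_mul, ENNReal.toReal_ofReal (by positivity)]

/-- The double integral over the hyperbolic Green kernel of the oscillation. -/
theorem integrable_hyperbolic {t : ℝ} (ht : -1 < t) {F : ℂ → ℂ → ℝ}
    (hF : ContinuousOn (Function.uncurry F) (disk ×ˢ disk)) {M : ℝ}
    (hM : ∀ z ∈ disk, ∀ w ∈ disk, |F z w| ≤ M) :
    Integrable (fun p : ℂ × ℂ => ((1 - ‖p.1‖ ^ 2) ^ 2)⁻¹ * (kap t (‖mobius p.1 p.2‖ ^ 2)).toReal *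
      F p.1 p.2) ((volume.restrict disk).prod (volume.restrict disk)) := by
  have hk := measurable_kap t
  have hmob := measurable_mobius
  have hk2 : Measurable fun p : ℂ × ℂ => kap t (‖mobius p.1 p.2‖ ^ 2) :=
    hk.comp (hmob.norm.pow_const 2)
  have hm : Measurable fun p : ℂ × ℂ =>
      ENNReal.ofReal (((1 - ‖p.1‖ ^ 2) ^ 2)⁻¹) * kap t (‖mobius p.1 p.2‖ ^ 2) := by
    fun_prop
  have hm2 : Measurable fun p : ℂ × ℂ =>
      ((1 - ‖p.1‖ ^ 2) ^ 2)⁻¹ * (kap t (‖mobius p.1 p.2‖ ^ 2)).toReal := by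
    have := hk2.ennreal_toReal
    fun_prop
  have hbase : Integrable (fun p : ℂ × ℂ => ((1 - ‖p.1‖ ^ 2) ^ 2)⁻¹ *
      (kap t (‖mobius p.1 p.2‖ ^ 2)).toReal) ((volume.restrict disk).prod (volume.restrict disk)) := by
    refine ⟨hm2.aestronglyMeasurable, ?_⟩
    rw [hasFiniteIntegral_iff_ofReal (Eventually.of_forall fun p => by positivity)]
    calc _ ≤ ∫⁻ p, ENNReal.ofReal (((1 - ‖p.1‖ ^ 2) ^ 2)⁻¹) * kap t (‖mobius p.1 p.2‖ ^ 2)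
          ∂((volume.restrict disk).prod (volume.restrict disk)) := by
          refine lintegral_mono fun p => ?_
          rw [ENNReal.ofReal_mul (by positivity)]
          gcongr
          exact ENNReal.ofReal_toReal_le
      _ = ∫⁻ w in disk, ENNReal.ofReal (1 / (4 * (t + 1))) := by
          rw [lintegral_prod_symm _ hm.aemeasurable]
          exact setLIntegral_congr_fun measurableSet_disk fun w hw => lintegral_kap_mobius ht hw
      _ < ⊤ := by
          rw [setLIntegral_const]
          exact ENNReal.mul_lt_top ENNReal.ofReal_lt_top measure_ball_lt_top
  refine hbase.mul_bdd (c := M) ?_ ?_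
  · rw [Measure.prod_restrict]
    exact hF.aestronglyMeasurable (measurableSet_disk.prod measurableSet_disk)
  · rw [Measure.prod_restrict]
    filter_upwards [ae_restrict_mem (measurableSet_disk.prod measurableSet_disk)] with p hp
    exact hM _ hp.1 _ hp.2

theorem continuousOn_lapSq {g : ℂ → ℂ} (hg : ContDiffOn ℝ 2 g disk) :
    ContinuousOn (Function.uncurry (lapSq g)) (disk ×ˢ disk) := by
  have hm1 : MapsTo (fun p : ℂ × ℂ => p.1) (disk ×ˢ disk) disk := fun p hp => hp.1
  have hm2 : MapsTo (fun p : ℂ × ℂ => p.2) (disk ×ˢ disk) disk := fun p hp => hp.2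
  have c1 := (continuousOn_del hg).comp continuous_snd.continuousOn hm2
  have c2 := (continuousOn_dbar hg).comp continuous_snd.continuousOn hm2
  have c3 := (continuousOn_laplacian isOpen_disk hg).comp continuous_snd.continuousOn hm2
  have c4 := hg.continuousOn.comp continuous_snd.continuousOn hm2
  have c5 := hg.continuousOn.comp continuous_fst.continuousOn hm1
  exact (continuousOn_const.mul ((c1.norm.pow 2).add (c2.norm.pow 2))).add (continuousOn_const.mul
    (Complex.continuous_re.comp_continuousOn
      ((Complex.continuous_conj.comp_continuousOn (c4.sub c5)).mul c3)))

/-- Averaging the oscillation against the hyperbolic Green kernel produces the kernel `ϱ_t`. -/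
theorem integral_oscillation_kap {g : ℂ → ℂ} (hg : ContDiffOn ℝ 2 g (closedBall 0 1)) {t : ℝ}
    (ht : -1 < t) {w : ℂ} (hw : w ∈ disk) :
    ∫ z in disk, conj (g w - g z) *
      ((((1 - ‖z‖ ^ 2) ^ 2)⁻¹ * (kap t (‖mobius z w‖ ^ 2)).toReal : ℝ) : ℂ) =
      -(((Real.pi / (t + 1) : ℝ) : ℂ) * ∫ z in disk, (rho t (‖mobius z w‖ ^ 2) : ℂ) * Δ (fun z => conj (g z)) z) := by
  have hgd := hg.mono (ball_subset_closedBall (x := (0 : ℂ)) (ε := 1))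
  obtain ⟨C, hC0, hC⟩ := exists_bound hg
  have ht' : 0 < t + 1 := by linarith
  have hpi := Real.pi_pos
  have hk := measurable_kap t
  have hsub : ContDiffOn ℝ 2 (fun y => g w - g y) disk := contDiffOn_const.sub hgd
  have hf : ContDiffOn ℝ 2 (fun y => conj (g w - g y)) disk := contDiffOn_conj hsub
  have hlap : ∀ z ∈ disk, Δ (fun y => conj (g w - g y)) z = -conj (Δ g z) := by
    intro z hz
    have h1 := ContDiffAt.laplacian_sub (contDiffAt_const (c := g w)) (contDiffAt_of_mem_disk hg hz)
    rw [laplacian_conj, show (fun y => g w - g y) = (fun _ => g w) - g from rfl, h1,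
      InnerProductSpace.laplacian_const]
    simp
  have hωE : ∀ y ∈ Ioo (0 : ℝ) 1, ENNReal.ofReal (((1 - y) ^ 2)⁻¹ * (kap t y).toReal) =
      ENNReal.ofReal (((1 - y) ^ 2)⁻¹) * kap t y := fun y hy => by
    rw [ENNReal.ofReal_mul (by positivity), ENNReal.ofReal_toReal (kap_ne_top t ht hy.1)]
  -- Green's formula centered at `w` for `conj(g(w) - g)`, which vanishes there, with the density
  -- `kap t y / (1 - y)²` whose potential is `sig`. The minus sign in the conclusion comes from
  -- `Δ(g(w) - g) = -Δg`.
  have h := radial_formula_mobius hf (C := 2 * C) (fun z hz => ?_) (fun z hz => ?_)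
    (ω := fun y => ((1 - y) ^ 2)⁻¹ * (kap t y).toReal) (by fun_prop) (fun y _ => by positivity)
    (m := 1 / (4 * Real.pi * (t + 1))) (by positivity) ?_ (measurable_sig t) (fun s hs => ?_) hw
  · rw [integral_comp_mobius hw]
    have e1 : ∫ u in disk, mobiusJac w u • (conj (g w - g (mobius w u)) *
        ((((1 - ‖mobius w u‖ ^ 2) ^ 2)⁻¹ * (kap t (‖mobius (mobius w u) w‖ ^ 2)).toReal : ℝ) : ℂ)) =
        ∫ u in disk, conj (g w - g (mobius w u)) *
          ((((1 - ‖u‖ ^ 2) ^ 2)⁻¹ * (kap t (‖u‖ ^ 2)).toReal : ℝ) : ℂ) := by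
      refine setIntegral_congr_fun measurableSet_disk fun u hu => ?_
      rw [← mobiusJac_mul hw hu, norm_mobius_comm (mobius w u) w, mobius_mobius hw hu, Complex.real_smul]
      push_cast
      ring
    rw [e1, h, sub_self, map_zero, mul_zero, zero_add, ← integral_const_mul, ← integral_neg]
    refine integral_congr_ae ?_
    have hne : ∀ᵐ z ∂(volume.restrict disk), z ≠ w := by
      refine ae_restrict_of_ae ?_
      rw [ae_iff]
      simp
    filter_upwards [ae_restrict_mem measurableSet_disk, hne] with z hz hzw
    rw [hlap z hz, laplacian_conj, norm_mobius_comm, ← sig_toReal (norm_mobius_sq_mem hz hw hzw)]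
    have h1 : ((t : ℂ) + 1) ≠ 0 := by exact_mod_cast ht'.ne'
    have h2 : (Real.pi : ℂ) ≠ 0 := by exact_mod_cast hpi.ne'
    push_cast
    field_simp
  · rw [RCLike.norm_conj]
    exact (norm_sub_le _ _).trans (by linarith [(hC w hw).1, (hC z hz).1])
  · rw [hlap z hz, norm_neg, RCLike.norm_conj]
    linarith [(hC z hz).2.2.2]
  · rw [← lintegral_kap ht]
    exact setLIntegral_congr_fun measurableSet_Ioo hωE
  · unfold sig
    refine setLIntegral_congr_fun measurableSet_Ioo fun y hy => ?_
    have := log_div_nonneg hs.1 hy.1.le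
    rw [hωE y ⟨hs.1.trans hy.1, hy.2⟩, ← mul_assoc, ← ENNReal.ofReal_mul (by positivity)]
    congr 2
    ring

/-- The Hilbert-Schmidt norm of the commutator of `g` with the Bergman projection. -/
theorem lintegral_commutator {g : ℂ → ℂ} (hg : ContDiffOn ℝ 2 g (closedBall 0 1)) {t : ℝ}
    (ht : -1 < t) :
    ∃ I : ℝ, 0 ≤ I ∧
      ∫⁻ z, ∫⁻ w, ‖g z - g w‖ₑ ^ 2 * ‖bk t z w‖ₑ ^ 2 ∂(lam t) ∂(lam t) = ENNReal.ofReal I ∧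
      I = 1 / Real.pi * (∫ z in disk, ‖del g z‖ ^ 2) + 1 / Real.pi * (∫ z in disk, ‖dbar g z‖ ^ 2) -
        2 * (∫ p in disk ×ˢ disk, pairIntegrand t g p).re := by
  have hgd := hg.mono (ball_subset_closedBall (x := (0 : ℂ)) (ε := 1))
  obtain ⟨M, hM0, hM⟩ := exists_lapSq_bound hg
  have ht' : 0 < t + 1 := by linarith
  have hpi := Real.pi_pos
  set k : ℂ → ℂ → ℝ := fun z w => ((1 - ‖z‖ ^ 2) ^ 2)⁻¹ * (kap t (‖mobius z w‖ ^ 2)).toReal with hk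
  have hH := integrable_hyperbolic ht (continuousOn_lapSq hgd) (fun z hz w hw => (hM z hz w hw).1)
  have hin : ∀ z ∈ disk, ∫ w in disk, k z w * lapSq g z w =
      ((1 - ‖z‖ ^ 2) ^ 2)⁻¹ * ∫ w in disk, lapSq g z w * (kap t (‖mobius z w‖ ^ 2)).toReal := by
    intro z _
    rw [← integral_const_mul]
    refine integral_congr_ae (Eventually.of_forall fun w => ?_)
    simp only [hk]
    ring
  have hin0 : ∀ z ∈ disk, 0 ≤ ∫ w in disk, k z w * lapSq g z w := fun z hz => by
    rw [hin z hz]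
    have := (lintegral_oscillation hg ht hz).1
    positivity
  -- The weight of `λ_t` times the factor `(1 - |z|²)^(-(t+2))` of the kernel integral leaves `((t +
  -- 1)/π) (1 - |z|²)⁻²`.
  refine ⟨(t + 1) / Real.pi * ∫ z in disk, ∫ w in disk, k z w * lapSq g z w, ?_, ?_, ?_⟩
  · have := setIntegral_nonneg (μ := volume) measurableSet_disk hin0
    positivity
  · rw [lintegral_lam, ENNReal.ofReal_mul (by positivity), ofReal_integral_eq_lintegral_ofReal,
      ← lintegral_const_mul' _ _ ENNReal.ofReal_ne_top]
    · refine setLIntegral_congr_fun measurableSet_disk fun z hz => ?_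
      have h1 := one_sub_norm_sq_pos hz
      have h2 := lintegral_oscillation hg ht hz
      rw [lintegral_kernel_sq t g hz, h2.2, hin z hz, ← ENNReal.ofReal_mul (by positivity),
        ← ENNReal.ofReal_mul (weight_nonneg ht hz), ← ENNReal.ofReal_mul (by positivity), ← mul_assoc,
        ← mul_assoc]
      congr 2
      rw [weight, mul_assoc, ← Real.rpow_add h1, show t + -(t + 2) = -(2 : ℕ) by push_cast; ring,
        Real.rpow_neg h1.le, Real.rpow_natCast]
    · exact hH.integral_prod_left
    · filter_upwards [ae_restrict_mem measurableSet_disk] with z hz using hin0 z hz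
  · have hswap := integral_integral_swap (f := fun z w => k z w * lapSq g z w) hH
    rw [hswap]
    have hpair := integrableOn_pairIntegrand hg ht
    rw [IntegrableOn, Measure.volume_eq_prod, ← Measure.prod_restrict] at hpair
    have hpi2 := integral_prod_symm _ hpair
    -- The gradient part of `lapSq` is constant in `z` and meets the mass `1/(4(t + 1))`; the other
    -- part is turned into `ϱ_t` by `integral_oscillation_kap`.
    have hre : ∀ w ∈ disk, ∫ z in disk, k z w * lapSq g z w =
        1 / (t + 1) * (‖del g w‖ ^ 2 + ‖dbar g w‖ ^ 2) -
          2 * (Real.pi / (t + 1)) * (∫ z in disk, pairIntegrand t g (z, w)).re := by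
      intro w hw
      have hcont : ∀ (f : ℂ → ℂ), ContinuousOn f disk → ∀ c : ℝ, (∀ z ∈ disk, ‖f z‖ ≤ c) →
          IntegrableOn (fun z => f z * (k z w : ℂ)) disk := by
        intro f hf c hc
        have hkint : IntegrableOn (fun z => k z w) disk := by
          -- The integral of a non-integrable function is zero by convention, whereas this one is
          -- known to be `1/(4(t + 1))`.
          by_contra hcon
          have h1 := integral_undef hcon
          rw [integral_kap_mobius ht hw] at h1
          have : 0 < 1 / (4 * (t + 1)) := by positivity
          linarith
        exact (hkint.ofReal (𝕜 := ℂ)).bdd_mul (hf.aestronglyMeasurable measurableSet_disk)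
          ((ae_restrict_mem measurableSet_disk).mono hc)
      obtain ⟨C, hC0, hC⟩ := exists_bound hg
      have hosc := hcont (fun z => conj (g w - g z))
        (Complex.continuous_conj.comp_continuousOn (continuousOn_const.sub hgd.continuousOn)) (2 * C)
        (fun z hz => by
          rw [RCLike.norm_conj]
          exact (norm_sub_le _ _).trans (by linarith [(hC w hw).1, (hC z hz).1]))
      have hosc' : Integrable (fun z => Δ g w * (conj (g w - g z) * (k z w : ℂ)))
          (volume.restrict disk) := hosc.const_mul _
      have hconj : Integrable (fun z => conj (Δ g w * (conj (g w - g z) * (k z w : ℂ))))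
          (volume.restrict disk) := (Complex.conjCLE : ℂ →L[ℝ] ℂ).integrable_comp hosc'
      have hone := hcont (fun _ => 1) continuousOn_const 1 (fun z _ => by simp)
      have e1 : ∫ z in disk, ((k z w * lapSq g z w : ℝ) : ℂ) =
          (4 * (‖del g w‖ ^ 2 + ‖dbar g w‖ ^ 2) : ℝ) * (∫ z in disk, 1 * (k z w : ℂ)) +
          (Δ g w * (∫ z in disk, conj (g w - g z) * (k z w : ℂ)) +
            conj (Δ g w * (∫ z in disk, conj (g w - g z) * (k z w : ℂ)))) := by
        rw [← integral_const_mul, ← integral_const_mul, ← integral_conj, ← integral_add,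
          ← integral_add]
        · refine integral_congr_ae (Eventually.of_forall fun z => ?_)
          have h5 := Complex.add_conj (conj (g w - g z) * Δ g w)
          simp only [lapSq]
          push_cast at h5 ⊢
          simp only [map_mul, Complex.conj_ofReal] at h5 ⊢
          linear_combination (-(k z w : ℂ)) * h5
        · exact hone.const_mul _
        · exact hosc'.add hconj
        · exact hosc.const_mul _
        · exact hconj
      have e2 : ∫ z in disk, pairIntegrand t g (z, w) =
          (∫ z in disk, (rho t (‖mobius z w‖ ^ 2) : ℂ) * Δ (fun z => conj (g z)) z) * Δ g w := by
        rw [← integral_mul_const]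
        rfl
      have e3 : ∫ z in disk, 1 * (k z w : ℂ) = ((1 / (4 * (t + 1)) : ℝ) : ℂ) := by
        simp only [one_mul]
        rw [integral_complex_ofReal, integral_kap_mobius ht hw]
      rw [integral_complex_ofReal, e3, integral_oscillation_kap hg ht hw] at e1
      apply Complex.ofReal_injective
      rw [e1, Complex.add_conj, e2]
      rw [← Complex.ofReal_mul, ← Complex.ofReal_add]
      congr 1
      have e4 : ∀ X : ℂ, (Δ g w * -(((Real.pi / (t + 1) : ℝ) : ℂ) * X)).re =
          -((Real.pi / (t + 1)) * (X * Δ g w).re) := by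
        intro X
        rw [show Δ g w * -(((Real.pi / (t + 1) : ℝ) : ℂ) * X) =
          -(((Real.pi / (t + 1) : ℝ) : ℂ) * (X * Δ g w)) by ring, Complex.neg_re, Complex.re_ofReal_mul]
      rw [e4]
      field_simp
      ring
    have hprint : Integrable (fun w => ∫ z in disk, pairIntegrand t g (z, w)) (volume.restrict disk) :=
      hpair.integral_prod_right
    rw [setIntegral_congr_fun measurableSet_disk hre, integral_sub, integral_const_mul,
      integral_const_mul, integral_add (integrableOn_norm_del_sq hg) (integrableOn_norm_dbar_sq hg),
      Measure.volume_eq_prod, ← Measure.prod_restrict, hpi2]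
    · have : (∫ w in disk, (∫ z in disk, pairIntegrand t g (z, w)).re) =
          (∫ w in disk, ∫ z in disk, pairIntegrand t g (z, w)).re := integral_re hprint
      rw [this]
      field_simp
    · exact ((integrableOn_norm_del_sq hg).add (integrableOn_norm_dbar_sq hg)).const_mul _
    · exact hprint.re.const_mul _

/-! ### The reproducing property -/

theorem circle_mean_holomorphic {h : ℂ → ℂ} (hh : DifferentiableOn ℂ h disk) {r : ℝ}
    (hr : r ∈ Ioo (0 : ℝ) 1) :
    ∫ θ in (-Real.pi)..Real.pi, h (r * Complex.exp (θ * Complex.I)) = 2 * Real.pi * h 0 := by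
  have hsub : closedBall (0 : ℂ) |r| ⊆ disk := fun z hz => by
    rw [mem_closedBall_zero_iff, abs_of_pos hr.1] at hz
    exact mem_disk.2 (hz.trans_lt hr.2)
  have havg : Real.circleAverage h 0 r = h 0 :=
    ((hh.mono (closure_ball_subset_closedBall.trans hsub)).diffContOnCl).circleAverage
  have hper : Function.Periodic (fun θ => h (circleMap 0 r θ)) (2 * Real.pi) := fun θ => by
    simp only [periodic_circleMap 0 r θ]
  have h1 := hper.intervalIntegral_add_eq 0 (-Real.pi)
  rw [zero_add, show -Real.pi + 2 * Real.pi = Real.pi by ring] at h1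
  have h2 : ∀ θ : ℝ, h (r * Complex.exp (θ * Complex.I)) = h (circleMap 0 r θ) := fun θ => by
    simp [circleMap]
  simp_rw [h2]
  rw [← h1, ← havg, Real.circleAverage_def, Complex.real_smul]
  have := Real.pi_pos.ne'
  push_cast
  field_simp

/-- By the mean value property on each circle, the integral is `h 0` times a quantity independent of
`h`, which is then identified by the choice `h = 1`. -/
theorem integral_lam_mul_radial_aux {t : ℝ} (ht : -1 < t) {κ : ℝ → ℝ} (hκ : Measurable κ) {h : ℂ → ℂ}
    (hh : DifferentiableOn ℂ h disk) (hint : Integrable (fun z => h z * κ ‖z‖) (lam t)) :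
    ∫ z, h z * κ ‖z‖ ∂(lam t) = h 0 * ∫ r in Ioo (0 : ℝ) 1,
      ((r * ((t + 1) / Real.pi * (1 - r ^ 2) ^ t * κ r) : ℝ) : ℂ) * (2 * Real.pi) := by
  rw [integrable_lam ht] at hint
  have e : ∀ z, weight t z * (h z * κ ‖z‖) =
      h z * (((t + 1) / Real.pi * (1 - ‖z‖ ^ 2) ^ t * κ ‖z‖ : ℝ) : ℂ) := fun z => by
    rw [weight]
    push_cast
    ring
  rw [integral_lam ht]
  simp only [e] at hint ⊢
  rw [integral_disk_radial (k := fun r => (t + 1) / Real.pi * (1 - r ^ 2) ^ t * κ r) hh.continuousOn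
    (by fun_prop) hint, ← integral_const_mul]
  refine setIntegral_congr_fun measurableSet_Ioo fun r hr => ?_
  rw [circle_mean_holomorphic hh hr]
  ring

/-- The mean value property with respect to radial weights. -/
theorem integral_lam_mul_radial {t : ℝ} (ht : -1 < t) {κ : ℝ → ℝ} (hκ : Measurable κ)
    (hκi : Integrable (fun z => (κ ‖z‖ : ℂ)) (lam t)) {h : ℂ → ℂ} (hh : DifferentiableOn ℂ h disk)
    (hint : Integrable (fun z => h z * κ ‖z‖) (lam t)) :
    ∫ z, h z * κ ‖z‖ ∂(lam t) = h 0 * ∫ z, (κ ‖z‖ : ℂ) ∂(lam t) := by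
  have h1 := integral_lam_mul_radial_aux ht hκ (h := fun _ => 1) (differentiableOn_const 1)
    (by simpa using hκi)
  simp only [one_mul] at h1
  rw [integral_lam_mul_radial_aux ht hκ hh hint, h1]

/-- The mean value property. -/
theorem integral_lam_holomorphic {t : ℝ} (ht : -1 < t) {h : ℂ → ℂ} (hh : DifferentiableOn ℂ h disk)
    (hint : Integrable h (lam t)) : ∫ z, h z ∂(lam t) = h 0 := by
  have := isProbabilityMeasure_lam ht
  have h1 := integral_lam_mul_radial ht (κ := fun _ => 1) measurable_const (integrable_const _) hh
    (by simpa using hint)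
  simpa using h1

/-- Since `1 - φ_z(u) z̄ = (1 - |z|²)/(1 - u z̄)`, the kernel at `φ_z(u)` is a positive multiple of
`(1 - u z̄)^(t+2)`. Splitting the non-integer power is legitimate because `1 - |z|²` is positive and
`1 - u z̄` lies in the slit plane. Conjugation turns that power into `|1 - u z̄|^(2(t+2)) k_z(u)`.
-/
theorem conj_bk_mobius (t : ℝ) {z u : ℂ} (hz : z ∈ disk) (hu : u ∈ disk) :
    ((((1 - ‖z‖ ^ 2) / ‖1 - u * conj z‖ ^ 2) ^ (t + 2) : ℝ) : ℂ) * conj (bk t z (mobius z u)) =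
      bk t z u := by
  have ha := one_sub_norm_sq_pos hz
  have hd := norm_one_sub_pos hz hu
  have hq := one_sub_mul_conj_ne_zero hz hu
  have hslit := one_sub_mul_conj_mem_slitPlane hz (mem_disk.1 hu).le
  have hQ : ∀ p : ℝ, (1 - u * conj z) ^ (p : ℂ) ≠ 0 := fun p => by
    rw [Complex.cpow_def_of_ne_zero hq]
    exact Complex.exp_ne_zero _
  have h1 : bk t z (mobius z u) =
      (((1 - ‖z‖ ^ 2) ^ (-(t + 2)) : ℝ) : ℂ) * (1 - u * conj z) ^ ((t + 2 : ℝ) : ℂ) := by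
    have ha' : ((1 - ‖z‖ ^ 2 : ℝ) : ℂ) ≠ 0 := by exact_mod_cast ha.ne'
    rw [bk, one_sub_mobius_mul hz hu, div_eq_mul_inv, Complex.ofReal_cpow ha.le,
      Complex.cpow_def_of_ne_zero (mul_ne_zero ha' (inv_ne_zero hq)), Complex.log_ofReal_mul ha
      (inv_ne_zero hq), Complex.log_inv _ (Complex.slitPlane_arg_ne_pi hslit),
      Complex.cpow_def_of_ne_zero ha', Complex.cpow_def_of_ne_zero hq, ← Complex.exp_add,
      Complex.ofReal_log ha.le]
    congr 1
    push_cast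
    ring
  have h2 : conj ((1 - u * conj z) ^ ((t + 2 : ℝ) : ℂ)) =
      (((‖1 - u * conj z‖ ^ 2) ^ (t + 2) : ℝ) : ℂ) * bk t z u := by
    have h3 := Complex.normSq_eq_conj_mul_self (z := (1 - u * conj z) ^ ((t + 2 : ℝ) : ℂ))
    rw [Complex.normSq_eq_norm_sq, Complex.norm_cpow_real] at h3
    rw [bk, Complex.ofReal_neg, Complex.cpow_neg, ← div_eq_mul_inv, eq_div_iff (hQ _), ← h3, sq, sq,
      Real.mul_rpow hd.le hd.le]
  rw [h1, map_mul, Complex.conj_ofReal, h2, ← mul_assoc, ← mul_assoc, ← Complex.ofReal_mul,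
    ← Complex.ofReal_mul, Real.div_rpow ha.le (by positivity), Real.rpow_neg ha.le]
  have e1 : (1 - ‖z‖ ^ 2) ^ (t + 2) ≠ 0 := (Real.rpow_pos_of_pos ha _).ne'
  have e2 : (‖1 - u * conj z‖ ^ 2) ^ (t + 2) ≠ 0 := (Real.rpow_pos_of_pos (by positivity) _).ne'
  rw [show (1 - ‖z‖ ^ 2) ^ (t + 2) / (‖1 - u * conj z‖ ^ 2) ^ (t + 2) * ((1 - ‖z‖ ^ 2) ^ (t + 2))⁻¹ *
    (‖1 - u * conj z‖ ^ 2) ^ (t + 2) = 1 by field_simp]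
  simp

/-! ### The kernels `k_z` as elements of `L²(λ_t)`, and the projection in terms of them. -/

theorem exists_norm_bk_le {t : ℝ} (ht : -1 < t) {z : ℂ} (hz : z ∈ disk) :
    ∃ C : ℝ, ∀ w, ‖w‖ ≤ 1 → ‖bk t z w‖ ≤ C := by
  refine ⟨(1 - ‖z‖) ^ (-(t + 2)), fun w hw => ?_⟩
  have h1 := mem_disk.1 hz
  have h2 : 1 - ‖z‖ ≤ ‖1 - w * conj z‖ := by
    have h3 := norm_sub_norm_le (1 : ℂ) (w * conj z)
    rw [norm_one, norm_mul, RCLike.norm_conj] at h3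
    nlinarith [norm_nonneg z]
  rw [norm_bk]
  exact Real.rpow_le_rpow_of_nonpos (by linarith) h2 (by linarith)

theorem differentiableOn_bk (t : ℝ) {z : ℂ} (hz : z ∈ disk) : DifferentiableOn ℂ (bk t z) disk :=
  fun _ hw => (differentiableAt_bk t hz (mem_disk.1 hw).le).differentiableWithinAt

theorem aestronglyMeasurable_lam {f : ℂ → ℂ} (hf : ContinuousOn f disk) (t : ℝ) :
    AEStronglyMeasurable f (lam t) :=
  (hf.aestronglyMeasurable measurableSet_disk).mono_ac (lam_ac t)

theorem memLp_of_bounded {t : ℝ} (ht : -1 < t) {f : ℂ → ℂ} (hf : ContinuousOn f disk) {C : ℝ}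
    (hC : ∀ z ∈ disk, ‖f z‖ ≤ C) : MemLp f 2 (lam t) := by
  have := isProbabilityMeasure_lam ht
  exact MemLp.of_bound (aestronglyMeasurable_lam hf t) C ((ae_lam_mem t).mono hC)

theorem memLp_bk {t : ℝ} (ht : -1 < t) {z : ℂ} (hz : z ∈ disk) : MemLp (bk t z) 2 (lam t) := by
  obtain ⟨C, hC⟩ := exists_norm_bk_le ht hz
  exact memLp_of_bounded ht (differentiableOn_bk t hz).continuousOn
    fun w hw => hC w (mem_disk.1 hw).le

/-- The substitution `w = φ_z(u)` turns the integral into the mean of the holomorphic function `k_z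
· (f ∘ φ_z)`, whose value at the origin is `f z`. -/
theorem integral_bk_mul {t : ℝ} (ht : -1 < t) {f : ℂ → ℂ} (hf : DifferentiableOn ℂ f disk)
    (hf2 : MemLp f 2 (lam t)) {z : ℂ} (hz : z ∈ disk) :
    ∫ w, conj (bk t z w) * f w ∂(lam t) = f z := by
  have := isProbabilityMeasure_lam ht
  have hint : Integrable (fun w => conj (bk t z w) * f w) (lam t) :=
    MemLp.integrable_mul (p := 2) (q := 2) (memLp_bk ht hz).star hf2
  have key : ∀ u ∈ disk, mobiusJac z u • ((weight t (mobius z u) : ℂ) *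
      (conj (bk t z (mobius z u)) * f (mobius z u))) = weight t u * (bk t z u * f (mobius z u)) := by
    intro u hu
    rw [← conj_bk_mobius t hz hu, Complex.real_smul, ← mul_assoc, ← Complex.ofReal_mul,
      mobiusJac_mul_weight t hz hu]
    push_cast
    ring
  have hd : DifferentiableOn ℂ (fun u => bk t z u * f (mobius z u)) disk :=
    (differentiableOn_bk t hz).mul (hf.comp (differentiableOn_mobius hz) fun u hu => mobius_mem hz hu)
  have hint2 : Integrable (fun u => bk t z u * f (mobius z u)) (lam t) := by
    rw [integrable_lam ht] at hint ⊢
    rw [integrableOn_comp_mobius hz] at hint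
    exact hint.congr_fun key measurableSet_disk
  have h := integral_lam_holomorphic ht hd hint2
  rw [mobius_zero] at h
  rw [integral_lam ht, integral_comp_mobius hz, setIntegral_congr_fun measurableSet_disk key,
    ← integral_lam ht, h]
  simp [bk]

/-- The reproducing kernel as an element of `L²(λ_t)`. -/
def kz {t : ℝ} (ht : -1 < t) {z : ℂ} (hz : z ∈ disk) : L2 t := (memLp_bk ht hz).toLp

theorem kz_mem {t : ℝ} (ht : -1 < t) {z : ℂ} (hz : z ∈ disk) : kz ht hz ∈ bergman t :=
  ⟨bk t z, differentiableOn_bk t hz, MemLp.coeFn_toLp _⟩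

theorem inner_eq_integral {t : ℝ} (f f' : L2 t) : ⟪f, f'⟫_ℂ = ∫ w, conj (f w) * f' w ∂(lam t) := by
  rw [L2.inner_def]
  refine integral_congr_ae (Eventually.of_forall fun w => ?_)
  simp [mul_comm]

theorem inner_kz {t : ℝ} (ht : -1 < t) {z : ℂ} (hz : z ∈ disk) {f : L2 t} {h : ℂ → ℂ}
    (hh : DifferentiableOn ℂ h disk) (hf : f =ᵐ[lam t] h) : ⟪kz ht hz, f⟫_ℂ = h z := by
  rw [inner_eq_integral, ← integral_bk_mul ht hh ((Lp.memLp f).ae_eq hf) hz]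
  refine integral_congr_ae ?_
  filter_upwards [hf, (memLp_bk ht hz).coeFn_toLp] with w h1 h2
  rw [h1, kz, h2]

theorem bergmanProj_mem {t : ℝ} (f : L2 t) : bergmanProj t f ∈ bergman t :=
  Submodule.starProjection_apply_mem _ _

theorem inner_bergmanProj {t : ℝ} (f f' : L2 t) :
    ⟪bergmanProj t f, f'⟫_ℂ = ⟪f, bergmanProj t f'⟫_ℂ :=
  Submodule.inner_starProjection_left_eq_right _ _ _

theorem bergmanProj_of_mem {t : ℝ} {f : L2 t} (hf : f ∈ bergman t) : bergmanProj t f = f :=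
  Submodule.starProjection_eq_self_iff.2 hf

theorem bergmanProj_idem {t : ℝ} (f : L2 t) : bergmanProj t (bergmanProj t f) = bergmanProj t f :=
  bergmanProj_of_mem (bergmanProj_mem f)

/-- The Bergman projection is given by the reproducing kernel. -/
theorem bergmanProj_ae_eq {t : ℝ} (ht : -1 < t) (f : L2 t) :
    ∀ᵐ z ∂(lam t), ∀ hz : z ∈ disk, bergmanProj t f z = ⟪kz ht hz, f⟫_ℂ := by
  obtain ⟨h, hh, hf⟩ := bergmanProj_mem f
  filter_upwards [hf] with z h1 hz
  rw [h1, ← inner_kz ht hz hh hf, ← inner_bergmanProj, bergmanProj_of_mem (kz_mem ht hz)]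

/-! ### Hankel operators and commutators -/

theorem coeFn_mulOp {t : ℝ} {g : ℂ → ℂ} (hg : MemLp g ⊤ (lam t)) (f : L2 t) :
    mulOp t g hg f =ᵐ[lam t] fun z => g z * f z := by
  filter_upwards [(ContinuousLinearMap.mul ℂ ℂ).coeFn_holder (r := 2) hg.toLp f, hg.coeFn_toLp]
    with z h1 h2
  rw [mulOp, ← h2]
  exact h1

theorem inner_mulOp {t : ℝ} {g : ℂ → ℂ} (hg : MemLp g ⊤ (lam t))
    (hg' : MemLp (fun z => conj (g z)) ⊤ (lam t)) (f f' : L2 t) :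
    ⟪mulOp t g hg f, f'⟫_ℂ = ⟪f, mulOp t _ hg' f'⟫_ℂ := by
  rw [inner_eq_integral, inner_eq_integral]
  refine integral_congr_ae ?_
  filter_upwards [coeFn_mulOp hg f, coeFn_mulOp hg' f'] with z h1 h2
  rw [h1, h2, map_mul]
  ring

theorem hankel_apply {t : ℝ} {g : ℂ → ℂ} (hg : MemLp g ⊤ (lam t)) (f : L2 t) :
    hankel t g hg f = mulOp t g hg (bergmanProj t f) -
      bergmanProj t (mulOp t g hg (bergmanProj t f)) := rfl

/-- Basis vectors are at mutual distance `√2`, so balls of radius `1/2` around them are disjoint,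
and `L²(λ_t)` is second countable. Countability permits exchanging the sum over the basis with
integrals and choosing one null set for all indices. -/
theorem countable_index {t : ℝ} (ht : -1 < t) {ι : Type*} (b : HilbertBasis ι ℂ (L2 t)) :
    Countable ι := by
  have := isProbabilityMeasure_lam ht
  have hfact : Fact ((2 : ℝ≥0∞) ≠ ⊤) := ⟨by norm_num⟩
  have hsc : SecondCountableTopology (L2 t) := Lp.SecondCountableTopology
  refine Pairwise.countable_of_isOpen_disjoint (s := fun i => ball (b i) (1 / 2)) ?_
    (fun _ => isOpen_ball) (fun i => ⟨b i, mem_ball_self (by norm_num)⟩)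
  intro i j hij
  refine ball_disjoint_ball ?_
  have h1 : ‖b i - b j‖ ^ 2 = 2 := by
    have h2 := norm_sub_sq (𝕜 := ℂ) (b i) (b j)
    rw [b.orthonormal.2 hij, b.orthonormal.1 i, b.orthonormal.1 j] at h2
    norm_num at h2
    exact h2
  rw [dist_eq_norm]
  nlinarith [norm_nonneg (b i - b j)]

theorem enorm_sq_eq_lintegral {t : ℝ} (f : L2 t) : ‖f‖ₑ ^ 2 = ∫⁻ z, ‖f z‖ₑ ^ 2 ∂(lam t) := by
  have h := eLpNorm_nnreal_pow_eq_lintegral (f := f) (μ := lam t) (p := 2) (by norm_num)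
  norm_num at h
  rw [Lp.enorm_def, h]

/-- The adjoint of a Hankel operator. -/
theorem adjoint_hankel {t : ℝ} {g : ℂ → ℂ} (hg : MemLp g ⊤ (lam t))
    (hg' : MemLp (fun z => conj (g z)) ⊤ (lam t)) (f : L2 t) :
    ContinuousLinearMap.adjoint (hankel t g hg) f =
      bergmanProj t (mulOp t _ hg' (f - bergmanProj t f)) := by
  refine ext_inner_left ℂ fun v => ?_
  rw [ContinuousLinearMap.adjoint_inner_right, hankel_apply, inner_sub_left, inner_bergmanProj,
    ← inner_sub_right, inner_mulOp hg hg', inner_bergmanProj]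

/-- The sum of the squared norms of the two Hankel operators is that of a commutator. -/
theorem hsNormSq_add {t : ℝ} {ι : Type*} (b : HilbertBasis ι ℂ (L2 t)) {g : ℂ → ℂ}
    (hg : MemLp g ⊤ (lam t)) (hg' : MemLp (fun z => conj (g z)) ⊤ (lam t)) :
    hsNormSq (hankel t g hg) + hsNormSq (hankel t _ hg') =
      ∑' i, ‖mulOp t _ hg' (bergmanProj t (b i)) - bergmanProj t (mulOp t _ hg' (b i))‖ₑ ^ 2 := by
  rw [hsNormSq_eq_tsum b (hankel t g hg), tsum_enorm_sq_adjoint b b (hankel t g hg),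
    hsNormSq_eq_tsum b, ← ENNReal.tsum_add]
  refine tsum_congr fun i => ?_
  set x := hankel t _ hg' (b i) with hx
  set y := ContinuousLinearMap.adjoint (hankel t g hg) (b i) with hy
  -- The commutator is `H_ḡ - H_g*`; the first term takes values in the orthogonal complement of the
  -- Bergman space, the second in the Bergman space.
  have h1 : mulOp t _ hg' (bergmanProj t (b i)) - bergmanProj t (mulOp t _ hg' (b i)) = x - y := by
    rw [hx, hy, adjoint_hankel hg hg', hankel_apply, map_sub, map_sub]
    abel
  have h2 : ⟪x, y⟫_ℂ = 0 := by
    rw [hy, adjoint_hankel hg hg', ← inner_bergmanProj, hx, hankel_apply, map_sub, bergmanProj_idem,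
      sub_self, inner_zero_left]
  have h3 : ‖x - y‖ ^ 2 = ‖y‖ ^ 2 + ‖x‖ ^ 2 := by
    rw [norm_sub_sq (𝕜 := ℂ), h2]
    simp [add_comm]
  rw [h1, ← ofReal_norm, ← ofReal_norm, ← ofReal_norm, ← ENNReal.ofReal_pow (norm_nonneg _),
    ← ENNReal.ofReal_pow (norm_nonneg _), ← ENNReal.ofReal_pow (norm_nonneg _), h3,
    ENNReal.ofReal_add (by positivity) (by positivity)]

/-- At almost every `z` the commutator applied to `f` is the inner product of `(g(z) - g) k_z` with
`f`. Parseval over the basis at fixed `z` gives the squared norm of this kernel section, which is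
then integrated in `z`. -/
theorem hsNormSq_add_eq_lintegral {t : ℝ} (ht : -1 < t) {g : ℂ → ℂ} (hg : MemLp g ⊤ (lam t))
    (hg' : MemLp (fun z => conj (g z)) ⊤ (lam t)) :
    hsNormSq (hankel t g hg) + hsNormSq (hankel t _ hg') =
      ∫⁻ z, ∫⁻ w, ‖g z - g w‖ₑ ^ 2 * ‖bk t z w‖ₑ ^ 2 ∂(lam t) ∂(lam t) := by
  obtain ⟨s, b, -⟩ := exists_hilbertBasis ℂ (L2 t)
  have := countable_index ht b
  rw [hsNormSq_add b hg hg']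
  simp_rw [enorm_sq_eq_lintegral]
  rw [← lintegral_tsum fun i => ((Lp.aestronglyMeasurable _).enorm.pow_const _)]
  refine lintegral_congr_ae ?_
  have h1 : ∀ᵐ z ∂(lam t), ∀ i : s, ∀ hz : z ∈ disk,
      (mulOp t _ hg' (bergmanProj t (b i)) - bergmanProj t (mulOp t _ hg' (b i)) : L2 t) z =
        ⟪g z • kz ht hz - mulOp t g hg (kz ht hz), b i⟫_ℂ := by
    refine ae_all_iff.2 fun i => ?_
    filter_upwards [Lp.coeFn_sub (mulOp t _ hg' (bergmanProj t (b i))) (bergmanProj t (mulOp t _ hg' (b i))),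
      coeFn_mulOp hg' (bergmanProj t (b i)), bergmanProj_ae_eq ht (b i),
      bergmanProj_ae_eq ht (mulOp t _ hg' (b i))] with z h1 h2 h3 h4 hz
    rw [h1, Pi.sub_apply, h2, h3 hz, h4 hz, inner_sub_left, inner_smul_left, inner_mulOp hg hg']
  filter_upwards [h1, ae_lam_mem t] with z h1 hz
  have h2 : ∀ i, ‖(mulOp t _ hg' (bergmanProj t (b i)) - bergmanProj t (mulOp t _ hg' (b i)) : L2 t) z‖ₑ ^ 2 =
      ‖⟪b i, g z • kz ht hz - mulOp t g hg (kz ht hz)⟫_ℂ‖ₑ ^ 2 := fun i => by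
    rw [h1 i hz, ← ofReal_norm, ← ofReal_norm, norm_inner_symm]
  simp_rw [h2]
  rw [← enorm_sq_eq_tsum b, enorm_sq_eq_lintegral]
  refine lintegral_congr_ae ?_
  filter_upwards [Lp.coeFn_sub (g z • kz ht hz) (mulOp t g hg (kz ht hz)), Lp.coeFn_smul (g z) (kz ht hz),
    coeFn_mulOp hg (kz ht hz), (memLp_bk ht hz).coeFn_toLp] with w h3 h4 h5 h6
  rw [h3, Pi.sub_apply, h4, h5, Pi.smul_apply, kz, h6, smul_eq_mul, ← sub_mul, enorm_mul, mul_pow]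

/-! ### Fourier coefficients on circles -/

/-- The `k`-th Fourier coefficient of `g` on the circle of radius `r`. -/
def circ (g : ℂ → ℂ) (k : ℤ) (r : ℝ) : ℂ :=
  (2 * Real.pi : ℂ)⁻¹ * ∫ θ in (-Real.pi)..Real.pi,
    g (r * Complex.exp (θ * Complex.I)) * Complex.exp (-(k * θ * Complex.I))

theorem continuousOn_circ {g : ℂ → ℂ} (hg : ContinuousOn g (closedBall 0 1)) (k : ℤ) :
    ContinuousOn (circ g k) (Icc 0 1) := by
  -- Clamping the radius to `[0, 1]` makes the integrand continuous in all real parameters without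
  -- changing it on `[0, 1]`.
  have h1 : Continuous fun p : ℝ × ℝ => g ((max 0 (min p.1 1) : ℝ) * Complex.exp (p.2 * Complex.I)) *
      Complex.exp (-(k * p.2 * Complex.I)) := by
    refine Continuous.mul (hg.comp_continuous (by fun_prop) fun p => ?_) (by fun_prop)
    rw [mem_closedBall_zero_iff, norm_mul, norm_exp_I, mul_one, Complex.norm_real, Real.norm_eq_abs,
      abs_of_nonneg (le_max_left _ _)]
    exact max_le zero_le_one (min_le_right _ _)
  have h2 := intervalIntegral.continuous_parametric_intervalIntegral_of_continuous'
    (μ := volume) (f := fun r θ : ℝ => g ((max 0 (min r 1) : ℝ) * Complex.exp (θ * Complex.I)) *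
      Complex.exp (-(k * θ * Complex.I))) h1 (-Real.pi) Real.pi
  have h3 := (h2.const_smul (2 * Real.pi : ℂ)⁻¹).continuousOn (s := Icc 0 1)
  refine h3.congr fun r hr => ?_
  simp only [Pi.smul_apply, min_eq_left hr.2, max_eq_right hr.1, circ, smul_eq_mul]

theorem norm_circle_coeff_le {u : ℝ → ℂ} {C : ℝ} (h : ∀ θ, ‖u θ‖ ≤ C) (k : ℤ) :
    ‖(2 * Real.pi : ℂ)⁻¹ * ∫ θ in (-Real.pi)..Real.pi, u θ * Complex.exp (-(k * θ * Complex.I))‖ ≤ C := by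
  have hpi := Real.pi_pos
  have h1 := intervalIntegral.norm_integral_le_of_norm_le_const (a := -Real.pi) (b := Real.pi)
    (f := fun θ : ℝ => u θ * Complex.exp (-(k * θ * Complex.I))) (C := C)
    fun θ _ => by
      have e : (-(k * θ * Complex.I) : ℂ) = ((-(k * θ) : ℝ) : ℂ) * Complex.I := by push_cast; ring
      rw [norm_mul, e, norm_exp_I, mul_one]
      exact h θ
  rw [sub_neg_eq_add, abs_of_pos (by positivity)] at h1
  rw [norm_mul, norm_inv]
  have e : ‖(2 * Real.pi : ℂ)‖ = 2 * Real.pi := by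
    rw [norm_mul, Complex.norm_real, Real.norm_eq_abs, abs_of_pos hpi]
    norm_num
  rw [e, inv_mul_le_iff₀ (by positivity)]
  linarith

theorem circ_one (k : ℤ) (r : ℝ) : circ (fun _ => 1) k r = if k = 0 then 1 else 0 := by
  have hpi := Real.pi_pos.ne'
  have hpi' : (Real.pi : ℂ) ≠ 0 := by exact_mod_cast hpi
  split_ifs with h
  · subst h
    simp [circ, ← two_mul]
    field_simp
  · have hk : (-(k * Complex.I) : ℂ) ≠ 0 := by simp [h]
    have h1 := integral_exp_mul_complex (a := -Real.pi) (b := Real.pi) hk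
    have e : ∀ θ : ℝ, (1 : ℂ) * Complex.exp (-(k * θ * Complex.I)) = Complex.exp (-(k * Complex.I) * θ) :=
      fun θ => by rw [one_mul]; congr 1; ring
    rw [circ]
    simp_rw [e]
    rw [h1]
    have e2 : Complex.exp (-(k * Complex.I) * (Real.pi : ℝ)) =
        Complex.exp (-(k * Complex.I) * ((-Real.pi : ℝ) : ℂ)) := by
      rw [Complex.exp_eq_exp_iff_exists_int]
      exact ⟨-k, by push_cast; ring⟩
    rw [e2, sub_self, zero_div, mul_zero]

/-- Integration by parts for Fourier coefficients of a periodic function. -/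
theorem integral_deriv_mul_exp {u u' : ℝ → ℂ} (hu : ∀ θ, HasDerivAt u (u' θ) θ)
    (hc : Continuous u') (hper : u (-Real.pi) = u Real.pi) (k : ℤ) :
    ∫ θ in (-Real.pi)..Real.pi, u' θ * Complex.exp (-(k * θ * Complex.I)) =
      k * Complex.I * ∫ θ in (-Real.pi)..Real.pi, u θ * Complex.exp (-(k * θ * Complex.I)) := by
  have hd : ∀ θ : ℝ, HasDerivAt (fun θ : ℝ => Complex.exp (-(k * θ * Complex.I)))
      (Complex.exp (-(k * θ * Complex.I)) * (-(k * Complex.I))) θ := fun θ => by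
    have h1 : HasDerivAt (fun θ : ℝ => (-(k * θ * Complex.I) : ℂ)) (-(k * Complex.I)) θ := by
      have := ((Complex.ofRealCLM.hasDerivAt (x := θ)).const_mul (-(k * Complex.I) : ℂ))
      simp only [Complex.ofRealCLM_apply, Complex.ofReal_one, mul_one] at this
      refine this.congr_of_eventuallyEq (Eventually.of_forall fun x => ?_)
      ring
    exact h1.cexp
  have h1 := intervalIntegral.integral_deriv_mul_eq_sub (a := -Real.pi) (b := Real.pi)
    (u := u) (v := fun θ : ℝ => Complex.exp (-(k * θ * Complex.I))) (u' := u')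
    (v' := fun θ => Complex.exp (-(k * θ * Complex.I)) * (-(k * Complex.I)))
    (fun θ _ => hu θ) (fun θ _ => hd θ) (hc.intervalIntegrable _ _)
    (Continuous.intervalIntegrable (by fun_prop) _ _)
  have e2 : Complex.exp (-(k * (Real.pi : ℝ) * Complex.I)) =
      Complex.exp (-(k * ((-Real.pi : ℝ) : ℂ) * Complex.I)) := by
    rw [Complex.exp_eq_exp_iff_exists_int]
    exact ⟨-k, by push_cast; ring⟩
  have hcu : Continuous u := continuous_iff_continuousAt.2 fun θ => (hu θ).continuousAt
  rw [hper, e2, sub_self, intervalIntegral.integral_add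
    (Continuous.intervalIntegrable (by fun_prop) _ _)
    (Continuous.intervalIntegrable (by fun_prop) _ _)] at h1
  have e3 : ∀ θ : ℝ, u θ * (Complex.exp (-(k * θ * Complex.I)) * (-(k * Complex.I))) =
      -(k * Complex.I) * (u θ * Complex.exp (-(k * θ * Complex.I))) := fun θ => by ring
  simp_rw [e3] at h1
  rw [intervalIntegral.integral_const_mul] at h1
  linear_combination h1

theorem fourierCoeffOn_eq (u : ℝ → ℂ) (k : ℤ) :
    fourierCoeffOn (show -Real.pi < Real.pi by linarith [Real.pi_pos]) u k =
      (2 * Real.pi : ℂ)⁻¹ * ∫ θ in (-Real.pi)..Real.pi, u θ * Complex.exp (-(k * θ * Complex.I)) := by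
  have hpi' : (Real.pi : ℂ) ≠ 0 := by exact_mod_cast Real.pi_pos.ne'
  rw [fourierCoeffOn_eq_integral, Complex.real_smul]
  congr 1
  · push_cast
    rw [one_div, sub_neg_eq_add, two_mul]
  · refine intervalIntegral.integral_congr fun θ _ => ?_
    rw [fourier_coe_apply, smul_eq_mul, mul_comm]
    congr 2
    push_cast
    field_simp
    ring

theorem memLp_Ioc {u : ℝ → ℂ} (hu : Continuous u) {a b : ℝ} :
    MemLp u 2 (volume.restrict (Ioc a b)) := by
  obtain ⟨C, hC⟩ := isCompact_Icc.exists_bound_of_continuousOn (hu.continuousOn (s := Icc a b))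
  refine MemLp.of_bound hu.aestronglyMeasurable C ?_
  filter_upwards [ae_restrict_mem measurableSet_Ioc] with x hx
  exact hC x (Ioc_subset_Icc_self hx)

/-- Parseval's identity for the pairing of a periodic function and its derivative. -/
theorem hasSum_mul_norm_sq {u u' : ℝ → ℂ} (hu : ∀ θ, HasDerivAt u (u' θ) θ)
    (hc : Continuous u') (hper : u (-Real.pi) = u Real.pi) :
    HasSum (fun k : ℤ => k * ‖(2 * Real.pi : ℂ)⁻¹ *
        ∫ θ in (-Real.pi)..Real.pi, u θ * Complex.exp (-(k * θ * Complex.I))‖ ^ 2)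
      ((2 * Real.pi)⁻¹ * ∫ θ in (-Real.pi)..Real.pi, (conj (u θ) * u' θ).im) := by
  have hcu : Continuous u := continuous_iff_continuousAt.2 fun θ => (hu θ).continuousAt
  have hab : -Real.pi < Real.pi := by linarith [Real.pi_pos]
  have key : ∀ a : ℂ, HasSum (fun k : ℤ => ‖(k * Complex.I + a) * ((2 * Real.pi : ℂ)⁻¹ *
        ∫ θ in (-Real.pi)..Real.pi, u θ * Complex.exp (-(k * θ * Complex.I)))‖ ^ 2)
      ((2 * Real.pi)⁻¹ * ∫ θ in (-Real.pi)..Real.pi, ‖u' θ + a * u θ‖ ^ 2) := by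
    intro a
    have hcont : Continuous fun θ => u' θ + a * u θ := by fun_prop
    have h1 := hasSum_sq_fourierCoeffOn (f := fun θ => u' θ + a * u θ) hab
      (memLp_Ioc hcont)
    rw [smul_eq_mul, sub_neg_eq_add, ← two_mul] at h1
    refine h1.congr_fun fun k => ?_
    rw [fourierCoeffOn_eq]
    have e : ∀ θ : ℝ, (u' θ + a * u θ) * Complex.exp (-(k * θ * Complex.I)) =
      u' θ * Complex.exp (-(k * θ * Complex.I)) + a * (u θ * Complex.exp (-(k * θ * Complex.I))) :=
      fun θ => by ring
    simp_rw [e]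
    rw [intervalIntegral.integral_add (Continuous.intervalIntegrable (by fun_prop) _ _)
      (Continuous.intervalIntegrable (by fun_prop) _ _), integral_deriv_mul_exp hu hc hper,
      intervalIntegral.integral_const_mul]
    congr 2
    ring
  -- Polarization: Parseval for `u' + i u` and `u' - i u`. The difference of the integrands is `4
  -- Im(ū u')`, and on the coefficient side `((k + 1)² - (k - 1)²)/4 = k`.
  have h1 := ((key Complex.I).sub (key (-Complex.I))).mul_left (1 / 4)
  have hi : ∀ a : ℂ, IntervalIntegrable (fun θ => ‖u' θ + a * u θ‖ ^ 2) volume (-Real.pi) Real.pi :=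
    fun a => Continuous.intervalIntegrable (by fun_prop) _ _
  rw [← mul_sub, ← intervalIntegral.integral_sub (hi _) (hi _), mul_left_comm,
    ← intervalIntegral.integral_const_mul] at h1
  have e : ∫ θ in (-Real.pi)..Real.pi, (conj (u θ) * u' θ).im = ∫ θ in (-Real.pi)..Real.pi,
      1 / 4 * (‖u' θ + Complex.I * u θ‖ ^ 2 - ‖u' θ + -Complex.I * u θ‖ ^ 2) := by
    refine intervalIntegral.integral_congr fun θ _ => ?_
    simp only [← Complex.normSq_eq_norm_sq, Complex.normSq_apply]
    simp
    ring
  rw [e]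
  refine h1.congr_fun fun k => ?_
  have e1 : ((k : ℂ) * Complex.I + Complex.I) = ((k + 1 : ℝ) : ℂ) * Complex.I := by push_cast; ring
  have e2 : ((k : ℂ) * Complex.I + -Complex.I) = ((k - 1 : ℝ) : ℂ) * Complex.I := by push_cast; ring
  have hn : ∀ (x : ℝ) (y : ℂ), ‖((x : ℂ) * Complex.I) * y‖ ^ 2 = x ^ 2 * ‖y‖ ^ 2 := fun x y => by
    rw [norm_mul, norm_mul, Complex.norm_I, Complex.norm_real, mul_one, mul_pow, Real.norm_eq_abs, sq_abs]
  rw [e1, e2, hn, hn]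
  ring

/-! ### Decay of the Fourier coefficients and Green's formula -/

/-- Two integrations by parts in the angle for `r < 1`, where the derivatives of `g` are bounded;
the radius `r = 1` follows by continuity of the coefficients. The quadratic decay makes the sums
over `k` converge uniformly in `r`. -/
theorem exists_circ_bound {g : ℂ → ℂ} (hg : ContDiffOn ℝ 2 g (closedBall 0 1)) :
    ∃ C : ℝ, 0 ≤ C ∧ ∀ k : ℤ, ∀ r ∈ Icc (0 : ℝ) 1,
      ‖circ g k r‖ ≤ C ∧ (k : ℝ) ^ 2 * ‖circ g k r‖ ≤ C := by
  obtain ⟨C, hC0, hC⟩ := exists_bound hg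
  have hgd := hg.mono (ball_subset_closedBall (x := (0 : ℂ)) (ε := 1))
  have hd1 : ContDiffOn ℝ 1 (fderiv ℝ g) disk := hgd.fderiv_of_isOpen isOpen_disk (by norm_num)
  have hc2 : ContinuousOn (fderiv ℝ (fderiv ℝ g)) disk :=
    hd1.continuousOn_fderiv_of_isOpen isOpen_disk (by norm_num)
  have hdh : ∀ z ∈ disk, DifferentiableAt ℝ g z := fun z hz =>
    (hgd.differentiableOn (by norm_num)).differentiableAt (isOpen_disk.mem_nhds hz)
  have hdd : ∀ z ∈ disk, DifferentiableAt ℝ (fderiv ℝ g) z := fun z hz =>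
    (hd1.differentiableOn (by norm_num)).differentiableAt (isOpen_disk.mem_nhds hz)
  have key : ∀ k : ℤ, ∀ r ∈ Ico (0 : ℝ) 1, ‖circ g k r‖ ≤ 2 * C ∧ (k : ℝ) ^ 2 * ‖circ g k r‖ ≤ 2 * C := by
    intro k r hr
    set e : ℝ → ℂ := fun θ => Complex.exp (θ * Complex.I) with he
    have hec : Continuous e := by fun_prop
    have hen : ∀ θ, ‖e θ‖ = 1 := norm_exp_I
    have hmem : ∀ θ, (r * e θ : ℂ) ∈ disk := fun θ => mul_exp_mem_disk hr.1 hr.2 θ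
    have hper : e (-Real.pi) = e Real.pi := by simp [he, Complex.exp_neg]
    have cont1 : Continuous fun θ => fderiv ℝ g (r * e θ) :=
      hd1.continuousOn.comp_continuous (by fun_prop) hmem
    have cont2 : Continuous fun θ => fderiv ℝ (fderiv ℝ g) (r * e θ) :=
      hc2.comp_continuous (by fun_prop) hmem
    set u' : ℝ → ℂ := fun θ => r • fderiv ℝ g (r * e θ) (e θ * Complex.I) with hu'
    set u'' : ℝ → ℂ := fun θ => r • (r • fderiv ℝ (fderiv ℝ g) (r * e θ) (e θ * Complex.I) (e θ * Complex.I) +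
      fderiv ℝ g (r * e θ) (e θ * Complex.I * Complex.I)) with hu''
    have d1 : ∀ θ, HasDerivAt (fun θ => g (r * e θ)) (u' θ) θ := fun θ => hasDerivAt_angle (hdh _ (hmem θ))
    have d2 : ∀ θ, HasDerivAt u' (u'' θ) θ := fun θ => by
      have h1 := (hasDerivAt_angle (hdd _ (hmem θ))).clm_apply ((hasDerivAt_exp_I θ).mul_const Complex.I)
      exact (h1.const_smul r).congr_deriv (by simp [hu'', he])
    have c1 : Continuous u' := (cont1.clm_apply (by fun_prop)).const_smul r
    have c2 : Continuous u'' := ((((cont2.clm_apply (by fun_prop)).clm_apply (by fun_prop)).const_smul r).add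
      (cont1.clm_apply (by fun_prop))).const_smul r
    have i1 := integral_deriv_mul_exp d1 c1 (by simp only [hper]) k
    have i2 := integral_deriv_mul_exp d2 c2 (by simp only [hu', hper]) k
    have hb0 : ∀ θ, ‖g (r * e θ)‖ ≤ 2 * C := fun θ => by linarith [(hC _ (hmem θ)).1]
    have hb2 : ∀ θ, ‖u'' θ‖ ≤ 2 * C := fun θ => by
      have h1 := (hC _ (hmem θ)).2.1
      have h2 := (hC _ (hmem θ)).2.2.1
      have hr1 : ‖r‖ ≤ 1 := by rw [Real.norm_eq_abs, abs_of_nonneg hr.1]; exact hr.2.le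
      have h3 : ‖fderiv ℝ (fderiv ℝ g) (r * e θ) (e θ * Complex.I) (e θ * Complex.I)‖ ≤ C := by
        refine ((fderiv ℝ (fderiv ℝ g) (r * e θ)).le_opNorm₂ _ _).trans ?_
        simpa [hen] using h2
      have h4 : ‖fderiv ℝ g (r * e θ) (e θ * Complex.I * Complex.I)‖ ≤ C := by
        refine ((fderiv ℝ g (r * e θ)).le_opNorm _).trans ?_
        simpa [hen] using h1
      rw [hu'', norm_smul]
      refine (mul_le_of_le_one_left (norm_nonneg _) hr1).trans ((norm_add_le _ _).trans ?_)
      rw [norm_smul]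
      have h5 := mul_le_of_le_one_left (norm_nonneg (fderiv ℝ (fderiv ℝ g) (r * e θ) (e θ * Complex.I) (e θ * Complex.I))) hr1
      linarith
    refine ⟨norm_circle_coeff_le hb0 k, ?_⟩
    have h5 := norm_circle_coeff_le hb2 k
    rw [i2, i1] at h5
    refine le_trans (le_of_eq ?_) h5
    rw [circ, show ∀ x : ℂ, (2 * Real.pi : ℂ)⁻¹ * (k * Complex.I * (k * Complex.I * x)) =
      ((-(k : ℝ) ^ 2 : ℝ) : ℂ) * ((2 * Real.pi : ℂ)⁻¹ * x) from fun x => by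
        push_cast; linear_combination ((2 * Real.pi : ℂ)⁻¹ * k ^ 2 * x) * Complex.I_sq, norm_mul _ (_ * _),
      Complex.norm_real, norm_neg, Real.norm_eq_abs, abs_of_nonneg (sq_nonneg _)]
  refine ⟨2 * C, by positivity, fun k r hr => ?_⟩
  rcases hr.2.lt_or_eq with h | h
  · exact key k r ⟨hr.1, h⟩
  · have hc : Tendsto (circ g k) (𝓝[Ico 0 1] 1) (𝓝 (circ g k 1)) :=
      ((continuousOn_circ hg.continuousOn k) 1 (right_mem_Icc.2 zero_le_one)).mono Ico_subset_Icc_self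
    have hne : (𝓝[Ico (0 : ℝ) 1] 1).NeBot := by
      rw [← mem_closure_iff_nhdsWithin_neBot, closure_Ico zero_ne_one]
      exact right_mem_Icc.2 zero_le_one
    rw [h]
    exact ⟨le_of_tendsto hc.norm (eventually_mem_nhdsWithin.mono fun r hr => (key k r hr).1),
      le_of_tendsto (hc.norm.const_mul _) (eventually_mem_nhdsWithin.mono fun r hr => (key k r hr).2)⟩

/-- The left side is `s` times the Jacobian determinant of `g` in the frame `e, i e`; rotation does
not change it, and it equals `|∂g|² - |∂̄g|²`. -/
theorem im_conj_fderiv_mul (g : ℂ → ℂ) (s : ℝ) (z : ℂ) {e : ℂ} (he : ‖e‖ = 1) :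
    (s * (conj (fderiv ℝ g z e) * fderiv ℝ g z (e * Complex.I))).im =
      -(s * (‖dbar g z‖ ^ 2 - ‖del g z‖ ^ 2)) := by
  have h1 : ∀ x y : ℝ, fderiv ℝ g z (x + y * Complex.I) =
      x * fderiv ℝ g z 1 + y * fderiv ℝ g z Complex.I := fun x y => by
    have e1 : (x + y * Complex.I : ℂ) = x • (1 : ℂ) + y • Complex.I := by simp
    rw [e1, map_add, map_smul, map_smul, Complex.real_smul, Complex.real_smul]
  have h2 : e = (e.re : ℂ) + e.im * Complex.I := (Complex.re_add_im e).symm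
  have h3 : e * Complex.I = ((-e.im : ℝ) : ℂ) + e.re * Complex.I := by
    apply Complex.ext <;> simp
  have h4 : e.re ^ 2 + e.im ^ 2 = 1 := by
    rw [← one_pow 2, ← he, ← Complex.normSq_eq_norm_sq, Complex.normSq_apply]
    ring
  rw [h3, h1]
  conv_lhs => rw [h2, h1]
  simp only [dbar, del, ← Complex.normSq_eq_norm_sq, Complex.normSq_apply]
  simp
  set a := fderiv ℝ g z 1
  set b := fderiv ℝ g z Complex.I
  linear_combination (s * (a.re * b.im - a.im * b.re)) * h4

/-- Green's formula for the Jacobian on a smaller disk. -/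
theorem hasSum_circ {g : ℂ → ℂ} (hg : ContDiffOn ℝ 2 g disk) {R : ℝ} (hR : R ∈ Ico (0 : ℝ) 1) :
    HasSum (fun k : ℤ => k * ‖circ g k R‖ ^ 2)
      (-Real.pi⁻¹ * ∫ s in 0..R, ∫ θ in (-Real.pi)..Real.pi,
        s * (‖dbar g (s * Complex.exp (θ * Complex.I))‖ ^ 2 - ‖del g (s * Complex.exp (θ * Complex.I))‖ ^ 2)) := by
  obtain ⟨hR0, hR1⟩ := hR
  have hpi := Real.pi_pos
  have hd1 : ContDiffOn ℝ 1 (fderiv ℝ g) disk := hg.fderiv_of_isOpen isOpen_disk (by norm_num)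
  have hc2 : ContinuousOn (fderiv ℝ (fderiv ℝ g)) disk :=
    hd1.continuousOn_fderiv_of_isOpen isOpen_disk (by norm_num)
  have hdh : ∀ z ∈ disk, DifferentiableAt ℝ g z := fun z hz =>
    (hg.differentiableOn (by norm_num)).differentiableAt (isOpen_disk.mem_nhds hz)
  have hdd : ∀ z ∈ disk, DifferentiableAt ℝ (fderiv ℝ g) z := fun z hz =>
    (hd1.differentiableOn (by norm_num)).differentiableAt (isOpen_disk.mem_nhds hz)
  set e : ℝ → ℂ := fun θ => Complex.exp (θ * Complex.I) with he
  have hec : Continuous e := by fun_prop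
  have hmem : ∀ s ∈ Icc 0 R, ∀ θ, (s * e θ : ℂ) ∈ disk := fun s hs θ =>
    mul_exp_mem_disk hs.1 (hs.2.trans_lt hR1) θ
  have hper : e (-Real.pi) = e Real.pi := by simp [he, Complex.exp_neg]
  have c0 := continuousOn_polar hg.continuousOn hR1
  have c1 := continuousOn_polar hd1.continuousOn hR1
  have c2 := continuousOn_polar hc2 hR1
  have cfst : ∀ {E : Type} [TopologicalSpace E] {f : ℝ × ℝ → E}, ContinuousOn f (Icc 0 R ×ˢ univ) →
      ∀ θ, ContinuousOn (fun s => f (s, θ)) (Icc 0 R) := fun hf θ =>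
    hf.comp (by fun_prop) fun s hs => ⟨hs, mem_univ _⟩
  have csnd : ∀ {E : Type} [TopologicalSpace E] {f : ℝ × ℝ → E}, ContinuousOn f (Icc 0 R ×ˢ univ) →
      ∀ s ∈ Icc 0 R, Continuous (fun θ => f (s, θ)) := fun hf s hs =>
    continuousOn_univ.1 (hf.comp (by fun_prop) fun θ _ => ⟨hs, mem_univ _⟩)
  -- the two mixed derivatives
  set A : ℝ × ℝ → ℂ := fun p => p.1 * fderiv ℝ (fderiv ℝ g) (p.1 * e p.2) (e p.2) (e p.2 * Complex.I) +
    fderiv ℝ g (p.1 * e p.2) (e p.2 * Complex.I) with hA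
  set J : ℝ × ℝ → ℂ := fun p => p.1 * (conj (fderiv ℝ g (p.1 * e p.2) (e p.2)) *
    fderiv ℝ g (p.1 * e p.2) (e p.2 * Complex.I)) with hJ
  set B : ℝ × ℝ → ℂ := fun p => conj (g (p.1 * e p.2)) * A p with hB
  have ce : ContinuousOn (fun p : ℝ × ℝ => e p.2) (Icc 0 R ×ˢ univ) := by fun_prop
  have ce' : ContinuousOn (fun p : ℝ × ℝ => e p.2 * Complex.I) (Icc 0 R ×ˢ univ) := by fun_prop
  have cp : ContinuousOn (fun p : ℝ × ℝ => (p.1 : ℂ)) (Icc 0 R ×ˢ univ) := by fun_prop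
  have cA : ContinuousOn A (Icc 0 R ×ˢ univ) :=
    (cp.mul ((c2.clm_apply ce).clm_apply ce')).add (c1.clm_apply ce')
  have cJ : ContinuousOn J (Icc 0 R ×ˢ univ) :=
    cp.mul ((Complex.continuous_conj.comp_continuousOn (c1.clm_apply ce)).mul (c1.clm_apply ce'))
  have cB : ContinuousOn B (Icc 0 R ×ˢ univ) :=
    (Complex.continuous_conj.comp_continuousOn c0).mul cA
  -- In polar coordinates `J = conj(∂_s g) ∂_θ g` and `B = ḡ ∂_s∂_θ g`, so `J + B = ∂_s (ḡ ∂_θ g)`.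
  have hray : ∀ θ : ℝ, ∫ s in 0..R, (J (s, θ) + B (s, θ)) =
      conj (g (R * e θ)) * (R • fderiv ℝ g (R * e θ) (e θ * Complex.I)) := by
    intro θ
    have h1 := intervalIntegral.integral_eq_sub_of_hasDerivAt_of_le hR0
      (f := fun s : ℝ => conj (g (s * e θ)) * (s * fderiv ℝ g (s * e θ) (e θ * Complex.I)))
      (f' := fun s => J (s, θ) + B (s, θ)) ?_ ?_ ?_
    · rw [h1]
      simp
    · exact (Complex.continuous_conj.comp_continuousOn (cfst c0 θ)).mul
        (ContinuousOn.mul (by fun_prop) ((cfst c1 θ).clm_apply continuousOn_const))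
    · intro s hs
      have hsd := hmem s ⟨hs.1.le, hs.2.le⟩ θ
      have d1 := (hasDerivAt_ray (hdd _ hsd)).clm_apply (hasDerivAt_const s (e θ * Complex.I))
      have d2 := ((hasDerivAt_id s).ofReal_comp.mul d1)
      have d3 := (hasDerivAt_ray (hdh _ hsd)).star.mul d2
      refine d3.congr_deriv ?_
      simp [hB, hJ, hA, he]
      ring
    · exact ContinuousOn.intervalIntegrable_of_Icc hR0 (cfst (cJ.add cB) θ)
  -- Likewise `conj J + B = ∂_θ (ḡ ∂_s g)` by symmetry of the second derivative, and periodicity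
  -- kills its integral. Subtracting leaves `J - conj J = 2i Im J`, the Jacobian.
  have hcirc : ∀ s ∈ Icc 0 R, ∫ θ in (-Real.pi)..Real.pi, (conj (J (s, θ)) + B (s, θ)) = 0 := by
    intro s hs
    have h1 := intervalIntegral.integral_eq_sub_of_hasDerivAt (a := -Real.pi) (b := Real.pi)
      (f := fun θ : ℝ => conj (g (s * e θ)) * fderiv ℝ g (s * e θ) (e θ))
      (f' := fun θ => conj (J (s, θ)) + B (s, θ)) ?_ ?_
    · rw [h1]
      simp only [hper, sub_self]
    · intro θ _
      have hsd := hmem s hs θ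
      have d1 := (hasDerivAt_angle (hdd _ hsd)).clm_apply (hasDerivAt_exp_I θ)
      have d3 := (hasDerivAt_angle (hdh _ hsd)).star.mul d1
      refine d3.congr_deriv ?_
      have hsymm : fderiv ℝ (fderiv ℝ g) (s * e θ) (e θ * Complex.I) (e θ) =
          fderiv ℝ (fderiv ℝ g) (s * e θ) (e θ) (e θ * Complex.I) := by
        have h2 : ContDiffAt ℝ 2 g (s * e θ) := hg.contDiffAt (isOpen_disk.mem_nhds hsd)
        exact (h2.isSymmSndFDerivAt (by simp)) _ _
      simp only [hB, hJ, hA, he] at hsymm ⊢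
      simp [hsymm]
      ring
    · exact Continuous.intervalIntegrable
        (csnd ((Complex.continuous_conj.comp_continuousOn cJ).add cB) s hs) _ _
  have hle : -Real.pi ≤ Real.pi := by linarith
  have hswap : ∫ θ in (-Real.pi)..Real.pi, ∫ s in 0..R, (J (s, θ) + B (s, θ)) =
      ∫ s in 0..R, ∫ θ in (-Real.pi)..Real.pi, (J (s, θ) + B (s, θ)) := by
    simp only [intervalIntegral.integral_of_le hR0, intervalIntegral.integral_of_le hle]
    rw [integral_integral_swap]
    have c3 : ContinuousOn (fun p : ℝ × ℝ => J (p.2, p.1) + B (p.2, p.1))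
        (Icc (-Real.pi) Real.pi ×ˢ Icc 0 R) :=
      (cJ.add cB).comp (f := fun p : ℝ × ℝ => (p.2, p.1)) (by fun_prop) fun p hp => ⟨hp.2, mem_univ _⟩
    have h1 := c3.integrableOn_compact (μ := volume) (isCompact_Icc.prod isCompact_Icc)
    rw [Measure.prod_restrict]
    exact h1.mono_set (prod_mono Ioc_subset_Icc_self Ioc_subset_Icc_self)
  have hin : ∀ s ∈ Icc 0 R, ∫ θ in (-Real.pi)..Real.pi, (J (s, θ) + B (s, θ)) =
      (-2 * Complex.I) * ((∫ θ in (-Real.pi)..Real.pi, s * (‖dbar g (s * e θ)‖ ^ 2 - ‖del g (s * e θ)‖ ^ 2) : ℝ) : ℂ) := by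
    intro s hs
    have k1 : IntervalIntegrable (fun θ => J (s, θ) + B (s, θ)) volume (-Real.pi) Real.pi :=
      (csnd (cJ.add cB) s hs).intervalIntegrable _ _
    have k2 : IntervalIntegrable (fun θ => conj (J (s, θ)) + B (s, θ)) volume (-Real.pi) Real.pi :=
      (csnd ((Complex.continuous_conj.comp_continuousOn cJ).add cB) s hs).intervalIntegrable _ _
    rw [← sub_zero (∫ θ in (-Real.pi)..Real.pi, _), ← hcirc s hs, ← intervalIntegral.integral_sub k1 k2, ← intervalIntegral.integral_ofReal, ← intervalIntegral.integral_const_mul]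
    refine intervalIntegral.integral_congr fun θ _ => ?_
    have h1 : J (s, θ) + B (s, θ) - (conj (J (s, θ)) + B (s, θ)) = (2 * (J (s, θ)).im : ℝ) * Complex.I := by
      rw [add_sub_add_right_eq_sub, Complex.sub_conj]
    rw [h1, im_conj_fderiv_mul g s (s * e θ) (norm_exp_I θ)]
    push_cast
    ring
  have h2 : ∫ θ in (-Real.pi)..Real.pi, conj (g (R * e θ)) * (R • fderiv ℝ g (R * e θ) (e θ * Complex.I)) =
      (-2 * Complex.I) * ((∫ s in 0..R, ∫ θ in (-Real.pi)..Real.pi,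
        s * (‖dbar g (s * e θ)‖ ^ 2 - ‖del g (s * e θ)‖ ^ 2) : ℝ) : ℂ) := by
    simp_rw [← hray]
    rw [hswap, ← intervalIntegral.integral_ofReal, ← intervalIntegral.integral_const_mul]
    refine intervalIntegral.integral_congr fun s hs => ?_
    rw [uIcc_of_le hR0] at hs
    exact hin s hs
  have hRm := hmem R ⟨hR0, le_rfl⟩
  have cR0 : Continuous fun θ => g (R * e θ) := csnd c0 R ⟨hR0, le_rfl⟩
  have cR1 : Continuous fun θ => fderiv ℝ g (R * e θ) := csnd c1 R ⟨hR0, le_rfl⟩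
  have cu' : Continuous fun θ => R • fderiv ℝ g (R * e θ) (e θ * Complex.I) :=
    (cR1.clm_apply (by fun_prop)).const_smul R
  have h3 := hasSum_mul_norm_sq (u := fun θ => g (R * e θ)) (fun θ => hasDerivAt_angle (hdh _ (hRm θ))) cu'
    (by simp only [hper])
  have h4 := intervalIntegral.intervalIntegral_im (𝕜 := ℂ) (μ := volume) (a := -Real.pi) (b := Real.pi)
    (((Complex.continuous_conj.comp cR0).mul cu').intervalIntegrable _ _)
  have h5 : ∫ θ in (-Real.pi)..Real.pi, (conj (g (R * e θ)) * (R • fderiv ℝ g (R * e θ) (e θ * Complex.I))).im =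
      -2 * ∫ s in 0..R, ∫ θ in (-Real.pi)..Real.pi,
        s * (‖dbar g (s * e θ)‖ ^ 2 - ‖del g (s * e θ)‖ ^ 2) := by
    refine h4.trans ((congrArg Complex.im h2).trans ?_)
    simp
  have h6 : HasSum (fun k : ℤ => k * ‖circ g k R‖ ^ 2) ((2 * Real.pi)⁻¹ *
      (-2 * ∫ s in 0..R, ∫ θ in (-Real.pi)..Real.pi,
        s * (‖dbar g (s * e θ)‖ ^ 2 - ‖del g (s * e θ)‖ ^ 2))) := by
    rw [← h5]
    exact h3
  have h7 : ∀ x : ℝ, -Real.pi⁻¹ * x = (2 * Real.pi)⁻¹ * (-2 * x) := fun x => by field_simp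
  rw [h7]
  exact h6

theorem tendsto_integral_polar {q : ℂ → ℝ} (hq : ContinuousOn q disk) {C : ℝ} (hC : ∀ z ∈ disk, ‖q z‖ ≤ C) :
    Tendsto (fun R => ∫ s in 0..R, ∫ θ in (-Real.pi)..Real.pi, s * q (s * Complex.exp (θ * Complex.I)))
      (𝓝[Ico 0 1] 1) (𝓝 (∫ z in disk, q z)) := by
  have hle : -Real.pi ≤ Real.pi := by linarith [Real.pi_pos]
  have hmem : ∀ p ∈ Ioo (0 : ℝ) 1 ×ˢ Ioo (-Real.pi) Real.pi,
      (p.1 * Complex.exp (p.2 * Complex.I) : ℂ) ∈ disk := fun p hp => mul_exp_mem_disk hp.1.1.le hp.1.2 _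
  have hS : MeasurableSet (Ioo (0 : ℝ) 1 ×ˢ Ioo (-Real.pi) Real.pi) :=
    measurableSet_Ioo.prod measurableSet_Ioo
  have hint : IntegrableOn (fun p : ℝ × ℝ => p.1 * q (p.1 * Complex.exp (p.2 * Complex.I)))
      (Ioo (0 : ℝ) 1 ×ˢ Ioo (-Real.pi) Real.pi) (volume.prod volume) := by
    refine IntegrableOn.of_bound (C := C) ?_ ?_ ?_
    · rw [Measure.prod_prod]
      simp
    · have c1 : ContinuousOn (fun p : ℝ × ℝ => q (p.1 * Complex.exp (p.2 * Complex.I)))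
          (Ioo (0 : ℝ) 1 ×ˢ Ioo (-Real.pi) Real.pi) := hq.comp (by fun_prop) hmem
      have c2 : ContinuousOn (fun p : ℝ × ℝ => p.1 * q (p.1 * Complex.exp (p.2 * Complex.I)))
          (Ioo (0 : ℝ) 1 ×ˢ Ioo (-Real.pi) Real.pi) := continuousOn_fst.mul c1
      exact c2.aestronglyMeasurable hS
    · filter_upwards [ae_restrict_mem hS] with p hp
      rw [norm_mul, Real.norm_eq_abs, abs_of_pos hp.1.1]
      exact (mul_le_of_le_one_left (norm_nonneg _) hp.1.2.le).trans (hC _ (hmem p hp))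
  have h1 : ∫ z in disk, q z = ∫ s in (0 : ℝ)..1, ∫ θ in (-Real.pi)..Real.pi,
      s * q (s * Complex.exp (θ * Complex.I)) := by
    have h2 := integral_disk_polar fun z => (q z : ℂ)
    rw [Measure.volume_eq_prod] at h2
    simp_rw [← Complex.ofReal_mul] at h2
    rw [show ∫ z in disk, (q z : ℂ) = ((∫ z in disk, q z : ℝ) : ℂ) from integral_ofReal,
      show ∀ (f : ℝ × ℝ → ℝ) (ν : Measure (ℝ × ℝ)), ∫ p, (f p : ℂ) ∂ν = ((∫ p, f p ∂ν : ℝ) : ℂ) from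
        fun _ _ => integral_ofReal, Complex.ofReal_inj, setIntegral_prod _ hint] at h2
    simp only [intervalIntegral.integral_of_le (zero_le_one (α := ℝ)), intervalIntegral.integral_of_le hle,
      integral_Ioc_eq_integral_Ioo]
    exact h2
  have h3 : IntegrableOn (fun s : ℝ => ∫ θ in (-Real.pi)..Real.pi, s * q (s * Complex.exp (θ * Complex.I)))
      (uIcc 0 1) := by
    rw [uIcc_of_le zero_le_one, integrableOn_Icc_iff_integrableOn_Ioo]
    rw [IntegrableOn, ← Measure.prod_restrict] at hint
    have h4 := hint.integral_prod_left
    simp only [intervalIntegral.integral_of_le hle, integral_Ioc_eq_integral_Ioo]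
    exact h4
  rw [h1]
  refine ((intervalIntegral.continuousOn_primitive_interval h3) 1 right_mem_uIcc).mono ?_
  rw [uIcc_of_le zero_le_one]
  exact Ico_subset_Icc_self

/-- The integrated Jacobian in terms of the Fourier coefficients of the boundary values. -/
theorem hasSum_circ_one {g : ℂ → ℂ} (hg : ContDiffOn ℝ 2 g (closedBall 0 1)) :
    HasSum (fun k : ℤ => k * ‖circ g k 1‖ ^ 2)
      (-Real.pi⁻¹ * ∫ z in disk, (‖dbar g z‖ ^ 2 - ‖del g z‖ ^ 2)) := by
  obtain ⟨C, hC0, hC⟩ := exists_circ_bound hg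
  obtain ⟨D, hD0, hD⟩ := exists_bound hg
  have hgd := hg.mono (ball_subset_closedBall (x := (0 : ℂ)) (ε := 1))
  -- For `k ≠ 0`, multiply `|k| |ĝ(k)| ≤ C` by `k² |ĝ(k)| ≤ C`. At `k = 0` both sides are zero, the
  -- right one by the convention `1 / 0 = 0`.
  have hb : ∀ k : ℤ, ∀ r ∈ Icc (0 : ℝ) 1, ‖k * ‖circ g k r‖ ^ 2‖ ≤ C ^ 2 * (1 / (k : ℝ) ^ 2) := by
    intro k r hr
    obtain ⟨h1, h2⟩ := hC k r hr
    rcases eq_or_ne k 0 with rfl | hk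
    · simp
    have hk1 : (1 : ℝ) ≤ |(k : ℝ)| := by exact_mod_cast Int.one_le_abs hk
    have hk2 : 0 < (k : ℝ) ^ 2 := by positivity
    rw [norm_mul, norm_pow, norm_norm, Real.norm_eq_abs, mul_one_div, le_div_iff₀ hk2, ← sq_abs (k : ℝ)]
    rw [← sq_abs] at h2
    have h3 : |(k : ℝ)| * ‖circ g k r‖ ≤ C := by
      refine le_trans (mul_le_mul_of_nonneg_right ?_ (norm_nonneg _)) h2
      nlinarith
    have h4 : |(k : ℝ)| * ‖circ g k r‖ ^ 2 * |(k : ℝ)| ^ 2 =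
      (|(k : ℝ)| * ‖circ g k r‖) * (|(k : ℝ)| ^ 2 * ‖circ g k r‖) := by ring
    rw [h4, sq C]
    exact mul_le_mul h3 h2 (by positivity) hC0
  have hs : Summable fun k : ℤ => C ^ 2 * (1 / (k : ℝ) ^ 2) :=
    (Real.summable_one_div_int_pow.2 one_lt_two).mul_left _
  have hne : (𝓝[Ico (0 : ℝ) 1] 1).NeBot := by
    rw [← mem_closure_iff_nhdsWithin_neBot, closure_Ico zero_ne_one]
    exact right_mem_Icc.2 zero_le_one
  have h1 : Tendsto (fun r => ∑' k : ℤ, k * ‖circ g k r‖ ^ 2) (𝓝[Ico (0 : ℝ) 1] 1)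
      (𝓝 (∑' k : ℤ, k * ‖circ g k 1‖ ^ 2)) := by
    refine tendsto_tsum_of_dominated_convergence hs (fun k => ?_)
      (eventually_mem_nhdsWithin.mono fun r hr k => hb k r (Ico_subset_Icc_self hr))
    have hc : Tendsto (circ g k) (𝓝[Ico 0 1] 1) (𝓝 (circ g k 1)) :=
      ((continuousOn_circ hg.continuousOn k) 1 (right_mem_Icc.2 zero_le_one)).mono Ico_subset_Icc_self
    exact (hc.norm.pow 2).const_mul _
  have h2 : Tendsto (fun r => ∑' k : ℤ, k * ‖circ g k r‖ ^ 2) (𝓝[Ico (0 : ℝ) 1] 1)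
      (𝓝 (-Real.pi⁻¹ * ∫ z in disk, (‖dbar g z‖ ^ 2 - ‖del g z‖ ^ 2))) := by
    have hq : ContinuousOn (fun z => ‖dbar g z‖ ^ 2 - ‖del g z‖ ^ 2) disk :=
      ((continuousOn_dbar hgd).norm.pow 2).sub ((continuousOn_del hgd).norm.pow 2)
    refine ((tendsto_integral_polar hq (C := D ^ 2 + D ^ 2) fun z hz => ?_).const_mul _).congr' ?_
    · have h3 := (norm_dbar_le g z).trans (hD z hz).2.1
      have h4 := (norm_del_le g z).trans (hD z hz).2.1
      refine (norm_sub_le _ _).trans ?_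
      rw [norm_pow, norm_norm, norm_pow, norm_norm]
      gcongr
    · filter_upwards [self_mem_nhdsWithin] with r hr
      exact (hasSum_circ hgd hr).tsum_eq.symm
  rw [← tendsto_nhds_unique h1 h2]
  exact (Summable.of_norm_bounded hs fun k => hb k 1 (right_mem_Icc.2 zero_le_one)).hasSum

/-! ### The monomial basis of the Bergman space -/

theorem lam_pos {t : ℝ} (ht : -1 < t) {V : Set ℂ} (hV : IsOpen V) (hVd : V ⊆ disk) (hne : V.Nonempty) :
    0 < lam t V := by
  rw [pos_iff_ne_zero]
  intro h0
  rw [lam, withDensity_apply_eq_zero (measurable_weight t).ennreal_ofReal,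
    Measure.restrict_apply' measurableSet_disk] at h0
  refine (hV.measure_pos volume hne).ne' (measure_mono_null (fun z hz => ?_) h0)
  refine ⟨⟨?_, hz⟩, hVd hz⟩
  have h1 := one_sub_norm_sq_pos (hVd hz)
  have h2 : 0 < t + 1 := by linarith
  have : 0 < weight t z := by
    unfold weight
    have := Real.pi_pos
    positivity
  simpa using this

/-- The moments `‖zⁿ‖²`. -/
def gam (t : ℝ) (n : ℕ) : ℝ := ∫ z, (‖z‖ ^ 2) ^ n ∂(lam t)

theorem integrable_norm_pow {t : ℝ} (ht : -1 < t) (n : ℕ) : Integrable (fun z => ‖z‖ ^ n) (lam t) := by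
  have := isProbabilityMeasure_lam ht
  refine Integrable.of_bound (by fun_prop) 1 ?_
  filter_upwards [ae_lam_mem t] with z hz
  rw [norm_pow, norm_norm]
  exact pow_le_one₀ (norm_nonneg z) (mem_disk.1 hz).le

theorem integrable_norm_sq_pow {t : ℝ} (ht : -1 < t) (n : ℕ) :
    Integrable (fun z => (‖z‖ ^ 2) ^ n) (lam t) := by
  simp_rw [← pow_mul]
  exact integrable_norm_pow ht _

theorem gam_pos {t : ℝ} (ht : -1 < t) (n : ℕ) : 0 < gam t n := by
  rw [gam, integral_pos_iff_support_of_nonneg (fun z => by positivity) (integrable_norm_sq_pow ht n)]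
  refine (lam_pos ht (V := disk \ {0}) (isOpen_disk.sdiff isClosed_singleton) sdiff_subset
    ⟨1 / 2, ?_⟩).trans_le (measure_mono fun z hz => ?_)
  · refine ⟨mem_disk.2 (by norm_num), by simp⟩
  · have : z ≠ 0 := hz.2
    simp [this]

/-- The radial moments concentrate on the boundary. -/
theorem tendsto_moment {t : ℝ} (ht : -1 < t) {φ : ℝ → ℂ} (hφ : ContinuousOn φ (Icc 0 1)) :
    Tendsto (fun n : ℕ => ((gam t n)⁻¹ : ℝ) • ∫ z, ((‖z‖ ^ 2) ^ n) • φ ‖z‖ ∂(lam t)) atTop (𝓝 (φ 1)) := by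
  have := isProbabilityMeasure_lam ht
  have hae : ∀ᵐ z ∂(lam t), ‖z‖ ∈ Icc (0 : ℝ) 1 :=
    (ae_lam_mem t).mono fun z hz => ⟨norm_nonneg z, (mem_disk.1 hz).le⟩
  have hclamp : Continuous fun r : ℝ => φ (max 0 (min r 1)) :=
    hφ.comp_continuous (by fun_prop) fun r => ⟨le_max_left _ _, max_le zero_le_one (min_le_right _ _)⟩
  have hn : AEMeasurable (fun z : ℂ => ‖z‖) (lam t) := measurable_norm.aemeasurable
  have hprob : IsProbabilityMeasure ((lam t).map fun z => ‖z‖) := Measure.isProbabilityMeasure_map hn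
  -- Peak function argument for the law of `|z|`: on `[0, 1]` the function `r²` has its only maximum
  -- at `r = 1`, and neighbourhoods of `1` carry positive mass.
  have h1 := tendsto_setIntegral_pow_smul_of_unique_maximum_of_isCompact_of_measure_nhdsWithin_pos
    (μ := (lam t).map fun z => ‖z‖) (s := Icc (0 : ℝ) 1) (x₀ := 1) (c := fun r => r ^ 2)
    (g := fun r => φ (max 0 (min r 1))) isCompact_Icc ?_ (by fun_prop) ?_ ?_ (by norm_num)
    (right_mem_Icc.2 zero_le_one) (hclamp.continuousOn.integrableOn_compact isCompact_Icc)
    hclamp.continuousWithinAt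
  · have e : ∀ {E : Type} [NormedAddCommGroup E] [NormedSpace ℝ E] {f : ℝ → E} (_ : Continuous f),
        ∫ x in Icc (0 : ℝ) 1, f x ∂((lam t).map fun z => ‖z‖) = ∫ z, f ‖z‖ ∂(lam t) := by
      intro E _ _ f hf
      rw [setIntegral_map measurableSet_Icc hf.aestronglyMeasurable hn]
      refine setIntegral_eq_integral_of_ae_compl_eq_zero ?_
      filter_upwards [hae] with z hz hz'
      exact absurd hz hz'
    simp only [min_self, max_eq_right (zero_le_one (α := ℝ))] at h1
    refine h1.congr fun n => ?_
    have hc : Continuous fun x : ℝ => (x ^ 2) ^ n • φ (max 0 (min x 1)) :=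
      ((continuous_pow 2).pow n).smul hclamp
    have hc0 : Continuous fun x : ℝ => (x ^ 2) ^ n := by fun_prop
    rw [e hc0, e hc, gam]
    congr 1
    refine integral_congr_ae ?_
    filter_upwards [hae] with z hz
    simp only [min_eq_left hz.2, max_eq_right hz.1]
  · intro u hu h1u
    rw [Measure.map_apply measurable_norm (hu.measurableSet.inter measurableSet_Icc)]
    refine (lam_pos ht (V := (fun z : ℂ => ‖z‖) ⁻¹' u ∩ disk)
      ((hu.preimage continuous_norm).inter isOpen_disk) inter_subset_right ?_).trans_le
      (measure_mono fun z hz => ⟨hz.1, norm_nonneg z, (mem_disk.1 hz.2).le⟩)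
    have hcl : (1 : ℝ) ∈ closure (Ico 0 1) := by
      rw [closure_Ico zero_ne_one]
      exact right_mem_Icc.2 zero_le_one
    obtain ⟨r, hru, hr⟩ := mem_closure_iff.1 hcl u hu h1u
    refine ⟨r, ?_, ?_⟩
    · simpa [abs_of_nonneg hr.1] using hru
    · simpa [mem_disk, abs_of_nonneg hr.1] using hr.2
  · intro y hy hne
    have := lt_of_le_of_ne hy.2 hne
    have := hy.1
    nlinarith
  · intro y _
    positivity

/-! ### Matrix entries in the monomial basis, and its completeness. -/

theorem integrable_of_bounded {t : ℝ} (ht : -1 < t) {f : ℂ → ℂ} (hf : ContinuousOn f disk) {C : ℝ}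
    (hC : ∀ z ∈ disk, ‖f z‖ ≤ C) : Integrable f (lam t) := by
  have := isProbabilityMeasure_lam ht
  exact Integrable.of_bound (aestronglyMeasurable_lam hf t) C ((ae_lam_mem t).mono hC)

theorem norm_pow_le_one {z : ℂ} (hz : z ∈ disk) (n : ℕ) : ‖z‖ ^ n ≤ 1 :=
  pow_le_one₀ (norm_nonneg z) (mem_disk.1 hz).le

/-- On the circle of radius `r` the product `conj(z^m) z^n` is `r^(m+n) e^(-i(m-n)θ)`, so the
angular integration picks out the Fourier coefficient of index `m - n`. -/
theorem integral_monomial {t : ℝ} (ht : -1 < t) {g : ℂ → ℂ} (hg : ContinuousOn g (closedBall 0 1))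
    (m n : ℕ) : ∫ z, conj (z ^ m) * (g z * z ^ n) ∂(lam t) =
      ∫ z, ((‖z‖ ^ (m + n) : ℝ) : ℂ) * circ g ((m : ℤ) - n) ‖z‖ ∂(lam t) := by
  obtain ⟨C, hC⟩ := (isCompact_closedBall (0 : ℂ) 1).exists_bound_of_continuousOn hg
  have hgd : ContinuousOn g disk := hg.mono ball_subset_closedBall
  have hmaps : MapsTo (fun z : ℂ => ‖z‖) disk (Icc 0 1) := fun z hz => ⟨norm_nonneg z, (mem_disk.1 hz).le⟩
  have c1 : ContinuousOn (fun z : ℂ => conj (z ^ m) * (g z * z ^ n)) disk :=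
    ContinuousOn.mul (by fun_prop) (hgd.mul (by fun_prop))
  have c2 : ContinuousOn (fun z : ℂ => ((‖z‖ ^ (m + n) : ℝ) : ℂ) * circ g ((m : ℤ) - n) ‖z‖) disk :=
    ContinuousOn.mul (by fun_prop) ((continuousOn_circ hg _).comp (by fun_prop) hmaps)
  have i1 := integrable_of_bounded ht c1 (C := C) fun z hz => by
    rw [norm_mul, norm_mul, RCLike.norm_conj, norm_pow, norm_pow]
    have h1 := norm_pow_le_one hz m
    have h2 := norm_pow_le_one hz n
    have h3 := hC z (ball_subset_closedBall hz)
    have h4 : ‖g z‖ * ‖z‖ ^ n ≤ C := (mul_le_of_le_one_right (norm_nonneg _) h2).trans h3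
    exact (mul_le_of_le_one_left (by positivity) h1).trans h4
  have i2 := integrable_of_bounded ht c2 (C := C) fun z hz => by
    rw [norm_mul, Complex.norm_real, norm_pow, norm_norm]
    refine (mul_le_of_le_one_left (norm_nonneg _) (norm_pow_le_one hz _)).trans ?_
    refine norm_circle_coeff_le (fun θ => hC _ ?_) _
    rw [mem_closedBall_zero_iff, norm_mul, norm_exp_I, mul_one, Complex.norm_real, norm_norm]
    exact (mem_disk.1 hz).le
  rw [integrable_lam ht] at i1 i2
  have e : ∀ z x : ℂ, weight t z * x = x * (((t + 1) / Real.pi * (1 - ‖z‖ ^ 2) ^ t : ℝ) : ℂ) :=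
    fun z x => by rw [weight, mul_comm]
  rw [integral_lam ht, integral_lam ht]
  simp only [e] at i1 i2 ⊢
  rw [integral_disk_radial (k := fun r => (t + 1) / Real.pi * (1 - r ^ 2) ^ t) c1 (by fun_prop) i1,
    integral_disk_radial (k := fun r => (t + 1) / Real.pi * (1 - r ^ 2) ^ t) c2 (by fun_prop) i2]
  refine setIntegral_congr_fun measurableSet_Ioo fun r hr => ?_
  congr 1
  have e1 : ∀ θ : ℝ, conj ((r * Complex.exp (θ * Complex.I)) ^ m) *
      (g (r * Complex.exp (θ * Complex.I)) * (r * Complex.exp (θ * Complex.I)) ^ n) =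
      ((r ^ (m + n) : ℝ) : ℂ) * (g (r * Complex.exp (θ * Complex.I)) *
        Complex.exp (-(((m - n : ℤ) : ℂ) * θ * Complex.I))) := fun θ => by
    have h1 : conj (Complex.exp (θ * Complex.I)) = Complex.exp (-(θ * Complex.I)) := by
      rw [← Complex.exp_conj]
      simp
    have h2 : Complex.exp (-(((m - n : ℤ) : ℂ) * θ * Complex.I)) =
        Complex.exp (-(θ * Complex.I)) ^ m * Complex.exp (θ * Complex.I) ^ n := by
      rw [← Complex.exp_nat_mul, ← Complex.exp_nat_mul, ← Complex.exp_add]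
      congr 1
      push_cast
      ring
    rw [h2, map_pow, map_mul, h1, Complex.conj_ofReal]
    push_cast
    ring
  have e2 : ∀ θ : ℝ, ‖(r * Complex.exp (θ * Complex.I) : ℂ)‖ = r := fun θ => by
    rw [norm_mul, norm_exp_I, mul_one, Complex.norm_real, Real.norm_eq_abs, abs_of_pos hr.1]
  have hpi : (Real.pi : ℂ) ≠ 0 := by exact_mod_cast Real.pi_pos.ne'
  simp_rw [e1, e2]
  rw [intervalIntegral.integral_const_mul, intervalIntegral.integral_const, Complex.real_smul, circ]
  generalize ∫ θ in (-Real.pi)..Real.pi, g (r * Complex.exp (θ * Complex.I)) *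
    Complex.exp (-(((m - n : ℤ) : ℂ) * θ * Complex.I)) = X
  push_cast
  field_simp
  ring

theorem memLp_monomial {t : ℝ} (ht : -1 < t) (n : ℕ) :
    MemLp (fun z : ℂ => ((√(gam t n))⁻¹ : ℂ) * z ^ n) 2 (lam t) := by
  refine memLp_of_bounded ht (by fun_prop) (C := (√(gam t n))⁻¹) fun z hz => ?_
  rw [norm_mul, norm_pow, ← Complex.ofReal_inv, Complex.norm_real, Real.norm_eq_abs, abs_of_nonneg (by positivity)]
  exact mul_le_of_le_one_right (by positivity) (norm_pow_le_one hz n)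

/-- The normalized monomials. -/
def monomial {t : ℝ} (ht : -1 < t) (n : ℕ) : L2 t := (memLp_monomial ht n).toLp

theorem coeFn_monomial {t : ℝ} (ht : -1 < t) (n : ℕ) :
    monomial ht n =ᵐ[lam t] fun z => ((√(gam t n))⁻¹ : ℂ) * z ^ n := MemLp.coeFn_toLp _

theorem monomial_mem {t : ℝ} (ht : -1 < t) (n : ℕ) : monomial ht n ∈ bergman t :=
  ⟨_, by fun_prop, coeFn_monomial ht n⟩

/-- The matrix of a Toeplitz operator in the monomial basis. -/
def toeplitz (t : ℝ) (g : ℂ → ℂ) (m n : ℕ) : ℂ :=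
  ((√(gam t m))⁻¹ * (√(gam t n))⁻¹ : ℝ) *
    ∫ z, ((‖z‖ ^ (m + n) : ℝ) : ℂ) * circ g ((m : ℤ) - n) ‖z‖ ∂(lam t)

/-- The multiplication enters only through an almost everywhere identity, so the case `g = 1` also
yields orthonormality of the monomials. -/
theorem inner_monomial {t : ℝ} (ht : -1 < t) {g : ℂ → ℂ} (hg : ContinuousOn g (closedBall 0 1)) {m n : ℕ}
    {f : L2 t} (hf : f =ᵐ[lam t] fun z => g z * monomial ht n z) :
    ⟪monomial ht m, f⟫_ℂ = toeplitz t g m n := by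
  rw [inner_eq_integral, toeplitz, ← integral_monomial ht hg, ← integral_const_mul]
  refine integral_congr_ae ?_
  filter_upwards [hf, coeFn_monomial ht m, coeFn_monomial ht n] with z h1 h2 h3
  rw [h1, h2, h3, map_mul, ← Complex.ofReal_inv, Complex.conj_ofReal]
  push_cast
  ring

theorem toeplitz_one {t : ℝ} (ht : -1 < t) (m n : ℕ) :
    toeplitz t (fun _ => 1) m n = if m = n then 1 else 0 := by
  rw [toeplitz]
  simp_rw [circ_one]
  split_ifs with h1 h2 h2
  · subst h2
    have h3 := gam_pos ht m
    have h4 : ∫ z : ℂ, ((‖z‖ ^ (m + m) : ℝ) : ℂ) * 1 ∂(lam t) = (gam t m : ℂ) := by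
      simp_rw [mul_one]
      rw [gam, ← integral_complex_ofReal]
      simp_rw [← pow_mul, two_mul]
    rw [h4, ← Complex.ofReal_mul, ← mul_inv, Real.mul_self_sqrt h3.le, inv_mul_cancel₀ h3.ne', Complex.ofReal_one]
  · omega
  · omega
  · simp

theorem orthonormal_monomial {t : ℝ} (ht : -1 < t) : Orthonormal ℂ (monomial ht) := by
  rw [orthonormal_iff_ite]
  intro m n
  rw [inner_monomial ht (g := fun _ => 1) continuousOn_const (n := n) (by simp), toeplitz_one ht]

/-- If `F = z^n q`, then orthogonality to `z^n` says `∫ q |z|^(2n) dλ_t = q(0) ‖z^n‖² = 0`, so `q(0)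
= 0` and another factor `z` splits off. Hence `F` vanishes to infinite order at the origin. -/
theorem eq_zero_of_inner_monomial {t : ℝ} (ht : -1 < t) {f : L2 t} (hf : f ∈ bergman t)
    (h : ∀ n, ⟪monomial ht n, f⟫_ℂ = 0) : f = 0 := by
  have := isProbabilityMeasure_lam ht
  obtain ⟨F, hF, hfF⟩ := hf
  have key : ∀ n : ℕ, ∃ q : ℂ → ℂ, DifferentiableOn ℂ q disk ∧ ∀ z ∈ disk, F z = z ^ n * q z := by
    intro n
    induction n with
    | zero => exact ⟨F, hF, fun z _ => by simp⟩
    | succ n ih =>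
      obtain ⟨q, hq, hFq⟩ := ih
      have hint : Integrable (fun z => conj (z ^ n) * f z) (lam t) := by
        refine (Integrable.const_mul (MemLp.integrable_mul (p := 2) (q := 2)
          (memLp_monomial ht n).star (Lp.memLp f)) (√(gam t n) : ℂ)).congr
            (Eventually.of_forall fun z => ?_)
        have h1 : (√(gam t n) : ℂ) ≠ 0 := by exact_mod_cast (Real.sqrt_pos.2 (gam_pos ht n)).ne'
        simp
        field_simp
      have hae : (fun z => conj (z ^ n) * f z) =ᵐ[lam t] fun z => q z * (((‖z‖ ^ 2) ^ n : ℝ) : ℂ) := by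
        filter_upwards [hfF, ae_lam_mem t] with z h1 h2
        rw [h1, hFq z h2, ← Complex.normSq_eq_norm_sq, Complex.ofReal_pow, Complex.normSq_eq_conj_mul_self,
          map_pow]
        ring
      have hk : Integrable (fun z : ℂ => (((‖z‖ ^ 2) ^ n : ℝ) : ℂ)) (lam t) :=
        (integrable_norm_sq_pow ht n).ofReal
      have hκ : Measurable fun r : ℝ => (r ^ 2) ^ n := by fun_prop
      have h1 : ∫ z, q z * (((‖z‖ ^ 2) ^ n : ℝ) : ℂ) ∂(lam t) =
          q 0 * ∫ z, (((‖z‖ ^ 2) ^ n : ℝ) : ℂ) ∂(lam t) :=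
        integral_lam_mul_radial ht hκ hk hq (hint.congr hae)
      have h2 : ∫ z, conj (z ^ n) * f z ∂(lam t) = 0 := by
        have h3 := h n
        rw [inner_eq_integral] at h3
        have h4 : ∫ z, conj (monomial ht n z) * f z ∂(lam t) =
            (√(gam t n))⁻¹ * ∫ z, conj (z ^ n) * f z ∂(lam t) := by
          rw [← integral_const_mul]
          refine integral_congr_ae ?_
          filter_upwards [coeFn_monomial ht n] with z h5
          rw [h5, map_mul, ← Complex.ofReal_inv, Complex.conj_ofReal, mul_assoc]
        rw [h4] at h3
        refine (mul_eq_zero.1 h3).resolve_left ?_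
        exact Complex.ofReal_ne_zero.2 (inv_ne_zero (Real.sqrt_pos.2 (gam_pos ht n)).ne')
      have h3 : ∫ z : ℂ, (((‖z‖ ^ 2) ^ n : ℝ) : ℂ) ∂(lam t) = gam t n := integral_complex_ofReal
      rw [← integral_congr_ae hae, h2, h3] at h1
      have h4 : q 0 = 0 := (mul_eq_zero.1 h1.symm).resolve_right (by exact_mod_cast (gam_pos ht n).ne')
      refine ⟨dslope q 0, (Complex.differentiableOn_dslope (isOpen_disk.mem_nhds zero_mem_disk)).2 hq, fun z hz => ?_⟩
      have h5 := sub_smul_dslope q 0 z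
      rw [h4, sub_zero, sub_zero, smul_eq_mul] at h5
      rw [hFq z hz, ← h5]
      ring
  have han : AnalyticOnNhd ℂ F disk := hF.analyticOnNhd isOpen_disk
  have h0 := han 0 zero_mem_disk
  have htop : analyticOrderAt F 0 = ⊤ := by
    refine ENat.eq_top_iff_forall_ge.2 fun n => ?_
    rw [natCast_le_analyticOrderAt h0]
    obtain ⟨q, hq, hFq⟩ := key n
    refine ⟨q, hq.analyticOnNhd isOpen_disk 0 zero_mem_disk, ?_⟩
    filter_upwards [isOpen_disk.mem_nhds zero_mem_disk] with z hz
    rw [hFq z hz, sub_zero, smul_eq_mul]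
  have hz := han.eqOn_zero_of_preconnected_of_eventuallyEq_zero
    (convex_ball (0 : ℂ) 1).isPreconnected zero_mem_disk (analyticOrderAt_eq_top.1 htop)
  rw [Lp.eq_zero_iff_ae_eq_zero]
  filter_upwards [hfF, ae_lam_mem t] with z h1 h2
  rw [h1, hz h2]

/-- Parseval's identity for the normalized monomials in the Bergman space. -/
theorem enorm_sq_bergmanProj {t : ℝ} (ht : -1 < t) (f : L2 t) :
    ‖bergmanProj t f‖ₑ ^ 2 = ∑' n, ‖⟪monomial ht n, f⟫_ℂ‖ₑ ^ 2 := by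
  set v : ℕ → bergman t := fun n => ⟨monomial ht n, monomial_mem ht n⟩ with hv
  have hon : Orthonormal ℂ v := by
    rw [orthonormal_iff_ite]
    exact orthonormal_iff_ite.1 (orthonormal_monomial ht)
  have hperp : (Submodule.span ℂ (Set.range v))ᗮ = ⊥ := by
    rw [Submodule.eq_bot_iff]
    intro x hx
    refine Subtype.ext (eq_zero_of_inner_monomial ht x.2 fun n => ?_)
    exact (Submodule.mem_orthogonal _ _).1 hx (v n) (Submodule.subset_span ⟨n, rfl⟩)
  have h1 := enorm_sq_eq_tsum (HilbertBasis.mkOfOrthogonalEqBot hon hperp) ⟨bergmanProj t f, bergmanProj_mem f⟩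
  rw [HilbertBasis.coe_mkOfOrthogonalEqBot] at h1
  refine Eq.trans h1 (tsum_congr fun n => ?_)
  rw [Submodule.coe_inner, ← inner_bergmanProj, bergmanProj_of_mem (monomial_mem ht n)]

/-- Since `H_g = H_g P`, the adjoint maps into the Bergman space, where the monomials form a basis.
Summing the adjoint over a basis of `L²(λ_t)` and exchanging the sums leaves only the monomials. -/
theorem hsNormSq_hankel {t : ℝ} (ht : -1 < t) {g : ℂ → ℂ} (hg : MemLp g ⊤ (lam t)) :
    hsNormSq (hankel t g hg) = ∑' n, ‖hankel t g hg (monomial ht n)‖ₑ ^ 2 := by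
  obtain ⟨s, b, -⟩ := exists_hilbertBasis ℂ (L2 t)
  have h1 : ∀ x, hankel t g hg (bergmanProj t x) = hankel t g hg x := fun x => by
    rw [hankel_apply, hankel_apply, bergmanProj_idem]
  have h2 : ∀ x, bergmanProj t (ContinuousLinearMap.adjoint (hankel t g hg) x) =
      ContinuousLinearMap.adjoint (hankel t g hg) x := fun x => by
    refine ext_inner_left ℂ fun v => ?_
    rw [← inner_bergmanProj, ContinuousLinearMap.adjoint_inner_right, h1,
      ContinuousLinearMap.adjoint_inner_right]
  rw [hsNormSq_eq_tsum b, tsum_enorm_sq_adjoint b b]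
  simp_rw [enorm_sq_eq_tsum b (hankel t g hg _)]
  rw [ENNReal.tsum_comm]
  refine tsum_congr fun i => ?_
  rw [← h2, enorm_sq_bergmanProj ht]
  refine tsum_congr fun n => ?_
  rw [ContinuousLinearMap.adjoint_inner_right, ← ofReal_norm, ← ofReal_norm, norm_inner_symm]

/-! ### The trace of the self-commutator -/

theorem toeplitz_conj {t : ℝ} (ht : -1 < t) {g : ℂ → ℂ} (hg : ContDiffOn ℝ 2 g (closedBall 0 1)) (m n : ℕ) :
    toeplitz t (fun z => conj (g z)) m n = conj (toeplitz t g n m) := by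
  rw [← inner_monomial ht hg.continuousOn (coeFn_mulOp (memLp_top hg t) (monomial ht m)),
    ← inner_monomial ht (contDiffOn_conj hg).continuousOn
      (coeFn_mulOp (memLp_top (contDiffOn_conj hg) t) (monomial ht n)), inner_conj_symm,
    inner_mulOp (memLp_top hg t) (memLp_top (contDiffOn_conj hg) t)]

/-- By the inequality of the means, `|z|^(m+n)/√(γ_m γ_n)` is at most the average of `|z|^(2m)/γ_m`
and `|z|^(2n)/γ_n`, each of integral one. When `B` bounds all radii, it controls the whole diagonal
`m - n`, wherever the entry sits on it. -/
theorem norm_toeplitz_le {t : ℝ} (ht : -1 < t) {g : ℂ → ℂ} {m n : ℕ} {B : ℝ}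
    (hB : ∀ r ∈ Icc (0 : ℝ) 1, ‖circ g ((m : ℤ) - n) r‖ ≤ B) : ‖toeplitz t g m n‖ ≤ B := by
  have hm := gam_pos ht m
  have hn := gam_pos ht n
  have hB0 : 0 ≤ B := (norm_nonneg _).trans (hB 0 (left_mem_Icc.2 zero_le_one))
  have hi := integrable_norm_sq_pow ht
  rw [toeplitz, ← integral_const_mul]
  have h1 : ∫ z, B / 2 * ((gam t m)⁻¹ * (‖z‖ ^ 2) ^ m + (gam t n)⁻¹ * (‖z‖ ^ 2) ^ n) ∂(lam t) = B := by
    rw [integral_const_mul, integral_add ((hi m).const_mul _) ((hi n).const_mul _), integral_const_mul,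
      integral_const_mul, ← gam, ← gam, inv_mul_cancel₀ hm.ne', inv_mul_cancel₀ hn.ne']
    ring
  rw [← h1]
  refine norm_integral_le_of_norm_le ((((hi m).const_mul _).add ((hi n).const_mul _)).const_mul _) ?_
  filter_upwards [ae_lam_mem t] with z hz
  rw [norm_mul, norm_mul, Complex.norm_real, Complex.norm_real, norm_pow, norm_norm, Real.norm_eq_abs,
    abs_of_nonneg (by positivity)]
  have h2 := hB ‖z‖ ⟨norm_nonneg z, (mem_disk.1 hz).le⟩
  have h3 : (√(gam t m))⁻¹ * (√(gam t n))⁻¹ * ‖z‖ ^ (m + n) ≤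
      1 / 2 * ((gam t m)⁻¹ * (‖z‖ ^ 2) ^ m + (gam t n)⁻¹ * (‖z‖ ^ 2) ^ n) := by
    have h4 := two_mul_le_add_sq ((√(gam t m))⁻¹ * ‖z‖ ^ m) ((√(gam t n))⁻¹ * ‖z‖ ^ n)
    rw [mul_pow, mul_pow, inv_pow, inv_pow, Real.sq_sqrt hm.le, Real.sq_sqrt hn.le, ← pow_mul,
      ← pow_mul] at h4
    rw [← pow_mul, ← pow_mul, mul_comm 2 m, mul_comm 2 n, pow_add]
    linarith
  calc _ = ((√(gam t m))⁻¹ * (√(gam t n))⁻¹ * ‖z‖ ^ (m + n)) * ‖circ g ((m : ℤ) - n) ‖z‖‖ := by ring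
    _ ≤ (1 / 2 * ((gam t m)⁻¹ * (‖z‖ ^ 2) ^ m + (gam t n)⁻¹ * (‖z‖ ^ 2) ^ n)) * B := by gcongr
    _ = _ := by ring

theorem tendsto_gam_ratio {t : ℝ} (ht : -1 < t) (k : ℕ) :
    Tendsto (fun n : ℕ => gam t n / gam t (n + k)) atTop (𝓝 1) := by
  have h1 := tendsto_moment ht (φ := fun r => (((r ^ 2) ^ k : ℝ) : ℂ)) (by fun_prop)
  have h2 : Tendsto (fun n : ℕ => ((gam t (n + k) / gam t n : ℝ) : ℂ)) atTop (𝓝 ((1 : ℝ) : ℂ)) := by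
    simp only [one_pow] at h1
    refine h1.congr fun n => ?_
    have e : ∫ z : ℂ, ((‖z‖ ^ 2) ^ n) • ((((‖z‖ ^ 2) ^ k : ℝ)) : ℂ) ∂(lam t) = gam t (n + k) := by
      rw [gam, ← integral_complex_ofReal]
      refine integral_congr_ae (Eventually.of_forall fun z => ?_)
      simp only [Complex.real_smul]
      rw [← Complex.ofReal_mul, pow_add]
    rw [e, Complex.real_smul, ← Complex.ofReal_mul, div_eq_inv_mul]
  have h3 : Tendsto (fun n : ℕ => gam t (n + k) / gam t n) atTop (𝓝 1) := by
    have := (Complex.continuous_re.tendsto _).comp h2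
    simpa [Function.comp_def] using this
  have h4 := h3.inv₀ one_ne_zero
  rw [inv_one] at h4
  exact h4.congr fun n => inv_div _ _

/-- The excess factor `|z|^k` joins `φ` without changing its value at `1`, and the normalizations
`γ_n` and `√(γ_n γ_(n+k))` are asymptotically equal. -/
theorem tendsto_toeplitz_aux {t : ℝ} (ht : -1 < t) {φ : ℝ → ℂ} (hφ : ContinuousOn φ (Icc 0 1)) (k : ℕ) :
    Tendsto (fun n : ℕ => (((√(gam t (n + k)))⁻¹ * (√(gam t n))⁻¹ : ℝ) : ℂ) *
      ∫ z, ((‖z‖ ^ (n + k + n) : ℝ) : ℂ) * φ ‖z‖ ∂(lam t)) atTop (𝓝 (φ 1)) := by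
  have h1 := tendsto_moment ht (φ := fun r => ((r ^ k : ℝ) : ℂ) * φ r)
    (ContinuousOn.mul (by fun_prop) hφ)
  have h2 := ((Complex.continuous_ofReal.comp Real.continuous_sqrt).tendsto 1).comp (tendsto_gam_ratio ht k)
  have h3 := h2.mul h1
  simp only [Function.comp_def, Real.sqrt_one, Complex.ofReal_one, one_pow, one_mul] at h3
  refine h3.congr fun n => ?_
  have hn := gam_pos ht n
  have hnk := gam_pos ht (n + k)
  have e : ∫ z, ((‖z‖ ^ 2) ^ n) • (((‖z‖ ^ k : ℝ) : ℂ) * φ ‖z‖) ∂(lam t) =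
      ∫ z, ((‖z‖ ^ (n + k + n) : ℝ) : ℂ) * φ ‖z‖ ∂(lam t) := by
    refine integral_congr_ae (Eventually.of_forall fun z => ?_)
    simp only [Complex.real_smul]
    rw [← mul_assoc, ← Complex.ofReal_mul]
    congr 2
    ring
  rw [e, Complex.real_smul, ← mul_assoc, ← Complex.ofReal_mul]
  congr 2
  rw [Real.sqrt_div hn.le]
  have e2 : gam t n = √(gam t n) * √(gam t n) := (Real.mul_self_sqrt hn.le).symm
  have e3 : √(gam t n) ≠ 0 := (Real.sqrt_pos.2 hn).ne'
  have e4 : √(gam t (n + k)) ≠ 0 := (Real.sqrt_pos.2 hnk).ne'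
  nth_rewrite 2 [e2]
  field_simp

theorem tendsto_toeplitz {t : ℝ} (ht : -1 < t) {g : ℂ → ℂ} (hg : ContinuousOn g (closedBall 0 1)) (k : ℕ) :
    Tendsto (fun n : ℕ => toeplitz t g (n + k) n) atTop (𝓝 (circ g k 1)) := by
  refine (tendsto_toeplitz_aux ht (continuousOn_circ hg k) k).congr fun n => ?_
  rw [toeplitz, show ((n + k : ℕ) : ℤ) - n = k by push_cast; ring]

theorem tendsto_toeplitz' {t : ℝ} (ht : -1 < t) {g : ℂ → ℂ} (hg : ContinuousOn g (closedBall 0 1)) (k : ℕ) :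
    Tendsto (fun n : ℕ => toeplitz t g n (n + k)) atTop (𝓝 (circ g (-k) 1)) := by
  refine (tendsto_toeplitz_aux ht (continuousOn_circ hg (-k)) k).congr fun n => ?_
  rw [toeplitz, show (n : ℤ) - (n + k : ℕ) = -k by push_cast; ring, add_comm n (n + k), mul_comm (√(gam t n))⁻¹]

/-- Truncated sums of an antisymmetric matrix. -/
theorem sum_tsum_antisymm {s : ℕ → ℕ → ℝ} (hs : ∀ m n, s m n = -s n m) (hsum : ∀ n, Summable (s n)) (M : ℕ) :
    ∑ n ∈ Finset.range M, ∑' m, s n m =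
      ∑ j ∈ Finset.range M, ∑' i, s (M - 1 - j) (M + i) := by
  have h1 : ∑ n ∈ Finset.range M, ∑ m ∈ Finset.range M, s n m = 0 := by
    have h2 : ∑ n ∈ Finset.range M, ∑ m ∈ Finset.range M, s n m =
        -∑ n ∈ Finset.range M, ∑ m ∈ Finset.range M, s n m := by
      conv_rhs => rw [Finset.sum_comm, ← Finset.sum_neg_distrib]
      refine Finset.sum_congr rfl fun n _ => ?_
      rw [← Finset.sum_neg_distrib]
      exact Finset.sum_congr rfl fun m _ => hs n m
    linarith
  -- With the reflection `n = M - 1 - j` and `m = M + i` the distance to the diagonal is `i + j +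
  -- 1`, whatever `M` is.
  rw [Finset.sum_range_reflect (fun n => ∑' i, s n (M + i)) M]
  have h3 : ∀ n, ∑' m, s n m = ∑ m ∈ Finset.range M, s n m + ∑' i, s n (M + i) := fun n => by
    rw [← (hsum n).sum_add_tsum_nat_add M]
    simp_rw [add_comm]
  simp_rw [h3]
  rw [Finset.sum_add_distrib, h1, zero_add]

/-- The antidiagonal of level `n` in `ℕ × ℕ` has `n + 1` points. -/
theorem hasSum_antidiagonal {f : ℕ → ℝ} {a : ℝ} (h : HasSum (fun p : ℕ × ℕ => f (p.1 + p.2)) a) :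
    HasSum (fun n : ℕ => (n + 1 : ℝ) * f n) a := by
  have h1 := (Finset.HasAntidiagonal.sigmaAntidiagonalEquivProd.hasSum_iff).2 h
  refine h1.sigma fun n => ?_
  have h2 := hasSum_fintype fun c : Finset.HasAntidiagonal.antidiagonal n =>
    ((fun p : ℕ × ℕ => f (p.1 + p.2)) ∘ Finset.HasAntidiagonal.sigmaAntidiagonalEquivProd) ⟨n, c⟩
  convert h2 using 1
  have h3 : ∀ c : Finset.HasAntidiagonal.antidiagonal n,
      ((fun p : ℕ × ℕ => f (p.1 + p.2)) ∘ Finset.HasAntidiagonal.sigmaAntidiagonalEquivProd) ⟨n, c⟩ = f n := fun c => by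
    have := Finset.HasAntidiagonal.mem_antidiagonal.1 c.2
    simp [Finset.HasAntidiagonal.sigmaAntidiagonalEquivProd, this]
  simp_rw [h3]
  simp

theorem hasSum_norm_sq {ι E : Type*} [NormedAddCommGroup E] {x : ι → E} (h : ∑' i, ‖x i‖ₑ ^ 2 ≠ ⊤) :
    HasSum (fun i => ‖x i‖ ^ 2) (∑' i, ‖x i‖ₑ ^ 2).toReal := by
  have h1 := ENNReal.hasSum_toReal h
  rw [← ENNReal.tsum_toReal_eq fun i => ENNReal.ne_top_of_tsum_ne_top h i] at h1
  simpa using h1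

/-- Pythagoras `‖f‖² - ‖(I - P) f‖² = ‖P f‖²` for `f = g e_n`, with `‖P f‖²` expanded by Parseval in
the monomials. -/
theorem norm_sq_hankel_monomial {t : ℝ} (ht : -1 < t) {g : ℂ → ℂ} (hg : ContDiffOn ℝ 2 g (closedBall 0 1))
    (n : ℕ) : HasSum (fun m => ‖toeplitz t g m n‖ ^ 2)
      (‖mulOp t g (memLp_top hg t) (monomial ht n)‖ ^ 2 -
        ‖hankel t g (memLp_top hg t) (monomial ht n)‖ ^ 2) := by
  set f := mulOp t g (memLp_top hg t) (monomial ht n) with hf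
  have h1 := enorm_sq_bergmanProj ht f
  have h2 : ∑' m, ‖⟪monomial ht m, f⟫_ℂ‖ₑ ^ 2 ≠ ⊤ := by
    rw [← h1]
    finiteness
  have h3 := hasSum_norm_sq h2
  rw [← h1, ENNReal.toReal_pow, toReal_enorm] at h3
  have h4 : ∀ m, ⟪monomial ht m, f⟫_ℂ = toeplitz t g m n := fun m =>
    inner_monomial ht hg.continuousOn (coeFn_mulOp (memLp_top hg t) (monomial ht n))
  simp_rw [h4] at h3
  have h5 : hankel t g (memLp_top hg t) (monomial ht n) = f - bergmanProj t f := by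
    rw [hankel_apply, bergmanProj_of_mem (monomial_mem ht n)]
  have h6 : ‖f‖ ^ 2 - ‖f - bergmanProj t f‖ ^ 2 = ‖bergmanProj t f‖ ^ 2 := by
    have h7 : ⟪f - bergmanProj t f, bergmanProj t f⟫_ℂ = 0 := by
      rw [← inner_bergmanProj, map_sub, bergmanProj_idem, sub_self, inner_zero_left]
    have h8 := norm_add_sq (𝕜 := ℂ) (f - bergmanProj t f) (bergmanProj t f)
    rw [h7, sub_add_cancel] at h8
    simp at h8
    linarith
  rwa [h5, h6]

theorem norm_mulOp_conj {t : ℝ} {g : ℂ → ℂ} (hg : MemLp g ⊤ (lam t))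
    (hg' : MemLp (fun z => conj (g z)) ⊤ (lam t)) (f : L2 t) : ‖mulOp t _ hg' f‖ = ‖mulOp t g hg f‖ := by
  have h : ‖mulOp t _ hg' f‖ₑ ^ 2 = ‖mulOp t g hg f‖ₑ ^ 2 := by
    rw [enorm_sq_eq_lintegral, enorm_sq_eq_lintegral]
    refine lintegral_congr_ae ?_
    filter_upwards [coeFn_mulOp hg f, coeFn_mulOp hg' f] with z h1 h2
    rw [h1, h2, enorm_mul, enorm_mul, ← ofReal_norm (conj (g z)), RCLike.norm_conj, ofReal_norm]
  have h2 := congrArg ENNReal.toReal h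
  rw [ENNReal.toReal_pow, ENNReal.toReal_pow, toReal_enorm, toReal_enorm] at h2
  exact (pow_left_inj₀ (norm_nonneg _) (norm_nonneg _) two_ne_zero).1 h2

theorem summable_one_div_mul : Summable fun p : ℕ × ℕ => 1 / ((p.1 + 1 : ℝ) ^ 2 * (p.2 + 1 : ℝ) ^ 2) := by
  have h1 : Summable fun n : ℕ => 1 / (n + 1 : ℝ) ^ 2 := by
    have := (summable_nat_add_iff 1).2 (Real.summable_one_div_nat_pow.2 one_lt_two)
    simpa using this
  refine (h1.mul_of_nonneg h1 (fun n => by positivity) fun n => by positivity).congr fun p => ?_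
  rw [one_div_mul_one_div]

/-- The limit of the partial sums of the trace of the self-commutator. -/
theorem tendsto_sum_commutator {t : ℝ} (ht : -1 < t) {g : ℂ → ℂ} (hg : ContDiffOn ℝ 2 g (closedBall 0 1)) :
    Summable (fun p : ℕ × ℕ =>
      ‖circ g (-((p.1 + p.2 + 1 : ℕ) : ℤ)) 1‖ ^ 2 - ‖circ g ((p.1 + p.2 + 1 : ℕ) : ℤ) 1‖ ^ 2) ∧
    Tendsto (fun M : ℕ => ∑ j ∈ Finset.range M, ∑' i,
        (‖toeplitz t g (M - 1 - j) (M + i)‖ ^ 2 - ‖toeplitz t g (M + i) (M - 1 - j)‖ ^ 2)) atTop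
      (𝓝 (∑' p : ℕ × ℕ, (‖circ g (-((p.1 + p.2 + 1 : ℕ) : ℤ)) 1‖ ^ 2 - ‖circ g ((p.1 + p.2 + 1 : ℕ) : ℤ) 1‖ ^ 2))) := by
  obtain ⟨C, hC0, hC⟩ := exists_circ_bound hg
  have hb : ∀ M i j : ℕ, j < M → ‖toeplitz t g (M - 1 - j) (M + i)‖ ≤ C / (j + i + 1 : ℝ) ^ 2 ∧
      ‖toeplitz t g (M + i) (M - 1 - j)‖ ≤ C / (j + i + 1 : ℝ) ^ 2 := by
    intro M i j hj
    have hpos : (0 : ℝ) < (j + i + 1 : ℝ) ^ 2 := by positivity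
    have h1 : ((M - 1 - j : ℕ) : ℤ) - (M + i : ℕ) = -(j + i + 1) := by omega
    have h2 : ((M + i : ℕ) : ℤ) - (M - 1 - j : ℕ) = j + i + 1 := by omega
    refine ⟨norm_toeplitz_le ht fun r hr => ?_, norm_toeplitz_le ht fun r hr => ?_⟩
    · rw [h1, le_div_iff₀ hpos, mul_comm]
      have := (hC (-(j + i + 1)) r hr).2
      push_cast at this
      rwa [neg_sq] at this
    · rw [h2, le_div_iff₀ hpos, mul_comm]
      have := (hC (j + i + 1) r hr).2
      push_cast at this
      exact this
  -- The truncated sums are extended by zero to a fixed index set `ℕ × ℕ`, so that dominated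
  -- convergence for series applies.
  set F : ℕ → ℕ × ℕ → ℝ := fun M p => if p.1 < M then
    ‖toeplitz t g (M - 1 - p.1) (M + p.2)‖ ^ 2 - ‖toeplitz t g (M + p.2) (M - 1 - p.1)‖ ^ 2 else 0 with hF
  have hFb : ∀ M p, ‖F M p‖ ≤ 2 * C ^ 2 * (1 / ((p.1 + 1 : ℝ) ^ 2 * (p.2 + 1 : ℝ) ^ 2)) := by
    intro M p
    simp only [hF]
    split_ifs with hp
    · obtain ⟨h1, h2⟩ := hb M p.2 p.1 hp
      have h3 := pow_le_pow_left₀ (norm_nonneg _) h1 2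
      have h4 := pow_le_pow_left₀ (norm_nonneg _) h2 2
      -- `(j + 1)(i + 1) ≤ (j + i + 1)²` splits the fourth power into a product of two summable
      -- factors.
      have h5 : (C / (p.1 + p.2 + 1 : ℝ) ^ 2) ^ 2 ≤ C ^ 2 * (1 / ((p.1 + 1 : ℝ) ^ 2 * (p.2 + 1 : ℝ) ^ 2)) := by
        rw [div_pow, ← mul_one_div]
        have h6 : (p.1 + 1 : ℝ) ^ 2 * (p.2 + 1 : ℝ) ^ 2 ≤ ((p.1 + p.2 + 1 : ℝ) ^ 2) ^ 2 := by
          rw [← mul_pow]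
          have a1 : (0 : ℝ) ≤ p.1 := Nat.cast_nonneg _
          have a2 : (0 : ℝ) ≤ p.2 := Nat.cast_nonneg _
          refine pow_le_pow_left₀ (by positivity) ?_ 2
          nlinarith
        gcongr
      refine (norm_sub_le _ _).trans ?_
      rw [norm_pow, norm_norm, norm_pow, norm_norm]
      linarith
    · rw [norm_zero]
      positivity
  have hs := summable_one_div_mul.mul_left (2 * C ^ 2)
  have hpt : ∀ p : ℕ × ℕ, Tendsto (fun M => F M p) atTop
      (𝓝 (‖circ g (-((p.1 + p.2 + 1 : ℕ) : ℤ)) 1‖ ^ 2 - ‖circ g ((p.1 + p.2 + 1 : ℕ) : ℤ) 1‖ ^ 2)) := by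
    intro p
    have h1 := ((tendsto_toeplitz' ht hg.continuousOn (p.1 + p.2 + 1)).norm.pow 2).sub
      ((tendsto_toeplitz ht hg.continuousOn (p.1 + p.2 + 1)).norm.pow 2)
    refine (h1.comp (tendsto_sub_atTop_nat (1 + p.1))).congr' ?_
    filter_upwards [eventually_ge_atTop (p.1 + 1)] with M hM
    have e1 : M - (1 + p.1) = M - 1 - p.1 := by omega
    have e2 : M - 1 - p.1 + (p.1 + p.2 + 1) = M + p.2 := by omega
    simp only [Function.comp_apply, hF, e1, e2, if_pos (show p.1 < M by omega)]
  refine ⟨Summable.of_norm_bounded hs fun p => le_of_tendsto (hpt p).norm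
    (Eventually.of_forall fun M => hFb M p), ?_⟩
  have hlim := tendsto_tsum_of_dominated_convergence hs hpt (Eventually.of_forall hFb)
  refine hlim.congr fun M => ?_
  rw [(Summable.of_norm_bounded hs (hFb M)).tsum_prod, tsum_eq_sum (s := Finset.range M)]
  · refine Finset.sum_congr rfl fun j hj => tsum_congr fun i => ?_
    simp only [hF, if_pos (Finset.mem_range.1 hj)]
  · intro j hj
    have : ∀ i, F M (j, i) = 0 := fun i => if_neg (by simpa using hj)
    simp [this]

/-- The difference of the squared Hilbert-Schmidt norms of `H_g` and `H_ḡ`. -/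
theorem hsNormSq_sub {t : ℝ} (ht : -1 < t) {g : ℂ → ℂ} (hg : ContDiffOn ℝ 2 g (closedBall 0 1))
    (h1 : hsNormSq (hankel t g (memLp_top hg t)) ≠ ⊤)
    (h2 : hsNormSq (hankel t _ (memLp_top (contDiffOn_conj hg) t)) ≠ ⊤) :
    (hsNormSq (hankel t g (memLp_top hg t))).toReal -
        (hsNormSq (hankel t _ (memLp_top (contDiffOn_conj hg) t))).toReal =
      Real.pi⁻¹ * ∫ z in disk, (‖dbar g z‖ ^ 2 - ‖del g z‖ ^ 2) := by
  rw [hsNormSq_hankel ht] at h1 h2 ⊢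
  rw [hsNormSq_hankel ht]
  have h3 := ((hasSum_norm_sq h1).sub (hasSum_norm_sq h2)).tendsto_sum_nat
  have hcol := norm_sq_hankel_monomial ht hg
  have hrow : ∀ n, HasSum (fun m => ‖toeplitz t g n m‖ ^ 2)
      (‖mulOp t g (memLp_top hg t) (monomial ht n)‖ ^ 2 -
        ‖hankel t _ (memLp_top (contDiffOn_conj hg) t) (monomial ht n)‖ ^ 2) := fun n => by
    have h4 := norm_sq_hankel_monomial ht (contDiffOn_conj hg) n
    simp_rw [toeplitz_conj ht hg, RCLike.norm_conj] at h4
    rwa [norm_mulOp_conj (memLp_top hg t)] at h4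
  have hd : ∀ n, HasSum (fun m => ‖toeplitz t g n m‖ ^ 2 - ‖toeplitz t g m n‖ ^ 2)
      (‖hankel t g (memLp_top hg t) (monomial ht n)‖ ^ 2 -
        ‖hankel t _ (memLp_top (contDiffOn_conj hg) t) (monomial ht n)‖ ^ 2) := fun n => by
    -- The norms `‖g e_n‖ = ‖ḡ e_n‖`, whose squares need not be summable in `n`, cancel term by term
    -- before any summation over `n`.
    have := (hrow n).sub (hcol n)
    rwa [sub_sub_sub_cancel_left] at this
  obtain ⟨hsm, h5⟩ := tendsto_sum_commutator ht hg
  simp_rw [← (hd _).tsum_eq] at h3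
  have h6 := fun M => sum_tsum_antisymm (s := fun n m => ‖toeplitz t g n m‖ ^ 2 - ‖toeplitz t g m n‖ ^ 2)
    (fun m n => (neg_sub _ _).symm) (fun n => (hd n).summable) M
  simp_rw [h6] at h3
  rw [tendsto_nhds_unique h3 h5]
  have h7 := hasSum_antidiagonal (f := fun n => ‖circ g (-((n + 1 : ℕ) : ℤ)) 1‖ ^ 2 -
    ‖circ g ((n + 1 : ℕ) : ℤ) 1‖ ^ 2) hsm.hasSum
  -- Fold the sum over `ℤ` by pairing `k` with `-k` and shift to `k = n + 1`; the term `k = 0`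
  -- vanishes, so both corrections are zero.
  have h8 := ((hasSum_nat_add_iff' 1).2 (hasSum_circ_one hg).nat_add_neg).neg
  have h9 := h7.unique (h8.congr_fun fun n => by push_cast; ring)
  rw [h9]
  simp

/-! ### The trace formula -/

theorem isHilbertSchmidt_hankel {t : ℝ} (ht : -1 < t) {g : ℂ → ℂ} (hg : ContDiffOn ℝ 2 g (closedBall 0 1)) :
    IsHilbertSchmidt (hankel t g (memLp_top hg t)) := by
  obtain ⟨I, -, hI, -⟩ := lintegral_commutator hg ht
  have h := hsNormSq_add_eq_lintegral ht (memLp_top hg t) (memLp_top (contDiffOn_conj hg) t)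
  rw [hI] at h
  exact ne_top_of_le_ne_top (by rw [h]; exact ENNReal.ofReal_ne_top) le_self_add

/-- Half of sum plus difference of the two squared norms: the integrals of `|∂g|²` cancel and the
factor `2` of the pair term disappears. -/
theorem hsNorm_sq {t : ℝ} (ht : -1 < t) {g : ℂ → ℂ} (hg : ContDiffOn ℝ 2 g (closedBall 0 1)) :
    hsNorm (hankel t g (memLp_top hg t)) ^ 2 = 1 / Real.pi * (∫ z in disk, ‖dbar g z‖ ^ 2) -
      (∫ p in disk ×ˢ disk, pairIntegrand t g p).re := by
  obtain ⟨I, hI0, hI, hIeq⟩ := lintegral_commutator hg ht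
  have h1 := isHilbertSchmidt_hankel ht hg
  have h2 := isHilbertSchmidt_hankel ht (contDiffOn_conj hg)
  have h3 := hsNormSq_sub ht hg h1 h2
  have h4 := hsNormSq_add_eq_lintegral ht (memLp_top hg t) (memLp_top (contDiffOn_conj hg) t)
  rw [hI] at h4
  have h5 := congrArg ENNReal.toReal h4
  rw [ENNReal.toReal_add h1 h2, ENNReal.toReal_ofReal hI0] at h5
  rw [integral_sub (integrableOn_norm_dbar_sq hg) (integrableOn_norm_del_sq hg), mul_sub, ← one_div] at h3
  rw [hsNorm, Real.sq_sqrt ENNReal.toReal_nonneg]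
  linarith

theorem ofReal_re_integral_pairIntegrand (g : ℂ → ℂ) (t : ℝ) :
    (((∫ p in disk ×ˢ disk, pairIntegrand t g p).re : ℝ) : ℂ) =
      ∫ p in disk ×ˢ disk, pairIntegrand t g p :=
  Complex.conj_eq_iff_re.1 (conj_integral_pairIntegrand g t)

end HankelHS

end

theorem mainTheorem4 (g : ℂ → ℂ) (hg : ContDiffOn ℝ 2 g (closedBall 0 1)) :
    (∀ t : ℝ, -1 < t →
      HankelHS.IsHilbertSchmidt (HankelHS.hankel t g (HankelHS.memLp_top hg t)) ∧
      IntegrableOn (fun z => ‖HankelHS.dbar g z‖ ^ 2) HankelHS.disk ∧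
      (∀ s ∈ Ioo (0 : ℝ) 1, IntervalIntegrable (HankelHS.rhoIntegrand t s) volume s 1) ∧
      IntegrableOn (HankelHS.pairIntegrand t g) (HankelHS.disk ×ˢ HankelHS.disk) ∧
      ((HankelHS.hsNorm (HankelHS.hankel t g (HankelHS.memLp_top hg t)) ^ 2 : ℝ) : ℂ) =
        ((1 / Real.pi * ∫ z in HankelHS.disk, ‖HankelHS.dbar g z‖ ^ 2 : ℝ) : ℂ) -
          ∫ p in HankelHS.disk ×ˢ HankelHS.disk, HankelHS.pairIntegrand t g p) ∧
    Tendsto (fun t : ℝ => HankelHS.hsNorm (HankelHS.hankel t g (HankelHS.memLp_top hg t)) ^ 2)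
      atTop (𝓝 (1 / Real.pi * ∫ z in HankelHS.disk, ‖HankelHS.dbar g z‖ ^ 2)) := by
  refine ⟨fun t ht => ⟨HankelHS.isHilbertSchmidt_hankel ht hg, HankelHS.integrableOn_norm_dbar_sq hg,
    fun s hs => ?_, HankelHS.integrableOn_pairIntegrand hg ht, ?_⟩, ?_⟩
  · rw [intervalIntegrable_iff_integrableOn_Ioo_of_le hs.2.le]
    exact HankelHS.integrableOn_rhoIntegrand ht hs
  · rw [HankelHS.hsNorm_sq ht hg, Complex.ofReal_sub, HankelHS.ofReal_re_integral_pairIntegrand]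
  · have h1 := (Complex.continuous_re.tendsto _).comp (HankelHS.tendsto_integral_pairIntegrand hg)
    have h2 := h1.const_sub (1 / Real.pi * ∫ z in HankelHS.disk, ‖HankelHS.dbar g z‖ ^ 2)
    rw [Complex.zero_re, sub_zero] at h2
    refine h2.congr' ?_
    filter_upwards [eventually_gt_atTop (-1)] with t ht
    exact (HankelHS.hsNorm_sq ht hg).symm
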